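/- Fix a finite alphabet $\Sigma$. An NFA is a tuple $A=(Q,\Sigma,\delta,q_0,F)$ with finite state set $Q$, one initial state $q_0$, a set $F$ of final states, and $\delta\subseteq Q\times\Sigma\times Q$ (no $\varepsilon$-transitions); it is unambiguous if every word that it accepts has exactly one accepting run. Inputs are words $x$ over $\{0,1\}$. The pair $(A,0^k)$ with $Q=\{0,\dots,n-1\}$ is encoded as the word consisting of $1^n0$, then $1^{q_0}0$, then the $n$ bits of the characteristic vector of $F$, then the bits of the characteristic vector of $\delta$ in lexicographic order, then $0^k$. Let $$\text{MEM-UFA}=\{((A,0^k),w)\mid A\text{ is an unambiguous NFA with alphabet }\Sigma,\ w\in\Sigma^k,\ w\text{ is accepted by }A\}$$ and $W(x)=\{w\mid (x,w)\in\text{MEM-UFA}\}$; so $W(x)=\emptyset$ if $x$ does not encode a pair $(A,0^k)$ with $A$ unambiguous. The model of computation is the random access machine (RAM) whose only arithmetic operation is addition, with uniform cost measure (each instruction takes one unit of time); in addition a randomized RAM can, in one step, draw an integer uniformly from $\{0,\dots,a-1\}$, where $a$ is the content of a register. Proposition. (1) $\mathrm{ENUM}(\text{MEM-UFA})$ can be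 solved with constant delay: there are a RAM algorithm in two phases, a polynomial $p$ and a constant $c$ such that for every input $x$ the first phase (precomputation) takes time at most $p(|x|)$ and produces no output, and the second phase (enumeration) outputs every word in $W(x)$ exactly once, and nothing else, where, with $\|y\|=\max(1,|y|)$: the time until the first output $y$ is at most $c\,\|y\|$; the time between two consecutive outputs $y$ and $y'$ is at most $c\,\|y'\|$; the time between the last output $y$ and the end of the phase is at most $c\,\|y\|$; and the phase takes time at most $c$ if $W(x)=\emptyset$. (2) There is a polynomial-time algorithm for $\mathrm{COUNT}(\text{MEM-UFA})$: a RAM that on input $x$ outputs $|W(x)|$ in binary within time polynomial in $|x|$. (3) There is a polynomial-time randomized algorithm for $\mathrm{GEN}(\text{MEM-UFA})$: a randomized RAM that on every input $x$, whatever its random choices, halts within time polynomial in $|x|$; if $W(x)\neq\emptyset$, it outputs each $w\in W(x)$ with probability exactly $1/|W(x)|$, and if $W(x)=\emptyset$, it returns $\bot$. -/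

import Mathlib

/-! ## Random access machines with addition, uniform cost measure

A machine has registers, a main memory, a read-only input tape, and an output on which it writes
a sequence of words. Registers and memory cells hold natural numbers, and the only arithmetic
operation is addition. Every executed instruction costs one unit of time. -/

namespace RAM

/-- Instructions; the arguments `d a b s` are indices of registers, `l` is a program address. -/
inductive Instr where
  /-- `R[d] := n` -/
  | const (d n : ℕ)
  /-- `R[d] := R[a]` -/
  | move (d a : ℕ)
  /-- `R[d] := R[a] + R[b]` -/
  | add (d a b : ℕ)
  /-- `R[d] :=` the input symbol at position `R[a]`: `1` for bit 0, `2` for bit 1, and `0` if the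
  input has at most `R[a]` symbols -/
  | input (d a : ℕ)
  /-- `R[d] := M[R[a]]` -/
  | load (d a : ℕ)
  /-- `M[R[a]] := R[s]` -/
  | store (a s : ℕ)
  /-- continue at address `l` -/
  | jump (l : ℕ)
  /-- continue at address `l` if `R[a] < R[b]`, otherwise at the next instruction -/
  | jumpLt (a b l : ℕ)
  /-- append the symbol with number `R[a]` to the output word that is being written -/
  | print (a : ℕ)
  /-- the word that is being written is complete: output it, and start a new empty word -/
  | emit

/-- A program; execution halts when the program counter is not the address of an instruction. -/
abbrev Program := List Instr

/-- A configuration. `log` lists the words that were output, in order, each with the time (the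
value of `clock`, which counts executed instructions) at which its output was completed. -/
structure Config where
  pc : ℕ
  reg : ℕ → ℕ
  mem : ℕ → ℕ
  word : List ℕ
  log : List (List ℕ × ℕ)
  clock : ℕ

/-- The initial configuration: all registers and memory cells are `0`, nothing has been written. -/
def Config.init : Config := ⟨0, fun _ => 0, fun _ => 0, [], [], 0⟩

/-- The words that were output, in order. -/
def Config.outputs (c : Config) : List (List ℕ) := c.log.map Prod.fst

/-- Continue at the next instruction, after setting register `d` to `v`. -/
def Config.setReg (c : Config) (d v : ℕ) : Config :=
  { c with pc := c.pc + 1, reg := Function.update c.reg d v, clock := c.clock + 1 }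

/-- The content, as seen by the machine, of position `i` of the input `x`. -/
def inputSymbol (x : List Bool) (i : ℕ) : ℕ :=
  match x[i]? with
  | none => 0
  | some false => 1
  | some true => 2

/-- The effect of one instruction on input `x`. -/
def Instr.exec (x : List Bool) : Instr → Config → Config
  | .const d n, c => c.setReg d n
  | .move d a, c => c.setReg d (c.reg a)
  | .add d a b, c => c.setReg d (c.reg a + c.reg b)
  | .input d a, c => c.setReg d (inputSymbol x (c.reg a))
  | .load d a, c => c.setReg d (c.mem (c.reg a))
  | .store a s, c =>
      { c with pc := c.pc + 1, mem := Function.update c.mem (c.reg a) (c.reg s),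
               clock := c.clock + 1 }
  | .jump l, c => { c with pc := l, clock := c.clock + 1 }
  | .jumpLt a b l, c =>
      { c with pc := if c.reg a < c.reg b then l else c.pc + 1, clock := c.clock + 1 }
  | .print a, c =>
      { c with pc := c.pc + 1, word := c.word ++ [c.reg a], clock := c.clock + 1 }
  | .emit, c =>
      { c with pc := c.pc + 1, word := [], log := c.log ++ [(c.word, c.clock + 1)],
               clock := c.clock + 1 }

/-- One step of a program on input `x`; a halted configuration stays as it is. -/
def step (P : Program) (x : List Bool) (c : Config) : Config :=
  match P[c.pc]? with
  | none => c
  | some i => i.exec x c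

/-- The configuration after `t` steps (or at halting, if this is earlier). -/
def run (P : Program) (x : List Bool) (c : Config) (t : ℕ) : Config := (step P x)^[t] c

/-- In configuration `c` the program has halted, with no unfinished output word. -/
def Halted {ι : Type} (P : List ι) (c : Config) : Prop := P.length ≤ c.pc ∧ c.word = []

/-- Instructions of randomized machines. -/
inductive RandInstr where
  /-- a deterministic instruction -/
  | det (i : Instr)
  /-- `R[d] :=` a uniformly random element of `{0, …, R[a] - 1}`, independent of all other random
  draws (and `R[d] := 0` if `R[a] = 0`) -/
  | rand (d a : ℕ)

/-- A randomized program. -/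
abbrev RandProgram := List RandInstr

/-- The distribution of the configuration after one randomized instruction. -/
noncomputable def RandInstr.exec (x : List Bool) : RandInstr → Config → PMF Config
  | .det i, c => PMF.pure (i.exec x c)
  | .rand d a, c =>
      (PMF.uniformOfFinset (Finset.range (max 1 (c.reg a))) ⟨0, by simp⟩).map (c.setReg d)

/-- The distribution of the configuration after one step of a randomized program. -/
noncomputable def randStep (P : RandProgram) (x : List Bool) (c : Config) : PMF Config :=
  match P[c.pc]? with
  | none => PMF.pure c
  | some i => i.exec x c

/-- The distribution of the configuration after `t` steps of a randomized program. -/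
noncomputable def randRun (P : RandProgram) (x : List Bool) (c : Config) : ℕ → PMF Config
  | 0 => PMF.pure c
  | t + 1 => (randRun P x c t).bind (randStep P x)

end RAM

/-! ## Enumeration, counting and uniform generation of the witnesses of a relation

Inputs are words over `{0, 1}` and witnesses are words over an alphabet with `σ` symbols, which
machines write as the numbers `0, …, σ - 1`. -/

/-- The set `W_R(x)` of witnesses for `x`. -/
def witnesses {σ : ℕ} (R : List Bool → List (Fin σ) → Prop) (x : List Bool) :
    Set (List (Fin σ)) := {y | R x y}

/-- A word as it is written by a machine. -/
def written {σ : ℕ} (y : List (Fin σ)) : List ℕ := y.map Fin.val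

/-- The delays of an enumeration phase that started at time `0` and is over in configuration `f`:
the time before the first output `y` is at most `c · |y|`, the time between two consecutive
outputs `y` and `y'` is at most `c · |y'|`, and the time between the last output `y` and the end is
at most `c · |y|`, where the empty word counts as a word of length 1. If there is no output at all,
the phase takes time at most `c`. -/
def DelaysBoundedBy (c : ℕ) (f : RAM.Config) : Prop :=
  (∀ e, f.log.head? = some e → e.2 ≤ c * max 1 e.1.length) ∧
  f.log.IsChain (fun e e' => e'.2 ≤ e.2 + c * max 1 e'.1.length) ∧
  (∀ e, f.log.getLast? = some e → f.clock ≤ e.2 + c * max 1 e.1.length) ∧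
  (f.log = [] → f.clock ≤ c)

/-- `ENUM(R)` can be solved with constant delay: there are a program `P` for the precomputation
phase and a program `E` for the enumeration phase, which starts with the registers and the memory
that the precomputation phase left, such that for every input the precomputation takes polynomial
time and outputs nothing, and the enumeration phase outputs every witness exactly once, and
nothing else, with delays bounded by a constant times the length of the output. -/
def EnumConstantDelay {σ : ℕ} (R : List Bool → List (Fin σ) → Prop) : Prop :=
  ∃ (P E : RAM.Program) (p : Polynomial ℕ) (c : ℕ), ∀ x : List Bool,
    let s : RAM.Config := RAM.run P x .init (p.eval x.length)
    RAM.Halted P s ∧ s.log = [] ∧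
    ∃ t : ℕ,
      let f : RAM.Config := RAM.run E x { RAM.Config.init with reg := s.reg, mem := s.mem } t
      RAM.Halted E f ∧
      (∃ ys : List (List (Fin σ)),
        ys.Nodup ∧ (∀ y, y ∈ ys ↔ y ∈ witnesses R x) ∧ f.outputs = ys.map written) ∧
      DelaysBoundedBy c f

/-- The binary representation of `n`, most significant bit first, without leading zeros. -/
def binaryRepr (n : ℕ) : List ℕ := if n = 0 then [0] else (Nat.digits 2 n).reverse

/-- There is a polynomial-time algorithm for `COUNT(R)`, with output in binary. -/
def CountPolyTime {σ : ℕ} (R : List Bool → List (Fin σ) → Prop) : Prop :=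
  ∃ (P : RAM.Program) (p : Polynomial ℕ), ∀ x : List Bool,
    (witnesses R x).Finite ∧
    RAM.Halted P (RAM.run P x .init (p.eval x.length)) ∧
    (RAM.run P x .init (p.eval x.length)).outputs = [binaryRepr (witnesses R x).ncard]

/-- There is a polynomial-time randomized algorithm for `GEN(R)`: whatever the random choices, it
halts in polynomial time; if there are witnesses, then its output is each of them with probability
`1 / |W_R(x)|`; if there is none, it returns `⊥`, that is, it halts without having output a word. -/
def GenPolyTime {σ : ℕ} (R : List Bool → List (Fin σ) → Prop) : Prop :=
  ∃ (P : RAM.RandProgram) (p : Polynomial ℕ), ∀ x : List Bool,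
    let D : PMF RAM.Config := RAM.randRun P x .init (p.eval x.length)
    (witnesses R x).Finite ∧
    (∀ f ∈ D.support, RAM.Halted P f) ∧
    (∀ y ∈ witnesses R x,
      D.map RAM.Config.outputs [written y] = ((witnesses R x).ncard : ENNReal)⁻¹) ∧
    (witnesses R x = ∅ → D.map RAM.Config.outputs [] = 1)

/-! ## Unambiguous automata -/

/-- A nondeterministic finite automaton without `ε`-transitions, with one initial state, with
states `0, …, n - 1`, over the alphabet `{0, …, σ - 1}`, given by explicit finite data. -/
structure FinNFA (σ : ℕ) where
  n : ℕ
  start : Fin n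
  accept : Fin n → Bool
  trans : Fin n → Fin σ → Fin n → Bool

namespace FinNFA

variable {σ : ℕ}

/-- The automaton as one of Mathlib's. -/
def toNFA (A : FinNFA σ) : NFA (Fin σ) (Fin A.n) where
  step q a := {q' | A.trans q a q' = true}
  start := {A.start}
  accept := {q | A.accept q = true}

/-- `r` is the sequence of states of an accepting run of `A` on `w`. -/
def IsAcceptingRun (A : FinNFA σ) (w : List (Fin σ)) (r : Fin (w.length + 1) → Fin A.n) : Prop :=
  r 0 = A.start ∧
  (∀ i : Fin w.length, A.trans (r i.castSucc) (w.get i) (r i.succ) = true) ∧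
  A.accept (r (Fin.last w.length)) = true

/-- Every accepted word has exactly one accepting run. -/
def Unambiguous (A : FinNFA σ) : Prop :=
  ∀ w ∈ A.toNFA.accepts, ∃! r, A.IsAcceptingRun w r

/-- The encoding of `(A, 0^k)`: the number of states and the initial state in unary, each closed by
a `0`, the characteristic vector of the set of final states, the characteristic vector of the
transition relation in lexicographic order, and then `0^k`. Here `false` stands for the bit 0. -/
def encode (A : FinNFA σ) (k : ℕ) : List Bool :=
  List.replicate A.n true ++ [false] ++
  List.replicate A.start.val true ++ [false] ++
  List.ofFn A.accept ++
  (List.ofFn fun q => (List.ofFn fun a => List.ofFn fun q' => A.trans q a q').flatten).flatten ++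
  List.replicate k false

end FinNFA

/-- The relation `MEM-UFA`: pairs `((A, 0^k), w)` such that `A` is an unambiguous NFA and `w` is a
word of length `k` that `A` accepts. An input that encodes no such pair has no witnesses. -/
def MemUFA (σ : ℕ) (x : List Bool) (w : List (Fin σ)) : Prop :=
  ∃ (A : FinNFA σ) (k : ℕ),
    x = A.encode k ∧ A.Unambiguous ∧ w.length = k ∧ w ∈ A.toNFA.accepts

/-! Everything rests on one recursion. Number the edges at each state, and let `wordList i q e` list
the words of length `i` read along accepting runs from `q` whose first edge, if `i` is positive, has
a number below `e`, with one entry per run. If no word has two accepting runs from the initial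
state, then by `nodup_wordList` and `mem_wordList` the list for length `k` and the initial state
contains every witness exactly once. The lengths of these lists obey a recursion that only adds, so
a table of polynomially many numbers gives the count; the numbers may be exponentially large, but an
addition costs one step. The binary digits of the count come from comparisons with powers of two
(`div_two_pow`).

Unambiguity has to be tested. Two different accepting runs on one word are a path in a graph on
triples `(p, q, d)`, where the bit `d` says whether the two runs have already separated. The graph
has `2 * n ^ 2` vertices, so paths of smaller length suffice (`unambiguous_iff_twin`), and
reachability level by level is again a table.

For generation, a single number is drawn below the count, and the word with this number is rebuilt
letter by letter: the table tells how many words begin with smaller edges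
(`exists_edge_of_getElem?`, `Generating.step`). One draw from a range of exactly the right size
makes the output exactly uniform.

For enumeration, the recursion becomes a linked structure: one node for each edge that has at least
one continuation, with a pointer to the continuations and a pointer to the next such edge. There are
no dead ends. Hence the next word arises by returning to the last node on the current path that has
an alternative, and following first continuations from there (`Path.lastBranch`, `Pending.path`).
This takes time linear in the length of the word (`reach_outputWord`).

On the machine level, all polynomial-time parts are written in a language whose sums and loops share
one bound `L`, linear in the length of the input; time polynomial in `L` is then automatic
(`Expr.reach_code`, `Cmd.reach_code`), and multiplication, subtraction and division are sums. Only
the enumeration phase is written directly as a structured program with an explicit count of steps,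
since there the constants matter. -/

/-! ## Structured programs

A small structured language that is compiled to random access machine code. -/

namespace RAM

/-- A configuration without the program counter. -/
structure St where
  reg : ℕ → ℕ
  mem : ℕ → ℕ
  word : List ℕ
  log : List (List ℕ × ℕ)
  clock : ℕ

/-- The configuration with program counter `pc`. -/
def St.at (s : St) (pc : ℕ) : Config := ⟨pc, s.reg, s.mem, s.word, s.log, s.clock⟩

def St.init : St := ⟨fun _ => 0, fun _ => 0, [], [], 0⟩

/-- One unit of time passes. -/
def St.tick (s : St) : St := { s with clock := s.clock + 1 }

def St.set (s : St) (d v : ℕ) : St :=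
  { s with reg := Function.update s.reg d v, clock := s.clock + 1 }

@[simp] theorem St.tick_reg (s : St) : s.tick.reg = s.reg := rfl
@[simp] theorem St.tick_mem (s : St) : s.tick.mem = s.mem := rfl
@[simp] theorem St.tick_word (s : St) : s.tick.word = s.word := rfl
@[simp] theorem St.tick_log (s : St) : s.tick.log = s.log := rfl
@[simp] theorem St.tick_clock (s : St) : s.tick.clock = s.clock + 1 := rfl
@[simp] theorem St.set_reg (s : St) (d v : ℕ) : (s.set d v).reg = Function.update s.reg d v := rfl
@[simp] theorem St.set_mem (s : St) (d v : ℕ) : (s.set d v).mem = s.mem := rfl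
@[simp] theorem St.set_word (s : St) (d v : ℕ) : (s.set d v).word = s.word := rfl
@[simp] theorem St.set_log (s : St) (d v : ℕ) : (s.set d v).log = s.log := rfl
@[simp] theorem St.set_clock (s : St) (d v : ℕ) : (s.set d v).clock = s.clock + 1 := rfl

/-- The instructions that are not jumps. -/
inductive Op where
  | const (d n : ℕ)
  | move (d a : ℕ)
  | add (d a b : ℕ)
  | input (d a : ℕ)
  | load (d a : ℕ)
  | store (a s : ℕ)
  | print (a : ℕ)
  | emit

def Op.toInstr : Op → Instr
  | .const d n => .const d n
  | .move d a => .move d a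
  | .add d a b => .add d a b
  | .input d a => .input d a
  | .load d a => .load d a
  | .store a s => .store a s
  | .print a => .print a
  | .emit => .emit

@[simp] def Op.act (x : List Bool) : Op → St → St
  | .const d n, s => s.set d n
  | .move d a, s => s.set d (s.reg a)
  | .add d a b, s => s.set d (s.reg a + s.reg b)
  | .input d a, s => s.set d (inputSymbol x (s.reg a))
  | .load d a, s => s.set d (s.mem (s.reg a))
  | .store a r, s =>
      { s with mem := Function.update s.mem (s.reg a) (s.reg r), clock := s.clock + 1 }
  | .print a, s => { s with word := s.word ++ [s.reg a], clock := s.clock + 1 }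
  | .emit, s =>
      { s with word := [], log := s.log ++ [(s.word, s.clock + 1)], clock := s.clock + 1 }

theorem Op.exec_toInstr (x : List Bool) (o : Op) (s : St) (pc : ℕ) :
    o.toInstr.exec x (s.at pc) = (o.act x s).at (pc + 1) := by
  cases o <;> rfl

theorem Op.act_clock (x : List Bool) (o : Op) (s : St) : (o.act x s).clock = s.clock + 1 := by
  cases o <;> rfl

/-- Structured programs; tests compare two registers. -/
inductive Stm where
  | skip
  | op (o : Op)
  | seq (S T : Stm)
  | ite (a b : ℕ) (S T : Stm)
  | whileLt (a b : ℕ) (S : Stm)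

infixr:60 " ;; " => Stm.seq

namespace Stm

/-- The constants count jumps. In an `ite` the else branch comes first and ends with a jump over the
then branch; a loop has its test, the exit jump and the jump back. -/
def size : Stm → ℕ
  | skip => 0
  | op _ => 1
  | seq S T => S.size + T.size
  | ite _ _ S T => T.size + S.size + 2
  | .whileLt _ _ S => S.size + 3

/-- The machine code of a structured program, placed at address `off`. -/
def code : Stm → ℕ → List Instr
  | skip, _ => []
  | op o, _ => [o.toInstr]
  | seq S T, off => S.code off ++ T.code (off + S.size)
  | ite a b S T, off =>
      .jumpLt a b (off + 2 + T.size) :: (T.code (off + 1) ++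
        .jump (off + 2 + T.size + S.size) :: S.code (off + 2 + T.size))
  | .whileLt a b S, off =>
      .jumpLt a b (off + 2) :: .jump (off + 3 + S.size) :: (S.code (off + 2) ++ [.jump off])

@[simp] theorem length_code (S : Stm) : ∀ off, (S.code off).length = S.size := by
  induction S with
  | skip => intro _; rfl
  | op o => intro _; rfl
  | seq S T hS hT => intro _; simp [code, size, hS, hT]
  | ite a b S T hS hT => intro _; simp [code, size, hS, hT]; omega
  | whileLt a b S hS => intro _; simp [code, size, hS]

end Stm

/-- Big-step semantics of structured programs. -/
inductive Exec (x : List Bool) : Stm → St → St → Prop where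
  | skip (s : St) : Exec x .skip s s
  | op (o : Op) (s : St) : Exec x (.op o) s (o.act x s)
  | seq {S T : Stm} {s s' s'' : St} : Exec x S s s' → Exec x T s' s'' → Exec x (.seq S T) s s''
  | iteTrue {a b : ℕ} {S T : Stm} {s s' : St} : s.reg a < s.reg b → Exec x S s.tick s' →
      Exec x (.ite a b S T) s s'
  | iteFalse {a b : ℕ} {S T : Stm} {s s' : St} : ¬ s.reg a < s.reg b → Exec x T s.tick s' →
      Exec x (.ite a b S T) s s'.tick
  | whileTrue {a b : ℕ} {S : Stm} {s s' s'' : St} : s.reg a < s.reg b → Exec x S s.tick s' →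
      Exec x (.whileLt a b S) s'.tick s'' → Exec x (.whileLt a b S) s s''
  | whileFalse {a b : ℕ} {S : Stm} {s : St} : ¬ s.reg a < s.reg b →
      Exec x (.whileLt a b S) s s.tick.tick

/-- `t` instructions, fetched by `get`, lead from `c` to `c'`. -/
inductive Steps (get : ℕ → Option Instr) (x : List Bool) : ℕ → Config → Config → Prop where
  | refl (c : Config) : Steps get x 0 c c
  | step {t : ℕ} {c c' : Config} (i : Instr) : get c.pc = some i →
      Steps get x t (i.exec x c) c' → Steps get x (t + 1) c c'

theorem Steps.trans {get : ℕ → Option Instr} {x : List Bool} {t t' : ℕ} {c c' c'' : Config}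
    (h : Steps get x t c c') (h' : Steps get x t' c' c'') : Steps get x (t + t') c c'' := by
  induction h with
  | refl => simpa using h'
  | step i hi _ ih => rw [Nat.add_right_comm]; exact .step i hi (ih h')

theorem Steps.one {get : ℕ → Option Instr} {x : List Bool} {c : Config} {i : Instr}
    (hi : get c.pc = some i) : Steps get x 1 c (i.exec x c) := .step i hi (.refl _)

/-- The instructions `l` are found at the addresses from `off` on. -/
def CodeAt (get : ℕ → Option Instr) : ℕ → List Instr → Prop
  | _, [] => True
  | off, i :: l => get off = some i ∧ CodeAt get (off + 1) l

theorem codeAt_append {get : ℕ → Option Instr} (l l' : List Instr) : ∀ off : ℕ,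
    CodeAt get off (l ++ l') ↔ CodeAt get off l ∧ CodeAt get (off + l.length) l' := by
  induction l with
  | nil => simp [CodeAt]
  | cons i l ih =>
    intro off
    simp [CodeAt, ih, and_assoc, Nat.add_assoc, Nat.add_comm 1]

theorem codeAt_of_getElem? {get : ℕ → Option Instr} (l : List Instr) : ∀ off : ℕ,
    (∀ i, i < l.length → get (off + i) = l[i]?) → CodeAt get off l := by
  induction l with
  | nil => intros; trivial
  | cons i l ih =>
    intro off h
    refine ⟨by simpa using h 0 (by simp), ih _ fun j hj => ?_⟩
    have := h (j + 1) (by simpa using hj)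
    simpa [Nat.add_assoc, Nat.add_comm 1] using this

/-- The ticks in `Exec` stand for exactly the jumps that the compiled code executes, so the clock
counts machine instructions. Code is found through a function `get` rather than in a program, so
that the result also applies to the deterministic stretches of a randomized program. -/
theorem Exec.steps {x : List Bool} {S : Stm} {s s' : St} (h : Exec x S s s')
    {get : ℕ → Option Instr} : ∀ off : ℕ, CodeAt get off (S.code off) →
    ∃ t, s'.clock = s.clock + t ∧ Steps get x t (s.at off) (s'.at (off + S.size)) := by
  induction h with
  | skip s => intro off _; exact ⟨0, rfl, .refl _⟩
  | op o s =>
    intro off h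
    refine ⟨1, o.act_clock x s, ?_⟩
    have := Steps.one (x := x) (c := s.at off) h.1
    rwa [Op.exec_toInstr] at this
  | seq _ _ ih ih' =>
    intro off h
    simp only [Stm.code, codeAt_append, Stm.length_code] at h
    obtain ⟨t, ht, hs⟩ := ih off h.1
    obtain ⟨t', ht', hs'⟩ := ih' _ h.2
    refine ⟨t + t', by omega, ?_⟩
    simp only [Stm.size, ← Nat.add_assoc]
    exact hs.trans hs'
  | @iteTrue a b S T s s' hlt _ ih =>
    intro off h
    simp only [Stm.code, CodeAt, codeAt_append, Stm.length_code] at h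
    obtain ⟨h1, h2, h3, h4⟩ := h
    obtain ⟨t, ht, hs⟩ := ih (off + 2 + T.size) (by
      convert h4 using 1; omega)
    refine ⟨1 + t, by simp at ht; omega, ?_⟩
    have := Steps.one (x := x) (c := s.at off) h1
    have e : (Instr.jumpLt a b (off + 2 + T.size)).exec x (s.at off) =
        s.tick.at (off + 2 + T.size) := by
      simp [Instr.exec, St.at, St.tick, hlt]
    rw [e] at this
    convert this.trans hs using 2
    simp only [Stm.size]; omega
  | @iteFalse a b S T s s' hlt _ ih =>
    intro off h
    simp only [Stm.code, CodeAt, codeAt_append, Stm.length_code] at h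
    obtain ⟨h1, h2, h3, h4⟩ := h
    obtain ⟨t, ht, hs⟩ := ih (off + 1) h2
    refine ⟨1 + t + 1, by simp at ht ⊢; omega, ?_⟩
    have := Steps.one (x := x) (c := s.at off) h1
    have e : (Instr.jumpLt a b (off + 2 + T.size)).exec x (s.at off) = s.tick.at (off + 1) := by
      simp [Instr.exec, St.at, St.tick, hlt]
    rw [e] at this
    have h5 := Steps.one (x := x) (c := s'.at (off + 1 + T.size)) h3
    convert (this.trans hs).trans h5 using 1
    simp only [Instr.exec, St.at, St.tick, Stm.size]
    congr 1; omega
  | @whileTrue a b S s s' s'' hlt _ _ ih ih' =>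
    intro off h
    obtain ⟨t', ht', hs'⟩ := ih' off h
    simp only [Stm.code, CodeAt, codeAt_append, Stm.length_code] at h
    obtain ⟨h1, h2, h3, h4, -⟩ := h
    obtain ⟨t, ht, hs⟩ := ih (off + 2) (by convert h3 using 1)
    refine ⟨1 + t + 1 + t', by simp at ht ht'; omega, ?_⟩
    have := Steps.one (x := x) (c := s.at off) h1
    have e : (Instr.jumpLt a b (off + 2)).exec x (s.at off) = s.tick.at (off + 2) := by
      simp [Instr.exec, St.at, St.tick, hlt]
    rw [e] at this
    have h5 := Steps.one (x := x) (c := s'.at (off + 2 + S.size)) h4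
    exact ((this.trans hs).trans h5).trans hs'
  | @whileFalse a b S s hlt =>
    intro off h
    simp only [Stm.code, CodeAt, codeAt_append, Stm.length_code] at h
    obtain ⟨h1, h2, -⟩ := h
    refine ⟨2, rfl, ?_⟩
    have := Steps.one (x := x) (c := s.at off) h1
    have e : (Instr.jumpLt a b (off + 2)).exec x (s.at off) = s.tick.at (off + 1) := by
      simp [Instr.exec, St.at, St.tick, hlt]
    rw [e] at this
    have h5 := Steps.one (x := x) (c := s.tick.at (off + 1)) h2
    convert this.trans h5 using 1
    simp only [Instr.exec, St.at, St.tick, Stm.size]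
    congr 1; omega

theorem Exec.clock_le {x : List Bool} {S : Stm} {s s' : St} (h : Exec x S s s') :
    s.clock ≤ s'.clock := by
  induction h with
  | op o s => rw [Op.act_clock]; omega
  | _ => (try simp only [St.tick_clock] at *); omega

/-! ### Deterministic and randomized runs -/

theorem Steps.run_eq {P : Program} {x : List Bool} {t : ℕ} {c c' : Config}
    (h : Steps (fun i => P[i]?) x t c c') : run P x c t = c' := by
  induction h with
  | refl => rfl
  | step i hi _ ih => rw [← ih, run, Function.iterate_succ_apply, RAM.step, hi]; rfl

theorem run_of_halted {P : Program} (x : List Bool) {c : Config} (h : P.length ≤ c.pc) (t : ℕ) :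
    run P x c t = c := by
  have : step P x c = c := by simp [step, List.getElem?_eq_none h]
  exact Function.iterate_fixed this t

theorem Steps.run_eq_of_le {P : Program} {x : List Bool} {t T : ℕ} {c c' : Config}
    (h : Steps (fun i => P[i]?) x t c c') (hc : P.length ≤ c'.pc) (hT : t ≤ T) :
    run P x c T = c' := by
  obtain ⟨m, rfl⟩ := Nat.exists_eq_add_of_le hT
  rw [run, Nat.add_comm, Function.iterate_add_apply]
  have := h.run_eq
  rw [run] at this
  rw [this]
  exact run_of_halted x hc m

/-- A halted configuration is a fixed point of `step`, so an upper bound of the time is as good as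
the exact time. -/
theorem Exec.run_eq {x : List Bool} {S : Stm} {s s' : St} (h : Exec x S s s') {T : ℕ}
    (hT : s'.clock ≤ s.clock + T) : run (S.code 0) x (s.at 0) T = s'.at S.size := by
  obtain ⟨t, ht, hs⟩ := h.steps (get := fun i => (S.code 0)[i]?) 0
    (codeAt_of_getElem? _ _ fun i _ => by simp)
  rw [Nat.zero_add] at hs
  exact hs.run_eq_of_le (by simp [St.at]) (by omega)

/-- The instruction at an address of a randomized program, if it is deterministic. -/
def RandInstr.det? : RandInstr → Option Instr
  | .det i => some i
  | .rand _ _ => none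

theorem randRun_add (P : RandProgram) (x : List Bool) (c : Config) (t t' : ℕ) :
    randRun P x c (t + t') = (randRun P x c t).bind fun c' => randRun P x c' t' := by
  induction t' with
  | zero => simp [randRun]
  | succ t' ih => rw [← Nat.add_assoc, randRun, ih, PMF.bind_bind]; rfl

theorem Steps.randRun_eq {P : RandProgram} {x : List Bool} {t : ℕ} {c c' : Config}
    (h : Steps (fun i => P[i]?.bind RandInstr.det?) x t c c') :
    randRun P x c t = PMF.pure c' := by
  induction h with
  | refl => rfl
  | @step t c c' i hi _ ih =>
    rw [Nat.add_comm, randRun_add, randRun, randRun, PMF.pure_bind]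
    have : randStep P x c = PMF.pure (i.exec x c) := by
      obtain ⟨j, hj, hj'⟩ := Option.bind_eq_some_iff.1 hi
      cases j with
      | det j =>
        simp only [RandInstr.det?, Option.some.injEq] at hj'
        subst hj'
        simp [randStep, hj, RandInstr.exec]
      | rand _ _ => simp [RandInstr.det?] at hj'
    rw [this, PMF.pure_bind, ih]

theorem randRun_of_halted {P : RandProgram} (x : List Bool) {c : Config} (h : P.length ≤ c.pc)
    (t : ℕ) : randRun P x c t = PMF.pure c := by
  induction t with
  | zero => rfl
  | succ t ih => simp [randRun, ih, randStep, List.getElem?_eq_none h]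

theorem Steps.randRun_eq_of_le {P : RandProgram} {x : List Bool} {t T : ℕ} {c c' : Config}
    (h : Steps (fun i => P[i]?.bind RandInstr.det?) x t c c') (hc : P.length ≤ c'.pc)
    (hT : t ≤ T) : randRun P x c T = PMF.pure c' := by
  obtain ⟨m, rfl⟩ := Nat.exists_eq_add_of_le hT
  rw [randRun_add, h.randRun_eq, PMF.pure_bind, randRun_of_halted x hc]

/-- A program that draws a single random number, into register `d` from the range given by
register `a`, between two deterministic parts. -/
def drawOnce (S : Stm) (d a : ℕ) (T : Stm) : RandProgram :=
  (S.code 0).map .det ++ .rand d a :: (T.code (S.size + 1)).map .det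

/-- Before and after the only draw the run is deterministic, so the final distribution is the image
of the uniform one under the map from the drawn number to the final state. -/
theorem randRun_drawOnce {x : List Bool} {S T : Stm} {d a : ℕ} {s s' : St} (hS : Exec x S s s')
    {g : ℕ → St} (hT : ∀ r < max 1 (s'.reg a), Exec x T (s'.set d r) (g r)) {B : ℕ}
    (hB : ∀ r < max 1 (s'.reg a), (g r).clock ≤ s.clock + B) :
    randRun (drawOnce S d a T) x (s.at 0) B =
      (PMF.uniformOfFinset (Finset.range (max 1 (s'.reg a))) ⟨0, by simp⟩).map
        fun r => (g r).at (S.size + 1 + T.size) := by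
  set P := drawOnce S d a T with hP
  have hlen : P.length = S.size + 1 + T.size := by simp [hP, drawOnce]; omega
  obtain ⟨t, ht, hs⟩ := hS.steps (get := fun i => P[i]?.bind RandInstr.det?) 0
    (codeAt_of_getElem? _ _ fun i hi => by
      have hi' : i < S.size := by simpa using hi
      simp [hP, drawOnce, List.getElem?_append_left, hi', RandInstr.det?])
  rw [Nat.zero_add] at hs
  -- The draw `0` is always possible; its run shows that `B` covers the first part and the draw
  -- itself.
  have h0 := hB 0 (by simp)
  have h1 := (hT 0 (by simp)).clock_le
  simp only [St.set_clock] at h1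
  obtain ⟨m, rfl⟩ : ∃ m, B = t + (1 + m) := ⟨B - t - 1, by omega⟩
  have hstep : randRun P x (s'.at S.size) 1 =
      (PMF.uniformOfFinset (Finset.range (max 1 (s'.reg a))) ⟨0, by simp⟩).map
        fun r => (s'.set d r).at (S.size + 1) := by
    have : P[S.size]? = some (.rand d a) := by
      simp [hP, drawOnce]
    rw [randRun, randRun, PMF.pure_bind, randStep]
    simp only [St.at, this]
    rfl
  rw [randRun_add, hs.randRun_eq, PMF.pure_bind, randRun_add, hstep, PMF.bind_map]
  rw [← PMF.bind_pure_comp]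
  ext c
  rw [PMF.bind_apply, PMF.bind_apply]
  refine tsum_congr fun r => ?_
  by_cases hr : r < max 1 (s'.reg a)
  · obtain ⟨t', ht', hs'⟩ := (hT r hr).steps (get := fun i => P[i]?.bind RandInstr.det?)
      (S.size + 1) (codeAt_of_getElem? _ _ fun i hi => by
        have hi' : i < T.size := by simpa using hi
        have : S.size + 1 + i = S.size + (1 + i) := by omega
        rw [hP, drawOnce, List.getElem?_append_right (by simp; omega)]
        simp [this, Nat.add_comm 1, hi', RandInstr.det?])
    have := hB r hr
    simp only [St.set_clock] at ht'
    simp only [Function.comp]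
    rw [hs'.randRun_eq_of_le (by simp [St.at, hlen]) (by omega)]
  -- Nothing is known about `g r` for `r` out of range, but such an `r` has probability zero.
  · have h0 : (PMF.uniformOfFinset (Finset.range (max 1 (s'.reg a))) ⟨0, by simp⟩) r = 0 :=
      PMF.uniformOfFinset_apply_of_notMem _ (by rwa [Finset.mem_range])
    simp only [h0, zero_mul]

end RAM

/-! ## Expressions and commands with bounded loops

All sums and loops have the same range `{0, …, L - 1}`, where `L` is the content of register `0`.
Hence the running time of a command is bounded by a polynomial in `L`. -/

namespace RAM

/-- The state `s` can be reached from `s₀` by `S` in time `B`, and has the property `Q`. -/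
def Reach (x : List Bool) (S : Stm) (s₀ : St) (B : ℕ) (Q : St → Prop) : Prop :=
  ∃ s, Exec x S s₀ s ∧ s.clock ≤ s₀.clock + B ∧ Q s

theorem Reach.op {x : List Bool} (o : Op) (s : St) :
    Reach x (.op o) s 1 fun s' => s' = o.act x s :=
  ⟨_, .op o s, (o.act_clock x s).le, rfl⟩

theorem Reach.seq {x : List Bool} {S T : Stm} {s₀ : St} {B B' : ℕ} {Q Q' : St → Prop}
    (h : Reach x S s₀ B Q) (h' : ∀ s, Q s → Reach x T s B' Q') :
    Reach x (.seq S T) s₀ (B + B') Q' := by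
  obtain ⟨s, hs, hB, hQ⟩ := h
  obtain ⟨s', hs', hB', hQ'⟩ := h' s hQ
  exact ⟨s', hs.seq hs', by omega, hQ'⟩

theorem Reach.mono {x : List Bool} {S : Stm} {s₀ : St} {B B' : ℕ} {Q Q' : St → Prop}
    (h : Reach x S s₀ B Q) (hB : B ≤ B') (hQ : ∀ s, Q s → Q' s) : Reach x S s₀ B' Q' := by
  obtain ⟨s, hs, hB, h⟩ := h
  exact ⟨s, hs, by omega, hQ s h⟩

/-- `for R[v] := 0, …, R[b] - 1`, with a scratch register `d`. -/
def Stm.for (v b d : ℕ) (S : Stm) : Stm :=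
  .op (.const v 0) ;; .whileLt v b (S ;; .op (.const d 1) ;; .op (.add v v d))

/-- A round costs the test, the body, the two instructions of the increment and the jump back; the
initialization and the exit take three steps. The increment changes only `v`, `d` and the clock,
which by `hI` do not matter for the invariant. -/
theorem Reach.for {x : List Bool} {v b d : ℕ} (hvd : v ≠ d) {S : Stm}
    {L B : ℕ} (I : ℕ → St → Prop)
    (hb : ∀ i s, I i s → s.reg b = L)
    (hI : ∀ i s s', I i s → (∀ r, r ≠ v → r ≠ d → s'.reg r = s.reg r) → s'.mem = s.mem →
      s'.word = s.word → s'.log = s.log → I i s')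
    (hS : ∀ i < L, ∀ s, I i s → s.reg v = i →
      Reach x S s B fun s' => I (i + 1) s' ∧ s'.reg v = i)
    {s₀ : St} (h₀ : I 0 s₀) : Reach x (.for v b d S) s₀ (L * (B + 4) + 3) (I L) := by
  have hloop : ∀ m, ∀ i, i + m = L → ∀ s, I i s → s.reg v = i →
      Reach x (.whileLt v b (S ;; .op (.const d 1) ;; .op (.add v v d))) s (m * (B + 4) + 2)
        (I L) := by
    intro m
    induction m with
    | zero =>
      intro i hi s hs hv
      have : ¬ s.reg v < s.reg b := by rw [hb i s hs]; omega
      refine ⟨_, .whileFalse this, by simp, ?_⟩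
      rw [← hi]
      exact hI _ s _ hs (fun _ _ _ => rfl) rfl rfl rfl
    | succ m ih =>
      intro i hi s hs hv
      have hlt : s.reg v < s.reg b := by rw [hb i s hs]; omega
      obtain ⟨s', hs', hB', hI', hv'⟩ := hS i (by omega) s.tick
        (hI i s _ hs (fun _ _ _ => rfl) rfl rfl rfl) hv
      have h2 := (hs'.seq ((Exec.op (.const d 1) s').seq (.op (.add v v d) _)))
      obtain ⟨s'', hs'', hB'', hI''⟩ := ih (i + 1) (by omega)
        (St.tick (((s'.set d 1)).set v ((s'.set d 1).reg v + (s'.set d 1).reg d)))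
        (hI (i + 1) s' _ hI' (fun r h1 h2 => by simp [h1, h2]) rfl rfl rfl) (by simp [hvd, hv'])
      refine ⟨s'', .whileTrue hlt h2 hs'', ?_, hI''⟩
      simp only [St.tick_clock, St.set_clock] at hB' hB''
      rw [Nat.succ_mul]
      omega
  refine ((Reach.op (.const v 0) s₀).seq (fun s hs => hloop L 0 (by simp) s ?_ ?_)).mono
    (by omega) fun _ h => h
  · subst hs
    exact hI 0 s₀ _ h₀ (fun r h1 _ => by simp [h1]) rfl rfl rfl
  · subst hs
    simp

/-- The value `s` if `a < b`, and `t` otherwise. -/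
def ifLt {α : Type*} (a b : ℕ) (s t : α) : α := if a < b then s else t

theorem ifLt_eq {α : Type*} (a b : ℕ) (s t : α) : ifLt a b s t = if a < b then s else t := rfl

/-- The value `s` if `a = b`, and `t` otherwise. -/
def ifEq {α : Type*} (a b : ℕ) (s t : α) : α := if a = b then s else t

theorem ifEq_eq {α : Type*} (a b : ℕ) (s t : α) : ifEq a b s t = if a = b then s else t := rfl

/-- Expressions, with de Bruijn indices for variables. -/
inductive Expr where
  | var (i : ℕ)
  | const (n : ℕ)
  /-- the bound `L` of all sums and loops -/
  | bound
  | add (a b : Expr)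
  /-- `if a < b then s else t` -/
  | ite (a b s t : Expr)
  | input (a : Expr)
  | load (a : Expr)
  /-- the sum of `s` over all values `< L` of a new variable -/
  | sum (s : Expr)
  /-- the value of `f` with the variables `a b c d` -/
  | call (f a b c d : Expr)

namespace Expr

/-- The value of an expression for the input `x`, the bound `L` and the memory `M`. -/
def eval (x : List Bool) (L : ℕ) (M : ℕ → ℕ) : Expr → List ℕ → ℕ
  | var i, env => env.getD i L
  | const n, _ => n
  | bound, _ => L
  | add a b, env => a.eval x L M env + b.eval x L M env
  | ite a b s t, env =>
      ifLt (a.eval x L M env) (b.eval x L M env) (s.eval x L M env) (t.eval x L M env)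
  | input a, env => inputSymbol x (a.eval x L M env)
  | load a, env => M (a.eval x L M env)
  | sum s, env => ∑ i ∈ Finset.range L, s.eval x L M (i :: env)
  | call f a b c d, env =>
      f.eval x L M [a.eval x L M env, b.eval x L M env, c.eval x L M env, d.eval x L M env]

/-- Code that writes the value into register `d`, uses only registers `≥ d`, and finds the variables
in the registers `ρ`. -/
def code : Expr → List ℕ → ℕ → Stm
  | var i, ρ, d => .op (.move d (ρ.getD i 0))
  | const n, _, d => .op (.const d n)
  | bound, _, d => .op (.move d 0)
  | add a b, ρ, d => a.code ρ d ;; b.code ρ (d + 1) ;; .op (.add d d (d + 1))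
  | ite a b s t, ρ, d =>
      a.code ρ d ;; b.code ρ (d + 1) ;; .ite d (d + 1) (s.code ρ d) (t.code ρ d)
  | input a, ρ, d => a.code ρ d ;; .op (.input d d)
  | load a, ρ, d => a.code ρ d ;; .op (.load d d)
  | sum s, ρ, d =>
      .op (.const d 0) ;;
      .for (d + 1) 0 (d + 2) (s.code ((d + 1) :: ρ) (d + 2) ;; .op (.add d d (d + 2)))
  | call f a b c e, ρ, d =>
      a.code ρ d ;; b.code ρ (d + 1) ;; c.code ρ (d + 2) ;; e.code ρ (d + 3) ;;
      f.code [d, d + 1, d + 2, d + 3] (d + 4) ;; .op (.move d (d + 4))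

/-- A bound of the running time of the code, as a polynomial in `L`. -/
noncomputable def cost : Expr → Polynomial ℕ
  | var _ | const _ | bound => 1
  | add a b => a.cost + (b.cost + 1)
  | ite a b s t => a.cost + (b.cost + (s.cost + t.cost + 2))
  | input a | load a => a.cost + 1
  | sum s => 1 + (.X * (s.cost + 1 + 4) + 3)
  | call f a b c d => a.cost + (b.cost + (c.cost + (d.cost + (f.cost + 1))))

/-- The effect of the evaluation of an expression on the state. -/
structure Result (d v : ℕ) (s s' : St) : Prop where
  reg : s'.reg d = v
  low : ∀ r < d, s'.reg r = s.reg r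
  mem : s'.mem = s.mem
  word : s'.word = s.word
  log : s'.log = s.log

theorem map_reg_eq {s s' : St} {d : ℕ} (h : ∀ r < d, s'.reg r = s.reg r) {ρ : List ℕ}
    (hρ : ∀ r ∈ ρ, r < d) : ρ.map s'.reg = ρ.map s.reg :=
  List.map_congr_left fun r hr => h r (hρ r hr)

/-- The registers serve as a stack: code for `d` leaves everything below `d` alone, hence the
variables, earlier intermediate results and, as `0 < d`, the bound in register `0`. Memory is never
written, so subexpressions evaluated at different times refer to the same `M`. -/
theorem reach_code (x : List Bool) {L : ℕ} (e : Expr) : ∀ (ρ : List ℕ) (d : ℕ) (s : St),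
    0 < d → (∀ r ∈ ρ, r < d) → s.reg 0 = L →
    Reach x (e.code ρ d) s (e.cost.eval L) (Result d (e.eval x L s.mem (ρ.map s.reg)) s) := by
  induction e with
  | var i =>
    intro ρ d s hd hρ hL
    refine (Reach.op _ s).mono (by simp [cost]) fun s' h => ?_
    subst h
    refine ⟨?_, fun r hr => by simp [hr.ne], rfl, rfl, rfl⟩
    -- An index without a variable reads register `0`, whose content `L` is the default value in
    -- `eval`.
    simp [eval, ← hL]
  | const n =>
    intro ρ d s hd hρ hL
    refine (Reach.op _ s).mono (by simp [cost]) fun s' h => ?_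
    subst h
    exact ⟨by simp [eval], fun r hr => by simp [hr.ne], rfl, rfl, rfl⟩
  | bound =>
    intro ρ d s hd hρ hL
    refine (Reach.op _ s).mono (by simp [cost]) fun s' h => ?_
    subst h
    exact ⟨by simp [eval, hL], fun r hr => by simp [hr.ne], rfl, rfl, rfl⟩
  | add a b iha ihb =>
    intro ρ d s hd hρ hL
    simp only [cost, Polynomial.eval_add, Polynomial.eval_one, code]
    refine (iha ρ d s hd hρ hL).seq fun s₁ h₁ => ?_
    have hm := map_reg_eq h₁.low hρ
    refine (ihb ρ (d + 1) s₁ (by omega) (fun r hr => by have := hρ r hr; omega)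
      ((h₁.low 0 hd).trans hL)).seq fun s₂ h₂ => ?_
    refine (Reach.op _ s₂).mono le_rfl fun s' h => ?_
    subst h
    refine ⟨?_, fun r hr => ?_, ?_, ?_, ?_⟩
    · simp [eval, h₂.reg, h₂.low d (by omega), h₁.reg, hm, h₁.mem]
    · simp [hr.ne, h₂.low r (by omega), h₁.low r hr]
    · exact h₂.mem.trans h₁.mem
    · exact h₂.word.trans h₁.word
    · exact h₂.log.trans h₁.log
  | ite a b t f iha ihb iht ihf =>
    intro ρ d s hd hρ hL
    simp only [cost, Polynomial.eval_add, Polynomial.eval_ofNat, code]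
    refine (iha ρ d s hd hρ hL).seq fun s₁ h₁ => ?_
    have hm := map_reg_eq h₁.low hρ
    refine (ihb ρ (d + 1) s₁ (by omega) (fun r hr => by have := hρ r hr; omega)
      ((h₁.low 0 hd).trans hL)).seq fun s₂ h₂ => ?_
    have low : ∀ r < d, s₂.reg r = s.reg r := fun r hr =>
      (h₂.low r (by omega)).trans (h₁.low r hr)
    have hm' := map_reg_eq low hρ
    have e1 : s₂.reg d = a.eval x L s.mem (ρ.map s.reg) := (h₂.low d (by omega)).trans h₁.reg
    have e2 : s₂.reg (d + 1) = b.eval x L s.mem (ρ.map s.reg) := by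
      rw [h₂.reg, hm, h₁.mem]
    have hmem := h₂.mem.trans h₁.mem
    by_cases hlt : s₂.reg d < s₂.reg (d + 1)
    · obtain ⟨s₃, hs₃, hB, hQ⟩ := iht ρ d s₂.tick hd hρ ((low 0 hd).trans hL)
      refine ⟨s₃, .iteTrue hlt hs₃, by simp at hB; omega, ?_⟩
      refine ⟨?_, fun r hr => (hQ.low r hr).trans (low r hr), hQ.mem.trans hmem,
        hQ.word.trans (h₂.word.trans h₁.word), hQ.log.trans (h₂.log.trans h₁.log)⟩
      rw [e1, e2] at hlt
      rw [hQ.reg, eval, ifLt, if_pos hlt, St.tick_reg, St.tick_mem, hm', hmem]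
    · obtain ⟨s₃, hs₃, hB, hQ⟩ := ihf ρ d s₂.tick hd hρ ((low 0 hd).trans hL)
      refine ⟨s₃.tick, .iteFalse hlt hs₃, by simp at hB ⊢; omega, ?_⟩
      refine ⟨?_, fun r hr => (hQ.low r hr).trans (low r hr), hQ.mem.trans hmem,
        hQ.word.trans (h₂.word.trans h₁.word), hQ.log.trans (h₂.log.trans h₁.log)⟩
      rw [e1, e2] at hlt
      rw [St.tick_reg, hQ.reg, eval, ifLt, if_neg hlt, St.tick_reg, St.tick_mem, hm', hmem]
  | input a iha =>
    intro ρ d s hd hρ hL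
    simp only [cost, Polynomial.eval_add, Polynomial.eval_one, code]
    refine (iha ρ d s hd hρ hL).seq fun s₁ h₁ => ?_
    refine (Reach.op _ s₁).mono le_rfl fun s' h => ?_
    subst h
    exact ⟨by simp [eval, h₁.reg], fun r hr => by simp [hr.ne, h₁.low r hr], h₁.mem, h₁.word,
      h₁.log⟩
  | load a iha =>
    intro ρ d s hd hρ hL
    simp only [cost, Polynomial.eval_add, Polynomial.eval_one, code]
    refine (iha ρ d s hd hρ hL).seq fun s₁ h₁ => ?_
    refine (Reach.op _ s₁).mono le_rfl fun s' h => ?_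
    subst h
    exact ⟨by simp [eval, h₁.reg, h₁.mem], fun r hr => by simp [hr.ne, h₁.low r hr], h₁.mem,
      h₁.word, h₁.log⟩
  | sum e ihe =>
    intro ρ d s hd hρ hL
    simp only [cost, Polynomial.eval_add, Polynomial.eval_one, Polynomial.eval_mul,
      Polynomial.eval_X, Polynomial.eval_ofNat, code]
    refine (Reach.op _ s).seq fun s₁ h₁ => ?_
    let I : ℕ → St → Prop := fun i s' =>
      Result d (∑ j ∈ Finset.range i, e.eval x L s.mem (j :: ρ.map s.reg)) s s'
    refine (Reach.for (by omega) I ?_ ?_ ?_ ?_).mono le_rfl fun s' h => h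
    · intro i s' h
      exact (h.low 0 hd).trans hL
    · intro i s' s'' h hr hm hw hl
      exact ⟨(hr d (by omega) (by omega)).trans h.reg,
        fun r hr' => (hr r (by omega) (by omega)).trans (h.low r hr'),
        hm.trans h.mem, hw.trans h.word, hl.trans h.log⟩
    · intro i hi s' h hv
      refine (ihe ((d + 1) :: ρ) (d + 2) s' (by omega) ?_ ((h.low 0 hd).trans hL)).seq
        fun s₂ h₂ => ?_
      · intro r hr
        rcases List.mem_cons.1 hr with rfl | hr
        · omega
        · have := hρ r hr; omega
      · refine (Reach.op _ s₂).mono le_rfl fun s₃ h₃ => ?_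
        subst h₃
        have hm := map_reg_eq h.low hρ
        refine ⟨⟨?_, fun r hr => ?_, h₂.mem.trans h.mem, h₂.word.trans h.word,
          h₂.log.trans h.log⟩, ?_⟩
        · simp [h₂.reg, h₂.low d (by omega), h.reg, Finset.sum_range_succ, h.mem, hm, hv]
        · simp [hr.ne, h₂.low r (by omega), h.low r hr]
        · simp [h₂.low (d + 1) (by omega), hv]
    · subst h₁
      exact ⟨by simp, fun r hr => by simp [hr.ne], rfl, rfl, rfl⟩
  | call f a b c e ihf iha ihb ihc ihe =>
    intro ρ d s hd hρ hL
    simp only [cost, Polynomial.eval_add, Polynomial.eval_one, code]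
    refine (iha ρ d s hd hρ hL).seq fun s₁ h₁ => ?_
    have l₁ := h₁.low
    refine (ihb ρ (d + 1) s₁ (by omega) (fun r hr => by have := hρ r hr; omega)
      ((l₁ 0 hd).trans hL)).seq fun s₂ h₂ => ?_
    have l₂ : ∀ r < d, s₂.reg r = s.reg r := fun r hr => (h₂.low r (by omega)).trans (l₁ r hr)
    refine (ihc ρ (d + 2) s₂ (by omega) (fun r hr => by have := hρ r hr; omega)
      ((l₂ 0 hd).trans hL)).seq fun s₃ h₃ => ?_
    have l₃ : ∀ r < d, s₃.reg r = s.reg r := fun r hr => (h₃.low r (by omega)).trans (l₂ r hr)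
    refine (ihe ρ (d + 3) s₃ (by omega) (fun r hr => by have := hρ r hr; omega)
      ((l₃ 0 hd).trans hL)).seq fun s₄ h₄ => ?_
    have l₄ : ∀ r < d, s₄.reg r = s.reg r := fun r hr => (h₄.low r (by omega)).trans (l₃ r hr)
    refine (ihf [d, d + 1, d + 2, d + 3] (d + 4) s₄ (by omega) (fun r hr => by simp at hr; omega)
      ((l₄ 0 hd).trans hL)).seq fun s₅ h₅ => ?_
    refine (Reach.op _ s₅).mono le_rfl fun s' h => ?_
    subst h
    have m₁ := h₁.mem
    have m₂ := h₂.mem.trans m₁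
    have m₃ := h₃.mem.trans m₂
    have m₄ := h₄.mem.trans m₃
    refine ⟨?_, fun r hr => ?_, h₅.mem.trans m₄,
      h₅.word.trans (h₄.word.trans (h₃.word.trans (h₂.word.trans h₁.word))),
      h₅.log.trans (h₄.log.trans (h₃.log.trans (h₂.log.trans h₁.log)))⟩
    · have r₁ : s₄.reg d = _ := (h₄.low d (by omega)).trans ((h₃.low d (by omega)).trans
        ((h₂.low d (by omega)).trans h₁.reg))
      have r₂ : s₄.reg (d + 1) = _ := (h₄.low (d + 1) (by omega)).trans
        ((h₃.low (d + 1) (by omega)).trans h₂.reg)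
      have r₃ : s₄.reg (d + 2) = _ := (h₄.low (d + 2) (by omega)).trans h₃.reg
      simp only [Op.act, St.set_reg, Function.update_self, h₅.reg, List.map_cons, List.map_nil, r₁,
        r₂, r₃, h₄.reg, m₁, m₂, m₃, m₄, map_reg_eq l₁ hρ, map_reg_eq l₂ hρ, map_reg_eq l₃ hρ, eval]
    · simp [hr.ne, h₅.low r (by omega), l₄ r hr]

end Expr

/-! ### Commands: memory, output and loops -/

/-- The part of the state that commands change. -/
structure Store where
  mem : ℕ → ℕ
  word : List ℕ
  outs : List (List ℕ)

def St.store (s : St) : Store := ⟨s.mem, s.word, s.log.map Prod.fst⟩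

/-- Commands, with de Bruijn indices for variables. -/
inductive Cmd where
  | seq (S T : Cmd)
  /-- `M[a] := e` -/
  | store (a e : Expr)
  | print (e : Expr)
  | emit
  /-- `S` if `a < b` -/
  | guarded (a b : Expr) (S : Cmd)
  /-- `S` for all values `< L` of a new variable -/
  | loop (S : Cmd)

/-- `f i` is applied for `i = 0, …, n - 1`. -/
def forLoop {α : Type*} (f : ℕ → α → α) : ℕ → α → α
  | 0, a => a
  | n + 1, a => f n (forLoop f n a)

namespace Cmd

def eval (x : List Bool) (L : ℕ) : Cmd → List ℕ → Store → Store
  | seq S T, env, s => T.eval x L env (S.eval x L env s)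
  | store a e, env, s =>
      { s with mem := Function.update s.mem (a.eval x L s.mem env) (e.eval x L s.mem env) }
  | print e, env, s => { s with word := s.word ++ [e.eval x L s.mem env] }
  | emit, _, s => { s with word := [], outs := s.outs ++ [s.word] }
  | guarded a b S, env, s =>
      ifLt (a.eval x L s.mem env) (b.eval x L s.mem env) (S.eval x L env s) s
  | loop S, env, s => forLoop (fun i => S.eval x L (i :: env)) L s

def code : Cmd → List ℕ → ℕ → Stm
  | seq S T, ρ, d => S.code ρ d ;; T.code ρ d
  | store a e, ρ, d => a.code ρ d ;; e.code ρ (d + 1) ;; .op (.store d (d + 1))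
  | print e, ρ, d => e.code ρ d ;; .op (.print d)
  | emit, _, _ => .op .emit
  | guarded a b S, ρ, d => a.code ρ d ;; b.code ρ (d + 1) ;; .ite d (d + 1) (S.code ρ d) .skip
  | loop S, ρ, d => .for d 0 (d + 1) (S.code (d :: ρ) (d + 1))

noncomputable def cost : Cmd → Polynomial ℕ
  | seq S T => S.cost + T.cost
  | store a e => a.cost + (e.cost + 1)
  | print e => e.cost + 1
  | emit => 1
  | guarded a b S => a.cost + (b.cost + (S.cost + 2))
  | loop S => .X * (S.cost + 4) + 3

/-- The effect of a command on the state. -/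
structure Result (d : ℕ) (v : Store) (s s' : St) : Prop where
  store : s'.store = v
  low : ∀ r < d, s'.reg r = s.reg r

/-- The effect is stated on `Store`, which forgets the times in the log. The result is thus a
function of the input, and time enters only through `cost`. -/
theorem reach_code (x : List Bool) {L : ℕ} (S : Cmd) : ∀ (ρ : List ℕ) (d : ℕ) (s : St),
    0 < d → (∀ r ∈ ρ, r < d) → s.reg 0 = L →
    Reach x (S.code ρ d) s (S.cost.eval L)
      (Result d (S.eval x L (ρ.map s.reg) s.store) s) := by
  induction S with
  | seq S T ihS ihT =>
    intro ρ d s hd hρ hL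
    simp only [cost, Polynomial.eval_add, code]
    refine (ihS ρ d s hd hρ hL).seq fun s₁ h₁ => ?_
    refine (ihT ρ d s₁ hd hρ ((h₁.low 0 hd).trans hL)).mono le_rfl fun s₂ h₂ => ?_
    refine ⟨?_, fun r hr => (h₂.low r hr).trans (h₁.low r hr)⟩
    rw [h₂.store, Expr.map_reg_eq h₁.low hρ, h₁.store, eval]
  | store a e =>
    intro ρ d s hd hρ hL
    simp only [cost, Polynomial.eval_add, Polynomial.eval_one, code]
    refine (a.reach_code x ρ d s hd hρ hL).seq fun s₁ h₁ => ?_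
    refine (e.reach_code x ρ (d + 1) s₁ (by omega) (fun r hr => by have := hρ r hr; omega)
      ((h₁.low 0 hd).trans hL)).seq fun s₂ h₂ => ?_
    refine (Reach.op _ s₂).mono le_rfl fun s' h => ?_
    subst h
    refine ⟨?_, fun r hr => (h₂.low r (by omega)).trans (h₁.low r hr)⟩
    simp [St.store, eval, h₂.reg, h₂.low d (by omega), h₁.reg, h₂.mem, h₁.mem, h₂.word, h₁.word,
      h₂.log, h₁.log, Expr.map_reg_eq h₁.low hρ]
  | print e =>
    intro ρ d s hd hρ hL
    simp only [cost, Polynomial.eval_add, Polynomial.eval_one, code]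
    refine (e.reach_code x ρ d s hd hρ hL).seq fun s₁ h₁ => ?_
    refine (Reach.op _ s₁).mono le_rfl fun s' h => ?_
    subst h
    refine ⟨?_, fun r hr => h₁.low r hr⟩
    simp [St.store, eval, h₁.reg, h₁.mem, h₁.word, h₁.log]
  | emit =>
    intro ρ d s hd hρ hL
    refine (Reach.op _ s).mono (by simp [cost]) fun s' h => ?_
    subst h
    exact ⟨by simp [St.store, eval], fun r hr => rfl⟩
  | guarded a b S ihS =>
    intro ρ d s hd hρ hL
    simp only [cost, Polynomial.eval_add, Polynomial.eval_ofNat, code]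
    refine (a.reach_code x ρ d s hd hρ hL).seq fun s₁ h₁ => ?_
    refine (b.reach_code x ρ (d + 1) s₁ (by omega) (fun r hr => by have := hρ r hr; omega)
      ((h₁.low 0 hd).trans hL)).seq fun s₂ h₂ => ?_
    have low : ∀ r < d, s₂.reg r = s.reg r := fun r hr =>
      (h₂.low r (by omega)).trans (h₁.low r hr)
    have e1 : s₂.reg d = a.eval x L s.mem (ρ.map s.reg) := (h₂.low d (by omega)).trans h₁.reg
    have e2 : s₂.reg (d + 1) = b.eval x L s.mem (ρ.map s.reg) := by
      rw [h₂.reg, Expr.map_reg_eq h₁.low hρ, h₁.mem]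
    have hst : s₂.store = s.store := by
      simp [St.store, h₁.mem, h₂.mem, h₁.word, h₂.word, h₁.log, h₂.log]
    by_cases hlt : s₂.reg d < s₂.reg (d + 1)
    · obtain ⟨s₃, hs₃, hB, hQ⟩ := ihS ρ d s₂.tick hd hρ ((low 0 hd).trans hL)
      refine ⟨s₃, .iteTrue hlt hs₃, by simp at hB; omega, ?_,
        fun r hr => (hQ.low r hr).trans (low r hr)⟩
      rw [e1, e2] at hlt
      rw [hQ.store, eval, St.tick_reg, Expr.map_reg_eq low hρ]
      exact (congrArg _ hst).trans (if_pos hlt).symm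
    · refine ⟨_, .iteFalse hlt (.skip _), by simp; omega, ?_, low⟩
      rw [e1, e2] at hlt
      exact hst.trans (if_neg hlt).symm
  | loop S ihS =>
    intro ρ d s hd hρ hL
    simp only [cost, Polynomial.eval_add, Polynomial.eval_mul, Polynomial.eval_X,
      Polynomial.eval_ofNat, code]
    let I : ℕ → St → Prop := fun i s' =>
      Result d (forLoop (fun i => S.eval x L (i :: ρ.map s.reg)) i s.store) s s'
    refine (Reach.for (by omega) I ?_ ?_ ?_ ?_).mono le_rfl fun s' h => h
    · intro i s' h
      exact (h.low 0 hd).trans hL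
    · intro i s' s'' h hr hm hw hl
      refine ⟨?_, fun r hr' => (hr r (by omega) (by omega)).trans (h.low r hr')⟩
      rw [← h.store, St.store, St.store, hm, hw, hl]
    · intro i hi s' h hv
      refine (ihS (d :: ρ) (d + 1) s' (by omega) ?_ ((h.low 0 hd).trans hL)).mono le_rfl
        fun s₂ h₂ => ?_
      · intro r hr
        rcases List.mem_cons.1 hr with rfl | hr
        · omega
        · have := hρ r hr; omega
      · refine ⟨⟨?_, fun r hr => (h₂.low r (by omega)).trans (h.low r hr)⟩,
          (h₂.low d (by omega)).trans hv⟩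
        rw [h₂.store, List.map_cons, hv, Expr.map_reg_eq h.low hρ, h.store]
        rfl
    · exact ⟨rfl, fun _ _ => rfl⟩

end Cmd

/-! ### The bound of the loops -/

/-- Code that sets register `0` to `b + a * |x|`. -/
def setBound (a b : ℕ) : Stm :=
  .op (.const 0 b) ;; .op (.const 1 0) ;; .op (.const 2 0) ;; .op (.const 3 1) ;;
  .op (.const 4 a) ;; .op (.input 5 1) ;;
  .whileLt 2 5 (.op (.add 0 0 4) ;; .op (.add 1 1 3) ;; .op (.input 5 1))

theorem inputSymbol_pos {x : List Bool} {i : ℕ} : 0 < inputSymbol x i ↔ i < x.length := by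
  unfold inputSymbol
  by_cases h : i < x.length
  · rw [List.getElem?_eq_getElem h]
    cases x[i] <;> simp [h]
  · rw [List.getElem?_eq_none (by omega)]
    simp [h]

/-- Symbols inside the input are positive and the symbol behind its end is `0`, so comparing
register `5` with the zero in register `2` detects the end; `a` is added once per symbol. -/
theorem reach_setBound (x : List Bool) (a b : ℕ) (s : St) :
    Reach x (setBound a b) s (5 * x.length + 8) fun s' =>
      s'.reg 0 = b + a * x.length ∧ s'.store = s.store ∧ s'.log = s.log := by
  have hloop : ∀ m i, i + m = x.length → ∀ s₁ : St, s₁.reg 0 = b + a * i → s₁.reg 1 = i →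
      s₁.reg 2 = 0 → s₁.reg 3 = 1 → s₁.reg 4 = a → s₁.reg 5 = inputSymbol x i →
      Reach x (.whileLt 2 5 (.op (.add 0 0 4) ;; .op (.add 1 1 3) ;; .op (.input 5 1))) s₁
        (5 * m + 2) fun s' =>
        s'.reg 0 = b + a * x.length ∧ s'.store = s₁.store ∧ s'.log = s₁.log := by
    intro m
    induction m with
    | zero =>
      intro i hi s₁ h0 h1 h2 h3 h4 h5
      have : ¬ s₁.reg 2 < s₁.reg 5 := by
        rw [h2, h5, inputSymbol_pos]; omega
      refine ⟨_, .whileFalse this, by simp, ?_, rfl, rfl⟩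
      simp [h0, ← hi]
    | succ m ih =>
      intro i hi s₁ h0 h1 h2 h3 h4 h5
      have hlt : s₁.reg 2 < s₁.reg 5 := by
        rw [h2, h5, inputSymbol_pos]; omega
      have hb := (Exec.op (x := x) (.add 0 0 4) s₁.tick).seq ((Exec.op (.add 1 1 3) _).seq
        (.op (.input 5 1) _))
      obtain ⟨s', hs', hB, hQ, hQ'⟩ := ih (i + 1) (by omega)
        (St.tick (Op.act x (.input 5 1) (Op.act x (.add 1 1 3) (Op.act x (.add 0 0 4) s₁.tick))))
        (by simp [h0, h4]; ring) (by simp [h1, h3]) (by simp [h2]) (by simp [h3]) (by simp [h4])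
        (by simp [h1, h3])
      refine ⟨s', .whileTrue hlt hb hs', ?_, hQ, hQ'⟩
      simp only [St.tick_clock, Op.act, St.set_clock] at hB
      omega
  unfold setBound
  refine Reach.mono (B := 1 + (1 + (1 + (1 + (1 + (1 + (5 * x.length + 2)))))))
    ((Reach.op _ s).seq fun s1 h1 => (Reach.op _ s1).seq fun s2 h2 => (Reach.op _ s2).seq
      fun s3 h3 => (Reach.op _ s3).seq fun s4 h4 => (Reach.op _ s4).seq fun s5 h5 =>
      (Reach.op _ s5).seq fun s6 h6 => (hloop x.length 0 (by simp) s6 ?_ ?_ ?_ ?_ ?_ ?_).mono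
        le_rfl fun s' h => ?_) (by omega) fun _ h => h <;> subst h1 h2 h3 h4 h5 h6
  · simp
  · simp
  · simp
  · simp
  · simp
  · simp
  · exact h

end RAM

/-! ## Enumeration of the words represented by a linked structure

A node at address `p` consists of a letter `M[p]`, a pointer `M[p + 1]` to the continuations, and a
pointer `M[p + 2]` to the alternatives. -/

namespace RAM

section Linked

variable (M : ℕ → ℕ) (S : ℕ)

/-- The pointer `p` represents the nonempty list `ws` of words of length `i`, or `p = 0` represents
the empty list; all nodes lie below `S`. -/
inductive Repr : ℕ → ℕ → List (List ℕ) → Prop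
  | zero (p : ℕ) : Repr 0 p [[]]
  | nil (i : ℕ) : Repr (i + 1) 0 []
  | cons {i p : ℕ} {ws ws' : List (List ℕ)} : 0 < p → p + 2 < S → Repr i (M (p + 1)) ws →
      ws ≠ [] → Repr (i + 1) (M (p + 2)) ws' →
      Repr (i + 1) p (ws.map (M p :: ·) ++ ws')

/-- The nodes `ps` form a path of length `i`, after which the words in `rest` remain. -/
inductive Path : ℕ → List ℕ → List (List ℕ) → Prop
  | nil : Path 0 [] []
  | cons {i p : ℕ} {ps : List ℕ} {ws ws' : List (List ℕ)} : p + 2 < S → Path i ps ws →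
      Repr M S (i + 1) (M (p + 2)) ws' → Path (i + 1) (p :: ps) (ws.map (M p :: ·) ++ ws')

/-- After the nodes `qs`, the structure is to be continued at `q`; the remaining words are `ws`. -/
inductive Pending : ℕ → List ℕ → ℕ → List (List ℕ) → Prop
  | nil {i q : ℕ} {ws : List (List ℕ)} : Repr M S i q ws → ws ≠ [] → Pending i [] q ws
  | cons {i p q : ℕ} {qs : List ℕ} {ws ws' : List (List ℕ)} : p + 2 < S → Pending i qs q ws →
      Repr M S (i + 1) (M (p + 2)) ws' → Pending (i + 1) (p :: qs) q (ws.map (M p :: ·) ++ ws')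

/-- The path that starts at node `p` and always takes the first continuation. -/
def firstPath : ℕ → ℕ → List ℕ
  | 0, _ => []
  | i + 1, p => p :: firstPath i (M (p + 1))

/-- The last node on a path that has alternatives: the pointer to them and the position, where the
positions on the path are counted from `a`. -/
def lastBranch : List ℕ → ℕ → ℕ × ℕ → ℕ × ℕ
  | [], _, cur => cur
  | p :: ps, a, cur => lastBranch ps (a + 1) (if 0 < M (p + 2) then (M (p + 2), a) else cur)

variable {M S}

@[simp] theorem length_firstPath (i p : ℕ) : (firstPath M i p).length = i := by
  induction i generalizing p with
  | zero => rfl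
  | succ i ih => simp [firstPath, ih]

theorem lastBranch_append (ps qs : List ℕ) (a : ℕ) (cur : ℕ × ℕ) :
    lastBranch M (ps ++ qs) a cur = lastBranch M qs (a + ps.length) (lastBranch M ps a cur) := by
  induction ps generalizing a cur with
  | nil => rfl
  | cons p ps ih => simp [lastBranch, ih, Nat.add_assoc, Nat.add_comm 1]

theorem Repr.pos {i p : ℕ} {ws : List (List ℕ)} (h : Repr M S (i + 1) p ws) (hws : ws ≠ []) :
    0 < p := by
  cases h with
  | nil => exact absurd rfl hws
  | cons hp => exact hp

theorem Repr.ne_nil {i p : ℕ} {ws : List (List ℕ)} (h : Repr M S (i + 1) p ws) (hp : 0 < p) :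
    ws ≠ [] := by
  cases h with
  | nil => omega
  | cons _ _ _ hws => simp [hws]

/-- In `Repr.cons` the continuations of a node are nonempty, so following first continuations never
gets stuck and spells the first word. -/
theorem Repr.path {i p : ℕ} {ws : List (List ℕ)} (h : Repr M S i p ws) (hws : ws ≠ []) :
    ∃ rest, ws = (firstPath M i p).map M :: rest ∧ Path M S i (firstPath M i p) rest := by
  induction h with
  | zero p => exact ⟨[], rfl, .nil⟩
  | nil => exact absurd rfl hws
  | @cons i p ws ws' hp hS h h0 h' ih ih' =>
    obtain ⟨rest, rfl, hpath⟩ := ih h0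
    exact ⟨rest.map (M p :: ·) ++ ws', by simp [firstPath], .cons hS hpath h'⟩

/-- Keeping the nodes `qs` and completing them by the first path from `q` gives the next word, and
again a `Path` for the words after it. -/
theorem Pending.path {i q : ℕ} {qs : List ℕ} {ws : List (List ℕ)} (h : Pending M S i qs q ws) :
    qs.length ≤ i ∧ ∃ rest, ws = (qs ++ firstPath M (i - qs.length) q).map M :: rest ∧
      Path M S i (qs ++ firstPath M (i - qs.length) q) rest := by
  induction h with
  | nil h hws => simpa using h.path hws
  | @cons i p q qs ws ws' hS h h' ih =>
    obtain ⟨hle, rest, rfl, hpath⟩ := ih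
    refine ⟨by simpa using hle, rest.map (M p :: ·) ++ ws', by simp, ?_⟩
    simpa using Path.cons hS hpath h'

theorem Path.node_lt {i : ℕ} {ps : List ℕ} {rest : List (List ℕ)} (h : Path M S i ps rest) :
    ∀ p ∈ ps, p + 2 < S := by
  induction h with
  | nil => simp
  | cons hS _ _ ih => simpa [hS] using ih

theorem Path.length_eq {i : ℕ} {ps : List ℕ} {rest : List (List ℕ)} (h : Path M S i ps rest) :
    ps.length = i := by
  induction h with
  | nil => rfl
  | cons hS _ _ ih => simpa using ih

/-- Continuations precede alternatives in the list, so the words after the current one start at the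
deepest node with an alternative, and the nodes before it are kept. If no node on the path has an
alternative, no word is left. -/
theorem Path.lastBranch {i : ℕ} {ps : List ℕ} {rest : List (List ℕ)} (h : Path M S i ps rest)
    (a : ℕ) (cur : ℕ × ℕ) :
    (lastBranch M ps a cur = cur ∧ rest = []) ∨
    ∃ b q, lastBranch M ps a cur = (q, a + b) ∧ 0 < q ∧ b < ps.length ∧
      Pending M S i (ps.take b) q rest := by
  induction h generalizing a cur with
  | nil => exact .inl ⟨rfl, rfl⟩
  | @cons i p ps ws ws' hS h h' ih =>
    rcases ih (a + 1) (if 0 < M (p + 2) then (M (p + 2), a) else cur) with ⟨h1, rfl⟩ | h1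
    · by_cases hp : 0 < M (p + 2)
      · refine .inr ⟨0, M (p + 2), ?_, hp, by simp, ?_⟩
        · rw [RAM.lastBranch, h1, if_pos hp]; rfl
        · simpa using Pending.nil h' (h'.ne_nil hp)
      · refine .inl ⟨by rw [RAM.lastBranch, h1, if_neg hp], ?_⟩
        by_contra hne
        exact hp (h'.pos (by simpa using hne))
    · obtain ⟨b, q, h1, hq, hb, hP⟩ := h1
      exact .inr ⟨b + 1, q, by rw [RAM.lastBranch, h1]; simp; omega, hq, by simpa using hb,
        by simpa using Pending.cons hS hP h'⟩

end Linked

/-! ### The program of the enumeration phase -/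

/-- Print the letter of the node in register `11`, and keep track of the last node with
alternatives in the registers `9` and `13`. -/
def visitNode : Stm :=
  .op (.load 12 11) ;; .op (.print 12) ;; .op (.add 12 11 6) ;; .op (.add 12 12 6) ;;
  .op (.load 12 12) ;; .ite 5 12 (.op (.move 9 12) ;; .op (.move 13 10)) .skip

/-- Visit the nodes of the current path before the address in register `8`. -/
def visitPrefix : Stm :=
  .whileLt 10 8 (.op (.load 11 10) ;; visitNode ;; .op (.add 10 10 6))

/-- Visit the nodes on the first path from the node in register `11`, and write them to memory. -/
def visitFirstPath : Stm :=
  .whileLt 10 2 (.op (.store 10 11) ;; visitNode ;; .op (.add 12 11 6) ;; .op (.load 11 12) ;;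
    .op (.add 10 10 6))

/-- Output one word. -/
def outputWord : Stm :=
  .op (.const 9 0) ;; .op (.move 10 1) ;; visitPrefix ;; .op (.move 11 3) ;; visitFirstPath ;;
  .op .emit ;; .op (.move 3 9) ;; .op (.move 8 13)

/-- Output all words represented by the pointer in register `3`, with memory from the address in
register `1` to that in register `2` for the current path, if register `4` is positive. -/
def enumerate : Stm :=
  .op (.const 5 0) ;; .op (.const 6 1) ;;
  .ite 5 4 (.op (.move 8 1) ;; .op (.const 9 1) ;; .whileLt 5 9 outputWord) .skip

/-- The registers that are constant during the output of one word, and the nodes. -/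
structure EnumFrame (M : ℕ → ℕ) (S k q b : ℕ) (s : St) : Prop where
  r1 : s.reg 1 = S
  r2 : s.reg 2 = S + k
  r3 : s.reg 3 = q
  r5 : s.reg 5 = 0
  r6 : s.reg 6 = 1
  r8 : s.reg 8 = b
  mem : ∀ a < S, s.mem a = M a

variable {x : List Bool} {M : ℕ → ℕ} {S k q b : ℕ}

/-- Register `10` holds the address of the current position in the array of the path, register `12`
is scratch, and the registers `5` and `6` hold the constants `0` and `1`. The registers `9` and `13`
together carry out one step of `lastBranch`. -/
theorem reach_visitNode {s : St} {p a : ℕ} (hs : EnumFrame M S k q b s) (hp : p + 2 < S)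
    (h11 : s.reg 11 = p) (h10 : s.reg 10 = a) {cur : ℕ × ℕ} (hcur : (s.reg 9, s.reg 13) = cur) :
    Reach x visitNode s 8 fun s' => EnumFrame M S k q b s' ∧ s'.reg 11 = p ∧ s'.reg 10 = a ∧
      (s'.reg 9, s'.reg 13) = lastBranch M [p] a cur ∧ s'.mem = s.mem ∧
      s'.word = s.word ++ [M p] ∧ s'.log = s.log := by
  have m0 := hs.mem p (by omega)
  have m2 := hs.mem (p + 2) (by omega)
  set s' := Op.act x (.load 12 12) (Op.act x (.add 12 12 6) (Op.act x (.add 12 11 6)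
    (Op.act x (.print 12) (Op.act x (.load 12 11) s)))) with hs'
  have hex : ∀ {T : Stm} {s'' : St}, Exec x T s' s'' → Exec x (.op (.load 12 11) ;;
      .op (.print 12) ;; .op (.add 12 11 6) ;; .op (.add 12 12 6) ;; .op (.load 12 12) ;; T) s s'' :=
    fun h => .seq (.op _ _) (.seq (.op _ _) (.seq (.op _ _) (.seq (.op _ _) (.seq (.op _ _) h))))
  have h5 : s'.reg 5 = 0 := by simp [hs', hs.r5]
  have h12 : s'.reg 12 = M (p + 2) := by
    simp [hs', h11, hs.r6, ← m2, Nat.add_assoc]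
  have hf : EnumFrame M S k q b s' := by
    constructor <;> simp [hs', hs.r1, hs.r2, hs.r3, hs.r5, hs.r6, hs.r8]
    exact hs.mem
  have hw : s'.word = s.word ++ [M p] := by simp [hs', h11, m0]
  have hc : s'.clock = s.clock + 5 := by simp [hs']
  by_cases hlt : 0 < M (p + 2)
  · refine ⟨_, hex (.iteTrue (by rwa [h5, h12]) (.seq (.op _ _) (.op _ _))), by simp; omega, ?_⟩
    refine ⟨?_, ?_, ?_, ?_, rfl, hw, rfl⟩
    · constructor <;> simp [hf.r1, hf.r2, hf.r3, hf.r5, hf.r6, hf.r8]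
      exact hf.mem
    · simp [hs', h11]
    · simp [hs', h10]
    · simp [lastBranch, hs', h10, h11, hs.r6, ← m2, Nat.add_assoc]
      omega
  · refine ⟨_, hex (.iteFalse (by rwa [h5, h12]) (.skip _)), by simp; omega, ?_⟩
    refine ⟨⟨hf.r1, hf.r2, hf.r3, hf.r5, hf.r6, hf.r8, hf.mem⟩, ?_, ?_, ?_, rfl, hw, rfl⟩
    · simp [hs', h11]
    · simp [hs', h10]
    · simp [lastBranch, hlt, hs', ← hcur]

/-- Every word must be printed in full anyway, so replaying the kept nodes from the array costs no
more than a constant factor. The replay also recomputes the last branch among them. -/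
theorem reach_visitPrefix (qs : List ℕ) : ∀ {s : St} {a : ℕ} {cur : ℕ × ℕ},
    EnumFrame M S k q b s → s.reg 10 = a → a + qs.length = b → (∀ p ∈ qs, p + 2 < S) →
    (∀ j, (h : j < qs.length) → s.mem (a + j) = qs[j]) → (s.reg 9, s.reg 13) = cur →
    Reach x visitPrefix s (12 * qs.length + 2) fun s' =>
      EnumFrame M S k q b s' ∧ s'.reg 10 = b ∧
      (s'.reg 9, s'.reg 13) = lastBranch M qs a cur ∧ s'.mem = s.mem ∧
      s'.word = s.word ++ qs.map M ∧ s'.log = s.log := by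
  induction qs with
  | nil =>
    intro s a cur hs h10 hab _ _ hcur
    have : ¬ s.reg 10 < s.reg 8 := by rw [h10, hs.r8]; simp at hab; omega
    refine ⟨_, .whileFalse this, by simp, ?_⟩
    exact ⟨⟨hs.r1, hs.r2, hs.r3, hs.r5, hs.r6, hs.r8, hs.mem⟩, by simpa [h10] using hab, hcur, rfl,
      by simp, rfl⟩
  | cons p qs ih =>
    intro s a cur hs h10 hab hS hm hcur
    have hlt : s.reg 10 < s.reg 8 := by rw [h10, hs.r8]; simp at hab; omega
    have hp : s.mem a = p := hm 0 (Nat.succ_pos _)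
    have hex := Exec.op (x := x) (.load 11 10) s.tick
    obtain ⟨s₁, hs₁, hc₁, hf₁, -, h10₁, hcur₁, hm₁, hw₁, hl₁⟩ :=
      reach_visitNode (x := x) (M := M) (S := S) (k := k) (q := q) (b := b) (p := p) (a := a)
        (cur := cur) (s := Op.act x (.load 11 10) s.tick)
        (by constructor <;> simp [hs.r1, hs.r2, hs.r3, hs.r5, hs.r6, hs.r8]; exact hs.mem)
        (hS p (by simp)) (by simp [h10, hp]) (by simp [h10]) (by simpa using hcur)
    obtain ⟨s', hs', hc', hf', h10', hcur', hm', hw', hl'⟩ := ih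
      (s := (Op.act x (.add 10 10 6) s₁).tick) (a := a + 1) (cur := lastBranch M [p] a cur)
      (by constructor <;> simp [hf₁.r1, hf₁.r2, hf₁.r3, hf₁.r5, hf₁.r6, hf₁.r8]; exact hf₁.mem)
      (by simp [h10₁, hf₁.r6]) (by simp at hab; omega) (fun p hp => hS p (by simp [hp]))
      (fun j hj => by
        have := hm (j + 1) (by simpa using hj)
        simpa [hm₁, Nat.add_assoc, Nat.add_comm 1] using this)
      (by simpa using hcur₁)
    refine ⟨s', .whileTrue hlt (hex.seq (hs₁.seq (.op _ _))) hs', ?_, hf', h10', hcur', ?_, ?_, ?_⟩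
    · simp at hc' hc₁ ⊢; omega
    · rw [hm']; exact hm₁
    · rw [hw']; simp [hw₁]
    · rw [hl']; exact hl₁

/-- The array of the path starts at `S` and the nodes lie below `S`, so recording the new path does
not damage the linked structure. -/
theorem reach_visitFirstPath (i : ℕ) : ∀ {s : St} {a p : ℕ} {cur : ℕ × ℕ},
    EnumFrame M S k q b s → s.reg 10 = a → s.reg 11 = p → S ≤ a → a + i = S + k →
    (∀ p' ∈ firstPath M i p, p' + 2 < S) → (s.reg 9, s.reg 13) = cur →
    Reach x visitFirstPath s (15 * i + 2) fun s' =>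
      EnumFrame M S k q b s' ∧
      (s'.reg 9, s'.reg 13) = lastBranch M (firstPath M i p) a cur ∧
      (∀ c < a, s'.mem c = s.mem c) ∧
      (∀ j, (h : j < (firstPath M i p).length) → s'.mem (a + j) = (firstPath M i p)[j]) ∧
      s'.word = s.word ++ (firstPath M i p).map M ∧ s'.log = s.log := by
  induction i with
  | zero =>
    intro s a p cur hs h10 h11 _ hab _ hcur
    have : ¬ s.reg 10 < s.reg 2 := by rw [h10, hs.r2]; omega
    refine ⟨_, .whileFalse this, by simp, ?_⟩
    exact ⟨⟨hs.r1, hs.r2, hs.r3, hs.r5, hs.r6, hs.r8, hs.mem⟩, hcur, fun _ _ => rfl,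
      fun j hj => absurd hj (by simp [firstPath]), by simp [firstPath], rfl⟩
  | succ i ih =>
    intro s a p cur hs h10 h11 hSa hab hS hcur
    have hlt : s.reg 10 < s.reg 2 := by rw [h10, hs.r2]; omega
    have hex := Exec.op (x := x) (.store 10 11) s.tick
    have hSp := hS p (by simp [firstPath])
    obtain ⟨s₁, hs₁, hc₁, hf₁, h11₁, h10₁, hcur₁, hm₁, hw₁, hl₁⟩ :=
      reach_visitNode (x := x) (M := M) (S := S) (k := k) (q := q) (b := b) (p := p) (a := a)
        (cur := cur) (s := Op.act x (.store 10 11) s.tick)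
        (by
          refine ⟨hs.r1, hs.r2, hs.r3, hs.r5, hs.r6, hs.r8, fun c hc => ?_⟩
          simp [h10, show c ≠ a by omega, hs.mem c hc])
        hSp h11 h10 hcur
    have hm₁' : s₁.mem = Function.update s.mem a p := by rw [hm₁]; simp [h10, h11]
    set s₂ := (Op.act x (.add 10 10 6) (Op.act x (.load 11 12) (Op.act x (.add 12 11 6) s₁))).tick
      with hs₂
    obtain ⟨s', hs', hc', hf', hcur', hlow', hpath', hw', hl'⟩ := ih
      (s := s₂) (a := a + 1) (p := M (p + 1)) (cur := lastBranch M [p] a cur)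
      (by constructor <;> simp [hs₂, hf₁.r1, hf₁.r2, hf₁.r3, hf₁.r5, hf₁.r6, hf₁.r8]; exact hf₁.mem)
      (by simp [hs₂, h10₁, hf₁.r6])
      (by simp [hs₂, h11₁, hf₁.r6, hf₁.mem (p + 1) (by omega)]) (by omega) (by omega)
      (fun p' hp' => hS p' (by simp [firstPath, hp'])) (by simpa [hs₂] using hcur₁)
    refine ⟨s', .whileTrue hlt (hex.seq (hs₁.seq (.seq (.op _ _) (.seq (.op _ _) (.op _ _))))) hs',
      ?_, hf', hcur', ?_, ?_, ?_, ?_⟩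
    · simp [hs₂] at hc' hc₁ ⊢; omega
    · intro c hc
      rw [hlow' c (by omega)]
      simp [hs₂, hm₁', hc.ne]
    · intro j hj
      cases j with
      | zero => simp [firstPath, hlow' a (by omega), hs₂, hm₁']
      | succ j =>
        have := hpath' j (by simpa using hj)
        simpa [firstPath, Nat.add_assoc, Nat.add_comm 1] using this
    · rw [hw']; simp [hs₂, hw₁, firstPath]
    · rw [hl']; exact hl₁

/-- The two passes visit the whole path and thereby find its last branch, which is all that is
needed to resume. The alternative in the conclusion mirrors `Path.lastBranch`: register `9` is `0`
when the list is exhausted, and otherwise the state fits a new `Pending`. -/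
theorem reach_outputWord {s : St} {qs : List ℕ} {ws : List (List ℕ)}
    (hs : EnumFrame M S k q (S + qs.length) s) (hP : Pending M S k qs q ws)
    (hm : ∀ j, (h : j < qs.length) → s.mem (S + j) = qs[j]) (hw : s.word = []) :
    ∃ w rest t, ws = w :: rest ∧ w.length = k ∧ t ≤ s.clock + (15 * k + 8) ∧
      Reach x outputWord s (15 * k + 10) fun s' => s'.clock = t + 2 ∧ s'.word = [] ∧
        s'.log = s.log ++ [(w, t)] ∧ s'.reg 5 = 0 ∧
        ((s'.reg 9 = 0 ∧ rest = []) ∨ ∃ qs' q', 0 < s'.reg 9 ∧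
          EnumFrame M S k q' (S + qs'.length) s' ∧ Pending M S k qs' q' rest ∧
          ∀ j, (h : j < qs'.length) → s'.mem (S + j) = qs'[j]) := by
  obtain ⟨hle, rest, rfl, hpath⟩ := hP.path
  set ps := qs ++ firstPath M (k - qs.length) q with hps
  -- The pointer `0` means that no branch has been seen yet; the old content of register `13` is
  -- then irrelevant.
  obtain ⟨s₁, hs₁, hc₁, hf₁, h10₁, hcur₁, hm₁, hw₁, hl₁⟩ := reach_visitPrefix (x := x) (M := M)
    (S := S) (k := k) (q := q) (b := S + qs.length) qs (a := S) (cur := (0, s.reg 13))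
    (s := Op.act x (.move 10 1) (Op.act x (.const 9 0) s))
    (by constructor <;> simp [hs.r1, hs.r2, hs.r3, hs.r5, hs.r6, hs.r8]; exact hs.mem)
    (by simp [hs.r1]) rfl (fun p' hp' => hpath.node_lt p' (by simp [hps, hp'])) hm (by simp)
  obtain ⟨s₂, hs₂, hc₂, hf₂, hcur₂, hlow₂, hpath₂, hw₂, hl₂⟩ := reach_visitFirstPath (x := x)
    (M := M) (S := S) (k := k) (q := q) (b := S + qs.length) (k - qs.length) (a := S + qs.length)
    (p := q) (cur := lastBranch M qs S (0, s.reg 13)) (s := Op.act x (.move 11 3) s₁)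
    (by constructor <;> simp [hf₁.r1, hf₁.r2, hf₁.r3, hf₁.r5, hf₁.r6, hf₁.r8]; exact hf₁.mem)
    (by simp [h10₁]) (by simp [hf₁.r3]) (by omega) (by omega)
    (fun p' hp' => hpath.node_lt p' (by simp [hps, hp'])) (by simpa using hcur₁)
  rw [← lastBranch_append] at hcur₂
  have hword : s₂.word = ps.map M := by
    rw [hw₂]; simp [hw₁, hw, hps]
  have hlog : s₂.log = s.log := by rw [hl₂]; simp [hl₁]
  have hclock : s₂.clock ≤ s.clock + (15 * k + 7) := by
    simp at hc₁ hc₂; omega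
  have hmem : ∀ j, (h : j < ps.length) → s₂.mem (S + j) = ps[j] := by
    intro j hj
    by_cases hj' : j < qs.length
    · rw [hlow₂ _ (by omega)]
      simp [hps, List.getElem_append_left hj', hm₁, hm j hj']
    · have := hpath₂ (j - qs.length) (by
        rw [hps, List.length_append] at hj; omega)
      rw [show S + qs.length + (j - qs.length) = S + j by omega] at this
      rw [this]
      simp only [hps]
      rw [List.getElem_append_right (by omega)]
  refine ⟨ps.map M, rest, s₂.clock + 1, rfl, by simpa using hpath.length_eq, by omega, ?_⟩
  refine ⟨Op.act x (.move 8 13) (Op.act x (.move 3 9) (Op.act x .emit s₂)),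
    .seq (.op _ _) (.seq (.op _ _) (hs₁.seq (.seq (.op _ _) (hs₂.seq (.seq (.op _ _)
      (.seq (.op _ _) (.op _ _))))))), by simp; omega, by simp, by simp, by simp [hword, hlog],
      by simp [hf₂.r5], ?_⟩
  rcases hpath.lastBranch S (0, s.reg 13) with ⟨h, h'⟩ | ⟨b', q', h, hq', hb', hP'⟩
  · refine .inl ⟨?_, h'⟩
    have := (Prod.ext_iff.1 (hcur₂.trans h)).1
    simpa using this
  · have h1 := Prod.ext_iff.1 (hcur₂.trans h)
    simp only at h1
    refine .inr ⟨ps.take b', q', by simpa [h1.1] using hq', ?_, hP', ?_⟩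
    · constructor <;> simp [hf₂.r1, hf₂.r2, hf₂.r5, hf₂.r6, h1.1, h1.2, hb'.le]
      exact hf₂.mem
    · intro j hj
      simp only [List.length_take] at hj
      simpa using hmem j (by omega)

/-! ### The delays -/

/-- The outputs `l` come with delays at most `D`, from time `t` to time `t'`. -/
def Delays (D : ℕ) : ℕ → List (List ℕ × ℕ) → ℕ → Prop
  | t, [], t' => t' ≤ t + D
  | t, e :: l, t' => e.2 ≤ t + D ∧ Delays D e.2 l t'

/-- Here `t₀` is the time of the previous output, or `0` at the start. The slack of `10` absorbs the
instructions between that output and the test of the loop, so that the bound `15 * k + 20` passes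
unchanged through the induction. -/
theorem exec_outputWords (ws : List (List ℕ)) : ∀ {s : St} {q : ℕ} {qs : List ℕ} (t₀ : ℕ),
    EnumFrame M S k q (S + qs.length) s → Pending M S k qs q ws →
    (∀ j, (h : j < qs.length) → s.mem (S + j) = qs[j]) → s.word = [] → 0 < s.reg 9 →
    s.clock ≤ t₀ + 10 →
    ∃ s' l, Exec x (.whileLt 5 9 outputWord) s s' ∧ s'.log = s.log ++ l ∧ l.map Prod.fst = ws ∧
      s'.word = [] ∧ (∀ w ∈ ws, w.length = k) ∧ Delays (15 * k + 20) t₀ l s'.clock := by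
  induction ws with
  | nil =>
    intro s q qs t₀ _ hP
    obtain ⟨-, rest, h, -⟩ := hP.path
    exact absurd h (by simp)
  | cons w ws ih =>
    intro s q qs t₀ hs hP hm hw h9 ht₀
    obtain ⟨w', rest, t, h, hlen, ht, s₁, hs₁, hc₁, hct, hw₁, hl₁, h5, hnext⟩ :=
      reach_outputWord (x := x) (s := s.tick)
        ⟨hs.r1, hs.r2, hs.r3, hs.r5, hs.r6, hs.r8, hs.mem⟩ hP hm hw
    obtain ⟨rfl, rfl⟩ := List.cons.inj h
    have hlt : s.reg 5 < s.reg 9 := by rwa [hs.r5]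
    simp only [St.tick_clock] at ht hc₁
    rcases hnext with ⟨h9', rfl⟩ | ⟨qs', q', h9', hs', hP', hm'⟩
    · have hlt' : ¬ s₁.tick.reg 5 < s₁.tick.reg 9 := by simp [h9']
      refine ⟨_, [(w, t)], .whileTrue hlt hs₁ (.whileFalse hlt'), hl₁, rfl, hw₁, by simpa using hlen,
        by simp; omega, ?_⟩
      simp only [Delays, St.tick_clock]; omega
    · obtain ⟨s', l, hs', hl', hlw, hw', hlen', hD⟩ := ih (s := s₁.tick) t
        ⟨hs'.r1, hs'.r2, hs'.r3, hs'.r5, hs'.r6, hs'.r8, hs'.mem⟩ hP' hm' hw₁ h9' (by simp; omega)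
      refine ⟨s', (w, t) :: l, .whileTrue hlt hs₁ hs', ?_, by simp [hlw], hw', ?_, by simp; omega,
        hD⟩
      · rw [hl', St.tick_log, hl₁]; simp
      · simpa [hlen] using hlen'

theorem exec_enumerate {s : St} {ws : List (List ℕ)} (h1 : s.reg 1 = S) (h2 : s.reg 2 = S + k)
    (hR : s.reg 4 = 0 ∧ ws = [] ∨ 0 < s.reg 4 ∧ ws ≠ [] ∧ Repr s.mem S k (s.reg 3) ws)
    (hw : s.word = []) (hc : s.clock = 0) (hl : s.log = []) :
    ∃ s', Exec x enumerate s s' ∧ s'.word = [] ∧ s'.log.map Prod.fst = ws ∧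
      (∀ w ∈ ws, w.length = k) ∧ (ws = [] → s'.clock ≤ 10) ∧
      (ws ≠ [] → Delays (15 * k + 20) 0 s'.log s'.clock) := by
  set s₂ := Op.act x (.const 6 1) (Op.act x (.const 5 0) s) with hs₂
  have hex : ∀ {T s'}, Exec x T s₂ s' → Exec x (.op (.const 5 0) ;; .op (.const 6 1) ;; T) s s' :=
    fun h => .seq (.op _ _) (.seq (.op _ _) h)
  rcases hR with ⟨h4, rfl⟩ | ⟨h4, hne, hR⟩
  · refine ⟨_, hex (.iteFalse (by simp [hs₂, h4]) (.skip _)), ?_⟩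
    simp [hs₂, hw, hc, hl]
  · obtain ⟨s', l, hs', hl', hlw, hw', hlen, hD⟩ := exec_outputWords (x := x) (M := s.mem) (S := S)
      (k := k) ws (s := Op.act x (.const 9 1) (Op.act x (.move 8 1) s₂.tick)) (q := s.reg 3)
      (qs := []) 0 (by constructor <;> simp [hs₂, h1, h2]) (.nil hR hne) (by simp) (by simp [hs₂, hw])
      (by simp) (by simp [hs₂, hc])
    refine ⟨s', hex (.iteTrue (by simpa [hs₂] using h4) (.seq (.op _ _) (.seq (.op _ _) hs'))), hw',
      ?_, hlen, fun h => absurd h hne, fun _ => ?_⟩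
    · rw [hl']; simpa [hs₂, hl] using hlw
    · rw [hl']; simpa [hs₂, hl] using hD

/-- A uniform bound `D` is enough once it is dominated by `c` times the length of every word that is
output. -/
theorem Delays.delaysBoundedBy {c D t' : ℕ} {f : Config} (h : Delays D 0 f.log t')
    (ht' : f.clock ≤ t') (hne : f.log ≠ []) (hD : ∀ e ∈ f.log, D ≤ c * max 1 e.1.length) :
    DelaysBoundedBy c f := by
  have key : ∀ l t, Delays D t l t' → (∀ e ∈ l, D ≤ c * max 1 e.1.length) →
      (∀ e, l.head? = some e → e.2 ≤ t + c * max 1 e.1.length) ∧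
      l.IsChain (fun e e' => e'.2 ≤ e.2 + c * max 1 e'.1.length) ∧
      (∀ e, l.getLast? = some e → t' ≤ e.2 + c * max 1 e.1.length) := by
    intro l
    induction l with
    | nil => simp
    | cons e l ih =>
      intro t h hD
      obtain ⟨h1, h2⟩ := h
      obtain ⟨i1, i2, i3⟩ := ih e.2 h2 fun e' he' => hD e' (by simp [he'])
      have he := hD e (by simp)
      refine ⟨by simp; omega, ?_, ?_⟩
      · rw [List.isChain_cons]
        exact ⟨fun e' he' => i1 e' he', i2⟩
      · intro e' he'
        cases l with
        | nil =>
          simp at he'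
          subst he'
          simp only [Delays] at h2
          omega
        | cons a l => exact i3 e' (by simpa using he')
  obtain ⟨h1, h2, h3⟩ := key _ _ h hD
  exact ⟨fun e he => by simpa using h1 e he, h2, fun e he => ht'.trans (h3 e he),
    fun h => absurd h hne⟩

end RAM

/-! ## Runs of automata -/

/-- A nonempty sequence of predicates on a finite type in which every element at level `i + 1` has
a parent, and parents do so at all levels, has an element at a level below the cardinality. -/
theorem exists_level_lt_card {T : Type*} [Fintype T] (P : ℕ → T → Prop)
    (hP : ∀ i v, P (i + 1) v → ∃ u, P i u ∧ ∀ j, P j u → P (j + 1) v) {t : ℕ} {v : T}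
    (h : P t v) : ∃ t' < Fintype.card T, P t' v := by
  classical
  -- `D i v` says that `i` is the first level of `v`. A parent of such an element has first level
  -- exactly one less, so each level up to that of `v` is the first level of some element; an
  -- element has only one first level, which makes these elements distinct.
  let D : ℕ → T → Prop := fun i v => P i v ∧ ∀ j < i, ¬ P j v
  have hD : ∀ i v, D (i + 1) v → ∃ u, D i u := by
    rintro i v ⟨hv, hmin⟩
    obtain ⟨u, hu, hstep⟩ := hP i v hv
    exact ⟨u, hu, fun j hj huj => hmin (j + 1) (by omega) (hstep j huj)⟩
  have hex : ∃ t, P t v := ⟨t, h⟩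
  have hfind : D (Nat.find hex) v := ⟨Nat.find_spec hex, fun j hj => Nat.find_min hex hj⟩
  refine ⟨Nat.find hex, ?_, hfind.1⟩
  have hall : ∀ m i, i + m = Nat.find hex → ∃ u, D i u := by
    intro m
    induction m with
    | zero => rintro i hi; exact ⟨v, by rw [show i = Nat.find hex by omega]; exact hfind⟩
    | succ m ih => rintro i hi; obtain ⟨u, hu⟩ := ih (i + 1) (by omega); exact hD i u hu
  choose f hf using fun i : Fin (Nat.find hex + 1) =>
    hall (Nat.find hex - i) i (by have := i.2; omega)
  have hinj : Function.Injective f := by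
    intro i j hij
    have hi := hf i
    have hj := hf j
    rw [hij] at hi
    rcases lt_trichotomy (i : ℕ) j with hlt | heq | hlt
    · exact absurd hi.1 (hj.2 _ hlt)
    · exact Fin.ext heq
    · exact absurd hj.1 (hi.2 _ hlt)
  simpa using Fintype.card_le_of_injective f hinj

namespace FinNFA

variable {σ : ℕ} (A : FinNFA σ)

/-- The edges at a state `q` are numbered: that to the state `q'` with letter `a` has the number
`a * n + q'`. -/
def edge (q e : ℕ) : Bool :=
  if h : q < A.n ∧ e < σ * A.n then
    A.trans ⟨q, h.1⟩ ⟨e / A.n, Nat.div_lt_of_lt_mul (by rw [Nat.mul_comm]; exact h.2)⟩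
      ⟨e % A.n, Nat.mod_lt _ (by omega)⟩
  else false

def final (q : ℕ) : Bool := if h : q < A.n then A.accept ⟨q, h⟩ else false

theorem edge_lt {q e : ℕ} (h : A.edge q e = true) : q < A.n ∧ e < σ * A.n := by
  unfold edge at h
  split at h
  · assumption
  · simp at h

theorem mul_add_div {n a q : ℕ} (hq : q < n) : (a * n + q) / n = a := by
  rw [Nat.mul_comm, Nat.mul_add_div (by omega), Nat.div_eq_of_lt hq, Nat.add_zero]

theorem mul_add_mod {n a q : ℕ} (hq : q < n) : (a * n + q) % n = q := by
  rw [Nat.mul_comm, Nat.mul_add_mod, Nat.mod_eq_of_lt hq]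

theorem mul_add_lt {n a q s : ℕ} (ha : a < s) (hq : q < n) : a * n + q < s * n := by
  calc a * n + q < (a + 1) * n := by rw [Nat.succ_mul]; omega
    _ ≤ s * n := Nat.mul_le_mul_right _ ha

theorem edge_mk (q q' : Fin A.n) (a : Fin σ) : A.edge q (a * A.n + q') = A.trans q a q' := by
  have h : (q : ℕ) < A.n ∧ (a : ℕ) * A.n + q' < σ * A.n := ⟨q.2, mul_add_lt a.2 q'.2⟩
  rw [edge, dif_pos h]
  congr 1
  · exact Fin.ext (mul_add_div q'.2)
  · exact Fin.ext (mul_add_mod q'.2)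

/-- `r` is the sequence of states after `q` of an accepting run from `q` on `w`. -/
def IsRun : ℕ → List ℕ → List ℕ → Prop
  | q, [], [] => A.final q = true
  | q, a :: w, q' :: r => A.edge q (a * A.n + q') = true ∧ q' < A.n ∧ IsRun q' w r
  | _, _, _ => False

variable {A}

/-- `IsRun` does not bound the letters, but the edge `a * n + q'` has a number below `σ * n`, which
forces `a < σ`. -/
theorem IsRun.exists_written {q : ℕ} {w r : List ℕ} (h : A.IsRun q w r) :
    ∃ y : List (Fin σ), w = written y := by
  induction w generalizing q r with
  | nil => exact ⟨[], rfl⟩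
  | cons a w ih =>
    cases r with
    | nil => exact h.elim
    | cons q' r =>
      obtain ⟨y, rfl⟩ := ih h.2.2
      have ha : a < σ := by
        by_contra ha
        have := (A.edge_lt h.1).2
        have := Nat.mul_le_mul_right A.n (not_lt.1 ha)
        omega
      exact ⟨⟨a, ha⟩ :: y, rfl⟩

theorem exists_mem_evalFrom {S : Set (Fin A.n)} {y : List (Fin σ)} :
    (∃ s ∈ A.toNFA.accept, s ∈ A.toNFA.evalFrom S y) ↔ ∃ q ∈ S, ∃ r, A.IsRun q (written y) r := by
  induction y generalizing S with
  | nil =>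
    constructor
    · rintro ⟨s, hs, hsS⟩
      refine ⟨s, hsS, [], ?_⟩
      simpa [IsRun, written, final, toNFA] using hs
    · rintro ⟨q, hq, r, hr⟩
      cases r with
      | nil =>
        refine ⟨q, ?_, hq⟩
        simpa [IsRun, written, final, toNFA] using hr
      | cons _ _ => exact hr.elim
  | cons a y ih =>
    rw [NFA.evalFrom_cons, ih]
    constructor
    · rintro ⟨q', hq', r, hr⟩
      obtain ⟨q, hq, hqq'⟩ := NFA.mem_stepSet.1 hq'
      exact ⟨q, hq, q' :: r, by rw [A.edge_mk]; exact hqq', q'.2, hr⟩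
    · rintro ⟨q, hq, r, hr⟩
      cases r with
      | nil => exact hr.elim
      | cons q' r =>
        obtain ⟨h1, h2, h3⟩ := hr
        refine ⟨⟨q', h2⟩, NFA.mem_stepSet.2 ⟨q, hq, ?_⟩, r, h3⟩
        have := A.edge_mk q ⟨q', h2⟩ a
        rw [h1] at this
        exact this.symm

theorem mem_accepts_iff {y : List (Fin σ)} :
    y ∈ A.toNFA.accepts ↔ ∃ r, A.IsRun A.start (written y) r := by
  rw [NFA.mem_accepts, exists_mem_evalFrom]
  simp [toNFA]

/-- Runs as functions and runs as lists. -/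
theorem isRun_iff {y : List (Fin σ)} : ∀ {q : Fin A.n} {r : List ℕ}, A.IsRun q (written y) r ↔
    ∃ f : Fin (y.length + 1) → Fin A.n, f 0 = q ∧
      (∀ i : Fin y.length, A.trans (f i.castSucc) (y.get i) (f i.succ) = true) ∧
      A.accept (f (Fin.last y.length)) = true ∧ r = List.ofFn fun i => (f i.succ : ℕ) := by
  induction y with
  | nil =>
    intro q r
    constructor
    · intro h
      cases r with
      | nil =>
        refine ⟨fun _ => q, rfl, fun i => i.elim0, ?_, by simp⟩
        simpa [IsRun, written, final] using h
      | cons _ _ => exact h.elim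
    · rintro ⟨f, rfl, -, h, rfl⟩
      simpa [IsRun, written, final] using h
  | cons a y ih =>
    intro q r
    constructor
    · intro h
      cases r with
      | nil => exact h.elim
      | cons q' r =>
        obtain ⟨h1, h2, h3⟩ := h
        obtain ⟨f, hf0, hf, hfl, rfl⟩ := (ih (q := ⟨q', h2⟩)).1 h3
        refine ⟨Fin.cons q f, rfl, fun i => ?_, ?_, ?_⟩
        · refine Fin.cases ?_ (fun i => ?_) i
          · have := A.edge_mk q ⟨q', h2⟩ a
            rw [h1] at this
            simpa [hf0] using this.symm
          · exact hf i
        · exact hfl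
        · simp [List.ofFn_succ, hf0]
    · rintro ⟨f, rfl, hf, hfl, rfl⟩
      rw [show written (a :: y) = (a : ℕ) :: written y from rfl]
      have : (List.ofFn fun i : Fin (a :: y).length => (f i.succ : ℕ)) =
          (f 1 : ℕ) :: List.ofFn fun i : Fin y.length => (f i.succ.succ : ℕ) := by
        simp [List.ofFn_succ]
      rw [this]
      refine ⟨?_, (f 1).2, (ih (q := f 1)).2 ⟨Fin.tail f, rfl, fun i => hf i.succ, hfl, rfl⟩⟩
      rw [A.edge_mk]
      exact hf 0

/-- Acceptance need not be mentioned: a run on a word shows that the word is over the alphabet and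
accepted. -/
theorem unambiguous_iff : A.Unambiguous ↔
    ∀ w r r', A.IsRun A.start w r → A.IsRun A.start w r' → r = r' := by
  constructor
  · intro h w r r' hr hr'
    obtain ⟨y, rfl⟩ := hr.exists_written
    obtain ⟨f, -, huniq⟩ := h y (mem_accepts_iff.2 ⟨r, hr⟩)
    obtain ⟨g, h1, h2, h3, rfl⟩ := isRun_iff.1 hr
    obtain ⟨g', h1', h2', h3', rfl⟩ := isRun_iff.1 hr'
    rw [huniq g ⟨h1, h2, h3⟩, huniq g' ⟨h1', h2', h3'⟩]
  · intro h y hy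
    obtain ⟨r, hr⟩ := mem_accepts_iff.1 hy
    obtain ⟨f, h1, h2, h3, -⟩ := isRun_iff.1 hr
    refine ⟨f, ⟨h1, h2, h3⟩, fun g ⟨g1, g2, g3⟩ => ?_⟩
    have := h _ _ _ (isRun_iff.2 ⟨g, g1, g2, g3, rfl⟩) (isRun_iff.2 ⟨f, h1, h2, h3, rfl⟩)
    funext i
    refine Fin.cases (g1.trans h1.symm) (fun i => Fin.ext ?_) i
    exact congrFun (List.ofFn_injective this) i

/-! ### Pairs of runs on the same word -/

variable (A) in
/-- There are two runs from the initial state on a word of length `t`, one to `p` and one to `q`;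
they are different if and only if `d = true`. -/
inductive Twin : ℕ → ℕ → ℕ → Bool → Prop
  | start : Twin 0 A.start A.start false
  | step {t p q p' q' a : ℕ} {d : Bool} : Twin t p q d → A.edge p (a * A.n + p') = true →
      A.edge q (a * A.n + q') = true → p' < A.n → q' < A.n →
      Twin (t + 1) p' q' (d || decide (p' ≠ q'))

theorem Twin.lt {t p q : ℕ} {d : Bool} (h : A.Twin t p q d) : p < A.n ∧ q < A.n := by
  cases h with
  | start => exact ⟨A.start.2, A.start.2⟩
  | step _ _ _ hp hq => exact ⟨hp, hq⟩

/-- Follow both runs letter by letter: either they have already separated, or the remaining parts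
differ, so the bit is `true` when both reach final states. -/
theorem Twin.exists_final {t p q : ℕ} {d : Bool} (h : A.Twin t p q d) {w r r' : List ℕ}
    (hr : A.IsRun p w r) (hr' : A.IsRun q w r') (hne : d = true ∨ r ≠ r') :
    ∃ t p q, A.Twin t p q true ∧ A.final p = true ∧ A.final q = true := by
  induction w generalizing t p q d r r' with
  | nil =>
    cases r <;> cases r' <;> try exact hr.elim
    · obtain rfl : d = true := by simpa using hne
      exact ⟨t, p, q, h, hr, hr'⟩
    · exact hr'.elim
  | cons a w ih =>
    cases r with
    | nil => exact hr.elim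
    | cons p' r =>
      cases r' with
      | nil => exact hr'.elim
      | cons q' r' =>
        refine ih (h.step hr.1 hr'.1 hr.2.1 hr'.2.1) hr.2.2 hr'.2.2 ?_
        by_cases hpq : p' = q' <;> simp_all

/-- Going back along the twin, each step prepends its common letter and its two target states; a bit
that becomes `true` turns into a difference of the two runs. -/
theorem Twin.exists_isRun {t p q : ℕ} {d : Bool} (h : A.Twin t p q d) : ∀ {w r r' : List ℕ},
    A.IsRun p w r → A.IsRun q w r' → d = true ∨ r ≠ r' →
    ∃ w r r', A.IsRun A.start w r ∧ A.IsRun A.start w r' ∧ r ≠ r' := by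
  induction h with
  | start =>
    intro w r r' hr hr' hne
    exact ⟨w, r, r', hr, hr', by simpa using hne⟩
  | @step t p q p' q' a d _ hp hq hp' hq' ih =>
    intro w r r' hr hr' hne
    refine ih (w := a :: w) (r := p' :: r) (r' := q' :: r') ⟨hp, hp', hr⟩ ⟨hq, hq', hr'⟩ ?_
    by_cases hpq : p' = q' <;> simp_all

/-- Whether one triple leads to another does not depend on the level, so a shortest path repeats no
triple, and there are `2 * n ^ 2` triples. -/
theorem Twin.exists_lt {t p q : ℕ} (h : A.Twin t p q true) :
    ∃ t' < 2 * A.n ^ 2, A.Twin t' p q true := by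
  have key := exists_level_lt_card (T := Fin A.n × Fin A.n × Bool)
    (P := fun t v => A.Twin t v.1 v.2.1 v.2.2) (t := t) (v := (⟨p, h.lt.1⟩, ⟨q, h.lt.2⟩, true))
    ?_ h
  · simpa [show A.n * (A.n * 2) = 2 * A.n ^ 2 by ring] using key
  · rintro i ⟨p', q', d'⟩ h
    dsimp only at h
    generalize hp : (p' : ℕ) = pn at h
    generalize hq : (q' : ℕ) = qn at h
    cases h with
    | @step _ p q _ _ a d h1 h2 h3 h4 h5 =>
      refine ⟨(⟨p, h1.lt.1⟩, ⟨q, h1.lt.2⟩, d), h1, fun j hj => ?_⟩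
      exact hj.step h2 h3 h4 h5

/-- It suffices to look at pairs of runs of bounded length. -/
theorem unambiguous_iff_twin {B : ℕ} (hB : 2 * A.n ^ 2 ≤ B ∨ σ = 0) : A.Unambiguous ↔
    ∀ t < B, ∀ p q, A.final p = true → A.final q = true → ¬ A.Twin t p q true := by
  rw [unambiguous_iff]
  constructor
  · intro h t _ p q hp hq ht
    -- As `p` and `q` are final, the empty word completes both runs.
    obtain ⟨w, r, r', hr, hr', hne⟩ := ht.exists_isRun (w := []) (r := []) (r' := []) hp hq (.inl rfl)
    exact hne (h w r r' hr hr')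
  · intro h w r r' hr hr'
    by_contra hne
    obtain ⟨t, p, q, ht, hp, hq⟩ := Twin.start.exists_final hr hr' (.inr hne)
    rcases hB with hB | rfl
    · obtain ⟨t', ht', h'⟩ := ht.exists_lt
      exact h t' (by omega) p q hp hq h'
    -- Without letters there are no edges, so the only twin is the initial one.
    · have : ∀ d, A.Twin t p q d → d = false := by
        intro d hd
        cases hd with
        | start => rfl
        | step _ h1 =>
          have := (A.edge_lt h1).2
          omega
      simpa using this _ ht

/-! ### The list of all accepted words -/

variable (A)

/-- The accepted words from `q` of length `i`, as far as the runs start with an edge numbered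
below `e` (if `i` is positive). -/
def wordList : ℕ → ℕ → ℕ → List (List ℕ)
  | 0, q, _ => if A.final q then [[]] else []
  | _ + 1, _, 0 => []
  | i + 1, q, e + 1 =>
      (if A.edge q e then (wordList i (e % A.n) (σ * A.n)).map (e / A.n :: ·) else []) ++
        wordList (i + 1) q e

theorem mem_wordList_succ {i q e : ℕ} {w : List ℕ} : w ∈ A.wordList (i + 1) q e ↔
    ∃ e' < e, A.edge q e' = true ∧ ∃ w' ∈ A.wordList i (e' % A.n) (σ * A.n),
      w = e' / A.n :: w' := by
  induction e with
  | zero => simp [wordList]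
  | succ e ih =>
    rw [wordList, List.mem_append, ih]
    constructor
    · rintro (h | ⟨e', he', h⟩)
      · split at h
        · obtain ⟨w', hw', rfl⟩ := List.mem_map.1 h
          exact ⟨e, by omega, by assumption, w', hw', rfl⟩
        · simp at h
      · exact ⟨e', by omega, h⟩
    · rintro ⟨e', he', he, w', hw', rfl⟩
      rcases Nat.lt_succ_iff_lt_or_eq.1 he' with h | rfl
      · exact .inr ⟨e', h, he, w', hw', rfl⟩
      · exact .inl (by rw [if_pos he]; exact List.mem_map.2 ⟨w', hw', rfl⟩)

theorem mem_wordList {i q : ℕ} {w : List ℕ} :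
    w ∈ A.wordList i q (σ * A.n) ↔ w.length = i ∧ ∃ r, A.IsRun q w r := by
  induction i generalizing q w with
  | zero =>
    rw [wordList]
    constructor
    · intro h
      split at h
      · obtain rfl : w = [] := by simpa using h
        exact ⟨rfl, [], by assumption⟩
      · simp at h
    · rintro ⟨h, r, hr⟩
      obtain rfl := List.length_eq_zero_iff.1 h
      cases r with
      | nil => rw [if_pos (show A.final q = true from hr)]; simp
      | cons _ _ => exact hr.elim
  | succ i ih =>
    rw [mem_wordList_succ]
    constructor
    · rintro ⟨e, he, hedge, w', hw', rfl⟩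
      obtain ⟨hlen, r, hr⟩ := ih.1 hw'
      have hn : 0 < A.n := A.start.pos
      exact ⟨by simp [hlen], e % A.n :: r, by rwa [Nat.mul_comm, Nat.div_add_mod],
        Nat.mod_lt _ hn, hr⟩
    · rintro ⟨hlen, r, hr⟩
      cases w with
      | nil => simp at hlen
      | cons a w =>
        cases r with
        | nil => exact hr.elim
        | cons q' r =>
          obtain ⟨h1, h2, h3⟩ := hr
          refine ⟨a * A.n + q', (A.edge_lt h1).2, h1, w, ?_, ?_⟩
          · rw [mul_add_mod h2]
            exact ih.2 ⟨by simpa using hlen, r, h3⟩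
          · rw [mul_add_div h2]

/-- The list has one entry per run, so a repetition would give two runs on the same word. Uniqueness
of runs from `q` is inherited by the target of each edge at `q`, because two runs from there extend
by that edge. -/
theorem nodup_wordList {i q : ℕ} (h : ∀ w r r', A.IsRun q w r → A.IsRun q w r' → r = r') (e : ℕ) :
    (A.wordList i q e).Nodup := by
  induction i generalizing q e with
  | zero => rw [wordList]; split <;> simp
  | succ i ih =>
    induction e with
    | zero => simp [wordList]
    | succ e ihe =>
      rw [wordList, List.nodup_append]
      refine ⟨?_, ihe, ?_⟩
      · split
        · rename_i hedge
          have hn : 0 < A.n := A.start.pos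
          have hedge' : A.edge q (e / A.n * A.n + e % A.n) = true := by
            rwa [Nat.mul_comm, Nat.div_add_mod]
          refine List.Nodup.map (List.cons_injective) (ih (fun w r r' hr hr' => ?_) _)
          have := h (e / A.n :: w) (e % A.n :: r) (e % A.n :: r') ⟨hedge', Nat.mod_lt _ hn, hr⟩
            ⟨hedge', Nat.mod_lt _ hn, hr'⟩
          exact (List.cons.inj this).2
        · simp
      · intro w hw w' hw' heq
        subst heq
        split at hw
        · rename_i hedge
          obtain ⟨u, hu, rfl⟩ := List.mem_map.1 hw
          obtain ⟨e', he', hedge', u', hu', heq⟩ := (A.mem_wordList_succ).1 hw'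
          obtain ⟨h1, rfl⟩ := List.cons.inj heq
          obtain ⟨-, r, hr⟩ := (A.mem_wordList).1 hu
          obtain ⟨-, r', hr'⟩ := (A.mem_wordList).1 hu'
          have hn : 0 < A.n := A.start.pos
          have := h (e / A.n :: u) (e % A.n :: r) (e' % A.n :: r')
            ⟨by rwa [Nat.mul_comm, Nat.div_add_mod], Nat.mod_lt _ hn, hr⟩
            ⟨by rw [h1]; rwa [Nat.mul_comm, Nat.div_add_mod], Nat.mod_lt _ hn, hr'⟩
          -- Both edges have the same letter and, by uniqueness of the run, the same target;
          -- quotient and remainder determine the edge, but `e' < e`.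
          have h2 := (List.cons.inj this).1
          have := Nat.div_add_mod e A.n
          rw [h1, h2, Nat.div_add_mod] at this
          omega
        · simp at hw

end FinNFA

/-! ## Decoding of inputs -/

namespace RAM

def bitSymbol (b : Bool) : ℕ := if b then 2 else 1

theorem inputSymbol_of_lt {x : List Bool} {i : ℕ} (h : i < x.length) :
    inputSymbol x i = bitSymbol x[i] := by
  unfold inputSymbol
  rw [List.getElem?_eq_getElem h]
  cases x[i] <;> rfl

theorem inputSymbol_of_le {x : List Bool} {i : ℕ} (h : x.length ≤ i) : inputSymbol x i = 0 := by
  unfold inputSymbol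
  rw [List.getElem?_eq_none h]

theorem inputSymbol_le (x : List Bool) (i : ℕ) : inputSymbol x i ≤ 2 := by
  unfold inputSymbol
  split <;> omega

theorem bitSymbol_injective : Function.Injective bitSymbol := by decide

theorem inputSymbol_append (x y : List Bool) (i : ℕ) : inputSymbol (x ++ y) i =
    if i < x.length then inputSymbol x i else inputSymbol y (i - x.length) := by
  unfold inputSymbol
  rw [List.getElem?_append]
  by_cases h : i < x.length <;> simp only [h, if_true, if_false]

theorem inputSymbol_replicate (m i : ℕ) (b : Bool) : inputSymbol (List.replicate m b) i =
    if i < m then bitSymbol b else 0 := by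
  unfold inputSymbol
  rw [List.getElem?_replicate]
  split
  · split at * <;> simp_all
  · split at * <;> simp_all [bitSymbol]
  · split at * <;> simp_all [bitSymbol]

theorem inputSymbol_ofFn {m : ℕ} (f : Fin m → Bool) (i : ℕ) : inputSymbol (List.ofFn f) i =
    if h : i < m then bitSymbol (f ⟨i, h⟩) else 0 := by
  split
  · rw [inputSymbol_of_lt (by simpa)]
    simp
  · exact inputSymbol_of_le (by simpa using by omega)

theorem ext_inputSymbol {x y : List Bool} (h : ∀ i, inputSymbol x i = inputSymbol y i) : x = y := by
  have hlen : x.length = y.length := by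
    rcases lt_trichotomy x.length y.length with hlt | heq | hlt
    · have := inputSymbol_pos.2 hlt
      rw [← h, inputSymbol_of_le le_rfl] at this
      omega
    · exact heq
    · have := inputSymbol_pos.2 hlt
      rw [h, inputSymbol_of_le le_rfl] at this
      omega
  refine List.ext_getElem hlen fun i h1 h2 => bitSymbol_injective ?_
  rw [← inputSymbol_of_lt h1, ← inputSymbol_of_lt h2, h]

/-- The position after the description of the automaton. -/
def bodyLength (σ n s : ℕ) : ℕ := n + s + 2 + n + n * (σ * n)

/-- The input `x` has the form of the encoding of an automaton with `n` states and initial state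
`s`, followed by `k` zeros. -/
structure Parsed (σ : ℕ) (x : List Bool) (n s k : ℕ) : Prop where
  start_lt : s < n
  ones : ∀ i < n, inputSymbol x i = 2
  sep : inputSymbol x n = 1
  ones' : ∀ i < s, inputSymbol x (n + 1 + i) = 2
  sep' : inputSymbol x (n + 1 + s) = 1
  length : x.length = bodyLength σ n s + k
  zeros : ∀ i < k, inputSymbol x (bodyLength σ n s + i) = 1

end RAM

namespace FinNFA

open RAM

variable {σ : ℕ} (A : FinNFA σ)

theorem flatten_trans (q : Fin A.n) :
    (List.ofFn fun a => List.ofFn fun q' => A.trans q a q').flatten =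
      List.ofFn fun e : Fin (σ * A.n) => A.edge q e := by
  rw [List.ofFn_mul]
  congr 2
  funext a
  congr 1
  funext q'
  exact (A.edge_mk q q' a).symm

theorem flatten_trans' :
    (List.ofFn fun q => (List.ofFn fun a => List.ofFn fun q' => A.trans q a q').flatten).flatten =
      List.ofFn fun u : Fin (A.n * (σ * A.n)) => A.edge (u / (σ * A.n)) (u % (σ * A.n)) := by
  simp only [flatten_trans]
  rw [List.ofFn_mul]
  congr 2
  funext q
  congr 1
  funext e
  simp only [mul_add_div e.2, mul_add_mod e.2]

theorem inputSymbol_encode (k i : ℕ) : inputSymbol (A.encode k) i =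
    if i < A.n then 2 else if i < A.n + 1 then 1 else if i < A.n + 1 + A.start then 2
    else if i < A.n + 1 + A.start + 1 then 1
    else if i < A.n + 1 + A.start + 1 + A.n then
      bitSymbol (A.final (i - (A.n + 1 + A.start + 1)))
    else if i < A.n + 1 + A.start + 1 + A.n + A.n * (σ * A.n) then
      bitSymbol (A.edge ((i - (A.n + 1 + A.start + 1 + A.n)) / (σ * A.n))
        ((i - (A.n + 1 + A.start + 1 + A.n)) % (σ * A.n)))
    else if i < A.n + 1 + A.start + 1 + A.n + A.n * (σ * A.n) + k then 1 else 0 := by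
  rw [encode, flatten_trans']
  simp only [inputSymbol_append, inputSymbol_replicate, inputSymbol_ofFn, List.length_append,
    List.length_replicate, List.length_ofFn, List.length_singleton]
  have h1 : ∀ j, inputSymbol [false] j = if j < 1 then 1 else 0 :=
    fun j => inputSymbol_replicate 1 j false
  simp only [h1, bitSymbol]
  split_ifs <;> first
    | rfl
    | omega
    | (simp only [final] at *; split_ifs at * <;> simp_all)
    | (exfalso; omega)

theorem length_encode (k : ℕ) : (A.encode k).length = bodyLength σ A.n A.start + k := by
  rw [encode, flatten_trans']
  simp [bodyLength]
  omega

theorem parsed_encode (k : ℕ) : Parsed σ (A.encode k) A.n A.start k where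
  start_lt := A.start.2
  ones i hi := by rw [inputSymbol_encode, if_pos hi]
  sep := by simp [inputSymbol_encode]
  ones' i hi := by
    rw [inputSymbol_encode, if_neg (by omega), if_neg (by omega), if_pos (by omega)]
  sep' := by
    rw [inputSymbol_encode, if_neg (by omega), if_neg (by omega), if_neg (by omega),
      if_pos (by omega)]
  length := A.length_encode k
  zeros i hi := by
    simp only [bodyLength]
    rw [inputSymbol_encode, if_neg (by omega), if_neg (by omega), if_neg (by omega),
      if_neg (by omega), if_neg (by omega), if_neg (by omega), if_pos (by omega)]

theorem inputSymbol_final {k q : ℕ} (hq : q < A.n) :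
    inputSymbol (A.encode k) (A.n + A.start + 2 + q) = bitSymbol (A.final q) := by
  rw [inputSymbol_encode, if_neg (by omega), if_neg (by omega), if_neg (by omega),
    if_neg (by omega), if_pos (by omega)]
  congr 2; omega

theorem inputSymbol_edge {k q e : ℕ} (hq : q < A.n) (he : e < σ * A.n) :
    inputSymbol (A.encode k) (A.n + A.start + 2 + A.n + q * (σ * A.n) + e) =
      bitSymbol (A.edge q e) := by
  have := mul_add_lt hq he
  rw [inputSymbol_encode, if_neg (by omega), if_neg (by omega), if_neg (by omega),
    if_neg (by omega), if_neg (by omega), if_pos (by omega)]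
  have h : A.n + A.start + 2 + A.n + q * (σ * A.n) + e - (A.n + 1 + A.start + 1 + A.n) =
      q * (σ * A.n) + e := by omega
  rw [h, mul_add_div he, mul_add_mod he]

/-- Only the unary header, the total length and the final zeros restrict the input: any bits in
between are the characteristic vectors of some automaton. -/
theorem exists_encode {x : List Bool} {n s k : ℕ} (h : Parsed σ x n s k) :
    ∃ A : FinNFA σ, A.n = n ∧ (A.start : ℕ) = s ∧ x = A.encode k := by
  let A : FinNFA σ :=
    { n := n
      start := ⟨s, h.start_lt⟩
      accept := fun q => decide (1 < inputSymbol x (n + s + 2 + q))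
      trans := fun q a q' =>
        decide (1 < inputSymbol x (n + s + 2 + n + q * (σ * n) + (a * n + q'))) }
  have hbit : ∀ i < x.length, bitSymbol (decide (1 < inputSymbol x i)) = inputSymbol x i := by
    intro i hi
    rw [inputSymbol_of_lt hi]
    cases x[i] <;> rfl
  have hlen := h.length
  simp only [bodyLength] at hlen
  refine ⟨A, rfl, rfl, ext_inputSymbol fun i => ?_⟩
  rw [inputSymbol_encode]
  change _ = if i < n then 2 else if i < n + 1 then 1 else if i < n + 1 + s then 2
    else if i < n + 1 + s + 1 then 1
    else if i < n + 1 + s + 1 + n then bitSymbol (A.final (i - (n + 1 + s + 1)))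
    else if i < n + 1 + s + 1 + n + n * (σ * n) then
      bitSymbol (A.edge ((i - (n + 1 + s + 1 + n)) / (σ * n)) ((i - (n + 1 + s + 1 + n)) % (σ * n)))
    else if i < n + 1 + s + 1 + n + n * (σ * n) + k then 1 else 0
  split_ifs with h1 h2 h3 h4 h5 h6 h7
  · exact h.ones i h1
  · rw [show i = n by omega]; exact h.sep
  · rw [show i = n + 1 + (i - (n + 1)) by omega]; exact h.ones' _ (by omega)
  · rw [show i = n + 1 + s by omega]; exact h.sep'
  · have hq : i - (n + 1 + s + 1) < A.n := show _ < n by omega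
    rw [final, dif_pos hq]
    change _ = bitSymbol (decide (1 < inputSymbol x (n + s + 2 + (i - (n + 1 + s + 1)))))
    rw [show n + s + 2 + (i - (n + 1 + s + 1)) = i by omega, hbit i (by omega)]
  · set u := i - (n + 1 + s + 1 + n) with hu
    have hu' : u < n * (σ * n) := by omega
    have hpos : 0 < σ * n := by
      rcases Nat.eq_zero_or_pos (σ * n) with h0 | h0
      · rw [h0] at hu'; omega
      · exact h0
    have hq : u / (σ * n) < A.n ∧ u % (σ * n) < σ * A.n :=
      ⟨Nat.div_lt_of_lt_mul (by rwa [Nat.mul_comm]), Nat.mod_lt _ hpos⟩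
    rw [edge, dif_pos hq]
    change _ = bitSymbol (decide (1 < inputSymbol x (n + s + 2 + n + u / (σ * n) * (σ * n) +
      (u % (σ * n) / n * n + u % (σ * n) % n))))
    have e1 : u % (σ * n) / n * n + u % (σ * n) % n = u % (σ * n) := by
      rw [Nat.mul_comm, Nat.div_add_mod]
    have e2 : u / (σ * n) * (σ * n) + u % (σ * n) = u := by
      rw [Nat.mul_comm, Nat.div_add_mod]
    rw [e1, Nat.add_assoc, e2, show n + s + 2 + n + u = i by omega, hbit i (by omega)]
  · rw [show i = bodyLength σ n s + (i - bodyLength σ n s) by simp only [bodyLength]; omega]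
    exact h.zeros _ (by simp only [bodyLength]; omega)
  · exact inputSymbol_of_le (by omega)

end FinNFA

namespace RAM

/-- Each unary block ends at its first `0`, and then the total length determines `k`. -/
theorem Parsed.unique {σ n s k n' s' k' : ℕ} {x : List Bool} (h : Parsed σ x n s k)
    (h' : Parsed σ x n' s' k') : n = n' ∧ s = s' ∧ k = k' := by
  have hn : n = n' := by
    rcases lt_trichotomy n n' with hlt | heq | hlt
    · have := h'.ones n hlt
      rw [h.sep] at this; omega
    · exact heq
    · have := h.ones n' hlt
      rw [h'.sep] at this; omega
  subst hn
  have hs : s = s' := by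
    rcases lt_trichotomy s s' with hlt | heq | hlt
    · have := h'.ones' s hlt
      rw [h.sep'] at this; omega
    · exact heq
    · have := h.ones' s' hlt
      rw [h'.sep'] at this; omega
  subst hs
  have h1 := h.length
  have h2 := h'.length
  exact ⟨rfl, rfl, by omega⟩

end RAM

/-! ### Injectivity of the encoding, and the witnesses of an encoded automaton -/

namespace FinNFA

open RAM

theorem encode_injective {σ : ℕ} {A A' : FinNFA σ} {k k' : ℕ} (h : A.encode k = A'.encode k') :
    A = A' ∧ k = k' := by
  have hp := A.parsed_encode k
  have hp' := A'.parsed_encode k'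
  rw [← h] at hp'
  obtain ⟨hn, hs, hk⟩ := hp.unique hp'
  refine ⟨?_, hk⟩
  have hf : ∀ q < A.n, A.final q = A'.final q := fun q hq => bitSymbol_injective (by
    rw [← A.inputSymbol_final (k := k) hq, ← A'.inputSymbol_final (k := k') (by omega), h, hs, hn])
  have he : ∀ q < A.n, ∀ e < σ * A.n, A.edge q e = A'.edge q e := fun q hq e he =>
    bitSymbol_injective (by
      rw [← A.inputSymbol_edge (k := k) hq he,
        ← A'.inputSymbol_edge (k := k') (by omega) (by rwa [← hn]), h, hs, hn])
  obtain ⟨n, start, accept, trans⟩ := A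
  obtain ⟨n', start', accept', trans'⟩ := A'
  obtain rfl : n = n' := hn
  obtain rfl : start = start' := Fin.ext hs
  congr
  · funext q
    have := hf q q.2
    simpa [final] using this
  · funext q a q'
    have := he q q.2 (a * n + q') (mul_add_lt a.2 q'.2)
    rw [edge_mk ⟨n, start, accept, trans⟩ q q' a, edge_mk ⟨n, start, accept', trans'⟩ q q' a] at this
    exact this

/-- The witnesses for the encoding of an unambiguous automaton. -/
theorem witnesses_encode {σ : ℕ} {A : FinNFA σ} {k : ℕ} (hA : A.Unambiguous) :
    witnesses (MemUFA σ) (A.encode k) = {y | y.length = k ∧ y ∈ A.toNFA.accepts} := by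
  ext y
  constructor
  · rintro ⟨A', k', h, -, h1, h2⟩
    obtain ⟨rfl, rfl⟩ := encode_injective h
    exact ⟨h1, h2⟩
  · rintro ⟨h1, h2⟩
    exact ⟨A, k, rfl, hA, h1, h2⟩

theorem witnesses_encode_of_not {σ : ℕ} {A : FinNFA σ} {k : ℕ} (hA : ¬ A.Unambiguous) :
    witnesses (MemUFA σ) (A.encode k) = ∅ := by
  ext y
  simp only [Set.mem_empty_iff_false, iff_false]
  rintro ⟨A', k', h, hA', -⟩
  obtain ⟨rfl, rfl⟩ := encode_injective h
  exact hA hA'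

theorem witnesses_of_not_encode {σ : ℕ} {x : List Bool} (h : ∀ (A : FinNFA σ) k, x ≠ A.encode k) :
    witnesses (MemUFA σ) x = ∅ := by
  ext y
  simp only [Set.mem_empty_iff_false, iff_false]
  rintro ⟨A, k, h', -⟩
  exact h A k h'

/-- The list of all witnesses: it has no duplicates if the automaton is unambiguous. -/
theorem exists_witness_list {σ : ℕ} (A : FinNFA σ) (k : ℕ) :
    ∃ ys : List (List (Fin σ)), ys.map written = A.wordList k A.start (σ * A.n) ∧
      (A.Unambiguous → ys.Nodup ∧ ∀ y, y ∈ ys ↔ y ∈ witnesses (MemUFA σ) (A.encode k)) := by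
  have hinj : Function.Injective (written (σ := σ)) := List.map_injective_iff.2 Fin.val_injective
  have hex : ∀ l : List (List ℕ), (∀ w ∈ l, ∃ y : List (Fin σ), w = written y) →
      ∃ ys : List (List (Fin σ)), ys.map written = l := by
    intro l
    induction l with
    | nil => exact fun _ => ⟨[], rfl⟩
    | cons w l ih =>
      intro h
      obtain ⟨ys, rfl⟩ := ih fun w hw => h w (by simp [hw])
      obtain ⟨y, rfl⟩ := h w (by simp)
      exact ⟨y :: ys, rfl⟩
  obtain ⟨ys, hys⟩ := hex (A.wordList k A.start (σ * A.n)) fun w hw => by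
    obtain ⟨-, r, hr⟩ := (A.mem_wordList).1 hw
    exact hr.exists_written
  refine ⟨ys, hys, fun hA => ⟨?_, fun y => ?_⟩⟩
  · refine List.Nodup.of_map written ?_
    rw [hys]
    exact A.nodup_wordList (unambiguous_iff.1 hA) _
  · rw [witnesses_encode hA, ← List.mem_map_of_injective hinj, hys, mem_wordList]
    simp [mem_accepts_iff, written]

end FinNFA

/-! ## Expressions for the components of the input -/

namespace RAM

theorem sum_ite_lt {L m : ℕ} (h : m ≤ L) :
    (∑ i ∈ Finset.range L, if i < m then 1 else 0) = m := by
  rw [Finset.sum_boole]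
  have : {i ∈ Finset.range L | i < m} = Finset.range m := by
    ext i; simp; omega
  simp [this]

/-- The way in which expressions find a number: they count the smaller ones. -/
theorem sum_ite_iff {L m : ℕ} (p : ℕ → Prop) [DecidablePred p] (h : m ≤ L)
    (hp : ∀ i < L, p i ↔ i < m) : (∑ i ∈ Finset.range L, if p i then 1 else 0) = m := by
  rw [← sum_ite_lt h]
  exact Finset.sum_congr rfl fun i hi => if_congr (hp i (Finset.mem_range.1 hi)) rfl rfl

namespace Expr

variable (x : List Bool) (L : ℕ) (M : ℕ → ℕ) (env : List ℕ)

/-- Product; the first factor has to be at most `L`. -/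
def mul (a b : Expr) : Expr :=
  call (sum (ite (var 0) (var 1) (var 2) (const 0))) a b (const 0) (const 0)

/-- Truncated subtraction, for a difference of at most `L`. -/
def sub (a b : Expr) : Expr :=
  call (sum (ite (add (var 0) (var 2)) (var 1) (const 1) (const 0))) a b (const 0) (const 0)

def eq (a b : Expr) : Expr := ite a b (const 0) (ite b a (const 0) (const 1))

def and (a b : Expr) : Expr := ite (const 0) a b (const 0)

/-- The number of consecutive symbols `2` of the input from position `p` on. -/
def ones (p : Expr) : Expr :=
  call (sum (ite (sum (ite (var 0) (add (var 1) (const 1))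
    (ite (input (add (var 2) (var 0))) (const 2) (const 1) (const 0)) (const 0)))
    (const 1) (const 1) (const 0))) p (const 0) (const 0) (const 0)

variable {x L M env}

theorem eval_mul {a b : Expr} (h : a.eval x L M env ≤ L) :
    (mul a b).eval x L M env = a.eval x L M env * b.eval x L M env := by
  simp only [mul, eval, ifLt_eq, List.getD_cons_zero, List.getD_cons_succ]
  rw [← Finset.sum_filter]
  have : {i ∈ Finset.range L | i < a.eval x L M env} = Finset.range (a.eval x L M env) := by
    ext i; simp; omega
  simp [this]

theorem eval_sub {a b : Expr} (h : a.eval x L M env ≤ b.eval x L M env + L) :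
    (sub a b).eval x L M env = a.eval x L M env - b.eval x L M env := by
  simp only [sub, eval, ifLt_eq, List.getD_cons_zero, List.getD_cons_succ]
  exact sum_ite_iff _ (by omega) fun i hi => by omega

theorem eval_eq {a b : Expr} : (eq a b).eval x L M env =
    ifEq (a.eval x L M env) (b.eval x L M env) 1 0 := by
  simp only [eq, eval, ifLt_eq, ifEq_eq]
  split_ifs <;> omega

theorem eval_and {a b : Expr} : (and a b).eval x L M env =
    ifLt 0 (a.eval x L M env) (b.eval x L M env) 0 := rfl

/-- The outer sum counts the `i` for which the inner sum finds no symbol below `2` at the offsets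
`0, …, i`. These are exactly the `i` before the first such symbol. -/
theorem eval_ones {p : Expr} {m : ℕ} (h : ∀ i < m, inputSymbol x (p.eval x L M env + i) = 2)
    (h' : inputSymbol x (p.eval x L M env + m) ≠ 2) (hm : m ≤ L) :
    (ones p).eval x L M env = m := by
  simp only [ones, eval, ifLt_eq, List.getD_cons_zero, List.getD_cons_succ]
  refine sum_ite_iff _ hm fun i hi => ?_
  rw [Nat.lt_one_iff, Finset.sum_eq_zero_iff]
  constructor
  · intro h0
    by_contra him
    have := h0 m (Finset.mem_range.2 (by omega))
    rw [if_pos (by omega), if_pos] at this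
    · omega
    · have := inputSymbol_le x (p.eval x L M env + m)
      omega
  · intro him j hj
    by_cases hji : j < i + 1
    · rw [if_pos hji, h j (by omega)]
      rfl
    · rw [if_neg hji]

theorem eval_ones_le {p : Expr} : (ones p).eval x L M env ≤ L := by
  simp only [ones, eval, ifLt_eq]
  rw [Finset.sum_boole]
  exact (Finset.card_filter_le _ _).trans (by simp)

/-- The number of states. -/
def numStates : Expr := ones (const 0)

/-- The initial state. -/
def initial : Expr := ones (add numStates (const 1))

/-- The number of edges at each state. -/
def numEdges (σ : ℕ) : Expr := mul (const σ) numStates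

/-- The position of the transition relation. -/
def transPos : Expr := add (add (add numStates initial) (const 2)) numStates

/-- The position after the automaton. -/
def bodyEnd (σ : ℕ) : Expr := add transPos (mul numStates (numEdges σ))

/-- The length of the words. -/
def wordLength (σ : ℕ) : Expr :=
  sum (ite (var 0) (bodyEnd σ) (const 0) (ite (const 0) (input (var 0)) (const 1) (const 0)))

def inputLength : Expr := sum (ite (const 0) (input (var 0)) (const 1) (const 0))

/-- `1` if the value is not `b`. -/
def ne (a b : Expr) : Expr := ite a b (const 1) (ite b a (const 1) (const 0))

theorem eval_ne {a b : Expr} : (ne a b).eval x L M env =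
    ifEq (a.eval x L M env) (b.eval x L M env) 0 1 := by
  simp only [ne, eval, ifLt_eq, ifEq_eq]
  split_ifs <;> omega

/-- The number of violations of the format of inputs. -/
def violations (σ : ℕ) : Expr :=
  add (ite initial numStates (const 0) (const 1)) <|
  add (sum (ite (var 0) numStates (ne (input (var 0)) (const 2)) (const 0))) <|
  add (ne (input numStates) (const 1)) <|
  add (sum (ite (var 0) initial
    (ne (input (add (add numStates (const 1)) (var 0))) (const 2)) (const 0))) <|
  add (ne (input (add (add numStates (const 1)) initial)) (const 1)) <|
  add (ne inputLength (add (bodyEnd σ) (wordLength σ))) <|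
  sum (ite (var 0) (wordLength σ) (ne (input (add (bodyEnd σ) (var 0))) (const 1)) (const 0))

theorem eval_inputLength (h : x.length ≤ L) : inputLength.eval x L M env = x.length := by
  simp only [inputLength, eval, ifLt_eq, List.getD_cons_zero]
  exact sum_ite_iff _ h fun i _ => inputSymbol_pos

/-- A `call` hides the surrounding variables from its body, and nothing here loads from memory; so
the value can be moved out of sums, which add a variable. -/
theorem eval_numStates_congr (M' : ℕ → ℕ) (env' : List ℕ) :
    numStates.eval x L M env = numStates.eval x L M' env' := rfl

theorem eval_initial_congr (M' : ℕ → ℕ) (env' : List ℕ) :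
    initial.eval x L M env = initial.eval x L M' env' := rfl

theorem eval_bodyEnd {σ : ℕ} (hσ : σ ≤ L) : (bodyEnd σ).eval x L M env =
    bodyLength σ (numStates.eval x L M env) (initial.eval x L M env) := by
  have hn : numStates.eval x L M env ≤ L := eval_ones_le
  simp only [bodyEnd, transPos, eval, numEdges]
  rw [eval_mul hn, eval_mul (by simpa [eval] using hσ)]
  simp only [eval, bodyLength]

theorem eval_wordLength_le {σ : ℕ} : (wordLength σ).eval x L M env ≤ L := by
  simp only [wordLength, eval, ifLt_eq]
  refine (Finset.sum_le_sum (g := fun _ => 1) fun i _ => ?_).trans (by simp)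
  split_ifs <;> omega

theorem eval_wordLength {σ : ℕ} {k : ℕ} (hσ : σ ≤ L) (hx : x.length ≤ L)
    (h : x.length = bodyLength σ (numStates.eval x L M env) (initial.eval x L M env) + k) :
    (wordLength σ).eval x L M env = k := by
  have hb : ∀ i, (bodyEnd σ).eval x L M (i :: env) = _ := fun i => eval_bodyEnd hσ
  simp only [wordLength, eval, ifLt_eq, hb]
  simp only [eval_numStates_congr (env := _ :: env) M env,
    eval_initial_congr (env := _ :: env) M env, List.getD_cons_zero]
  set Z := bodyLength σ (numStates.eval x L M env) (initial.eval x L M env)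
  have : ∀ i, (if i < Z then 0 else if 0 < inputSymbol x i then 1 else 0) =
      if i ∈ Finset.Ico Z x.length then 1 else 0 := by
    intro i
    simp only [inputSymbol_pos, Finset.mem_Ico]
    split_ifs <;> omega
  simp only [this, Finset.sum_boole]
  have h' : {i ∈ Finset.range L | i ∈ Finset.Ico Z x.length} = Finset.Ico Z x.length := by
    ext i; simp; omega
  rw [h']
  simp; omega

theorem eval_wordLength_congr {σ : ℕ} (M' : ℕ → ℕ) (env' : List ℕ) :
    (wordLength σ).eval x L M env = (wordLength σ).eval x L M' env' := rfl

/-- The three parameters have a value on every input, well-formed or not. Each clause of `Parsed`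
contributes a natural number that vanishes if and only if the clause holds. -/
theorem eval_violations {σ : ℕ} (hσ : σ ≤ L) (hx : x.length ≤ L) :
    (violations σ).eval x L M env = 0 ↔ Parsed σ x (numStates.eval x L M env)
      (initial.eval x L M env) ((wordLength σ).eval x L M env) := by
  have hn : numStates.eval x L M env ≤ L := eval_ones_le
  have hs : initial.eval x L M env ≤ L := eval_ones_le
  have hk : (wordLength σ).eval x L M env ≤ L := eval_wordLength_le
  simp only [violations, eval, eval_ne, eval_bodyEnd hσ, eval_inputLength hx,
    Nat.add_eq_zero_iff, Finset.sum_eq_zero_iff, Finset.mem_range,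
    eval_numStates_congr (env := _ :: env) M env, eval_initial_congr (env := _ :: env) M env,
    eval_wordLength_congr (env := _ :: env) M env, List.getD_cons_zero]
  generalize numStates.eval x L M env = n at *
  generalize initial.eval x L M env = s at *
  generalize (wordLength σ).eval x L M env = k at *
  simp only [ifLt_eq, ifEq_eq]
  have key : ∀ {m : ℕ} {f : ℕ → Prop} [DecidablePred f], m ≤ L →
      ((∀ i < L, (if i < m then if f i then 0 else 1 else 0) = 0) ↔ ∀ i < m, f i) := by
    intro m f _ hm
    refine ⟨fun h i hi => ?_, fun h i _ => ?_⟩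
    · have := h i (by omega)
      simpa [hi] using this
    · by_cases hi : i < m
      · simp [hi, h i hi]
      · simp [hi]
  rw [key hn, key hs, key hk]
  constructor
  · rintro ⟨h1, h2, h3, h4, h5, h6, h7⟩
    exact ⟨by simpa using h1, h2, by simpa using h3, h4, by simpa using h5, by simpa using h6, h7⟩
  · rintro ⟨h1, h2, h3, h4, h5, h6, h7⟩
    exact ⟨by simpa using h1, h2, by simpa using h3, h4, by simpa using h5, by simpa using h6, h7⟩

/-! ### Expressions for the automaton -/

def final (q : Expr) : Expr :=
  call (ite (var 0) numStates
    (ite (const 1) (input (add (add (add numStates initial) (const 2)) (var 0)))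
      (const 1) (const 0)) (const 0)) q (const 0) (const 0) (const 0)

def edge (σ : ℕ) (q e : Expr) : Expr :=
  call (ite (var 0) numStates (ite (var 1) (numEdges σ)
    (ite (const 1) (input (add (add transPos (mul (var 0) (numEdges σ))) (var 1)))
      (const 1) (const 0)) (const 0)) (const 0)) q e (const 0) (const 0)

/-- The quotient by the number of states. -/
def letter (e : Expr) : Expr :=
  call (sum (ite (var 1) (mul (add (var 0) (const 1)) numStates) (const 0) (const 1)))
    e (const 0) (const 0) (const 0)

/-- The remainder modulo the number of states. -/
def target (e : Expr) : Expr := sub e (mul (letter e) numStates)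

end Expr

/-! ### Values of the expressions on the encoding of an automaton -/

/-- The bound of the loops is large enough for the automaton. -/
structure Enough (σ : ℕ) (A : FinNFA σ) (k L : ℕ) : Prop where
  letters : σ ≤ L
  length : (A.encode k).length ≤ L
  states : A.n < L
  edges : σ * A.n < L
  words : k < L
  tables : 10 ≤ L
  bits : σ * k < L
  twins : 2 * A.n ^ 2 ≤ L ∨ σ = 0

/-- The encoding contains `σ * n ^ 2` bits for the transitions, and the bound at least twice the
length. For `σ = 0` there are no such bits, hence the alternative in `twins`. -/
theorem enough {σ : ℕ} (A : FinNFA σ) (k : ℕ) :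
    Enough σ A k ((σ + 10) + (σ + 2) * (A.encode k).length) := by
  have h := A.length_encode k
  simp only [bodyLength] at h
  have hn : 0 < A.n := A.start.pos
  set N := (A.encode k).length
  have h1 : (σ + 2) * N = σ * N + 2 * N := by ring
  have h2 : σ * A.n ≤ A.n * (σ * A.n) := Nat.le_mul_of_pos_left _ hn
  have h3 : σ * k ≤ σ * N := Nat.mul_le_mul_left _ (by omega)
  constructor <;> try omega
  rcases Nat.eq_zero_or_pos σ with h0 | h0
  · exact .inr h0
  · left
    have : A.n ^ 2 ≤ A.n * (σ * A.n) := by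
      calc A.n ^ 2 = A.n * (1 * A.n) := by ring
        _ ≤ A.n * (σ * A.n) := Nat.mul_le_mul_left _ (Nat.mul_le_mul_right _ h0)
    omega

namespace Expr

variable {σ : ℕ} {A : FinNFA σ} {k L : ℕ} {M : ℕ → ℕ} {env : List ℕ}

theorem eval_numStates (hL : Enough σ A k L) : numStates.eval (A.encode k) L M env = A.n := by
  have hp := A.parsed_encode k
  have := hL.states
  refine eval_ones (fun i hi => ?_) ?_ (by omega)
  · simpa [eval] using hp.ones i hi
  · simp [eval, hp.sep]

theorem eval_initial (hL : Enough σ A k L) : initial.eval (A.encode k) L M env = A.start := by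
  have hp := A.parsed_encode k
  have := hL.states
  have := hp.start_lt
  refine eval_ones (fun i hi => ?_) ?_ (by omega)
  · simpa [eval, eval_numStates hL] using hp.ones' i hi
  · simp [eval, eval_numStates hL, hp.sep']

theorem eval_numEdges (hL : Enough σ A k L) :
    (numEdges σ).eval (A.encode k) L M env = σ * A.n := by
  rw [numEdges, eval_mul (by simpa [eval] using hL.letters), eval_numStates hL]
  simp [eval]

theorem eval_wordLength_encode (hL : Enough σ A k L) :
    (wordLength σ).eval (A.encode k) L M env = k :=
  eval_wordLength hL.letters hL.length (by
    rw [eval_numStates hL, eval_initial hL, A.length_encode])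

theorem eval_violations_encode (hL : Enough σ A k L) :
    (violations σ).eval (A.encode k) L M env = 0 := by
  rw [eval_violations hL.letters hL.length, eval_numStates hL, eval_initial hL,
    eval_wordLength_encode hL]
  exact A.parsed_encode k

theorem eval_final (hL : Enough σ A k L) {q : Expr} : (final q).eval (A.encode k) L M env =
    (A.final (q.eval (A.encode k) L M env)).toNat := by
  simp only [final, eval, ifLt_eq, eval_numStates hL, eval_initial hL, List.getD_cons_zero]
  generalize q.eval (A.encode k) L M env = q
  by_cases hq : q < A.n
  · rw [if_pos hq, A.inputSymbol_final hq]
    cases A.final q <;> rfl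
  · simp [hq, FinNFA.final]

theorem eval_edge (hL : Enough σ A k L) {q e : Expr} : (edge σ q e).eval (A.encode k) L M env =
    (A.edge (q.eval (A.encode k) L M env) (e.eval (A.encode k) L M env)).toNat := by
  simp only [edge, eval, ifLt_eq, eval_numStates hL, eval_initial hL, eval_numEdges hL, transPos,
    List.getD_cons_zero, List.getD_cons_succ]
  generalize q.eval (A.encode k) L M env = q
  generalize e.eval (A.encode k) L M env = e
  by_cases hq : q < A.n
  · by_cases he : e < σ * A.n
    · have := hL.states
      rw [if_pos hq, if_pos he, eval_mul (by simp [eval]; omega), eval_numEdges hL]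
      simp only [eval, List.getD_cons_zero]
      rw [A.inputSymbol_edge hq he]
      cases A.edge q e <;> rfl
    · simp [he, FinNFA.edge]
  · simp [hq, FinNFA.edge]

/-- The quotient is the number of `i` with `(i + 1) * n ≤ e`. -/
theorem eval_letter (hL : Enough σ A k L) {e : Expr} (he : e.eval (A.encode k) L M env ≤ L) :
    (letter e).eval (A.encode k) L M env = e.eval (A.encode k) L M env / A.n := by
  have hn : 0 < A.n := A.start.pos
  simp only [letter, eval]
  generalize e.eval (A.encode k) L M env = e at *
  have hmul : ∀ i ∈ Finset.range L,
      (mul (add (var 0) (const 1)) numStates).eval (A.encode k) L M [i, e, 0, 0, 0] =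
        (i + 1) * A.n := by
    intro i hi
    have := Finset.mem_range.1 hi
    rw [eval_mul (by simp [eval]; omega), eval_numStates hL]
    simp [eval]
  rw [Finset.sum_congr rfl fun i hi => by rw [hmul i hi]]
  simp only [ifLt_eq, List.getD_cons_zero, List.getD_cons_succ]
  have : ∀ i, (if e < (i + 1) * A.n then 0 else 1) = if i < e / A.n then 1 else 0 := by
    intro i
    have : i < e / A.n ↔ (i + 1) * A.n ≤ e := Nat.le_div_iff_mul_le hn
    split_ifs <;> omega
  simp only [this]
  exact sum_ite_lt ((Nat.div_le_self _ _).trans he)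

theorem eval_target (hL : Enough σ A k L) {e : Expr} (he : e.eval (A.encode k) L M env ≤ L) :
    (target e).eval (A.encode k) L M env = e.eval (A.encode k) L M env % A.n := by
  have hl := eval_letter hL he
  have hm : (mul (letter e) numStates).eval (A.encode k) L M env = _ :=
    eval_mul (by rw [hl]; exact (Nat.div_le_self _ _).trans he)
  rw [target, eval_sub (by omega), hm, hl, eval_numStates hL, Nat.mod_eq_sub_div_mul]

end Expr

end RAM

/-! ## Tables in memory

A table has four indices below `L`; the cells of different tables have addresses with different
remainders modulo `L`. -/

namespace RAM

/-- The number of a cell in a table. -/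
def idx (L a b c d : ℕ) : ℕ := L * (L * (L * a + b) + c) + d

/-- The address of a cell of the table number `j`. -/
def flat (L a b c d j : ℕ) : ℕ := L * idx L a b c d + j

theorem mul_add_inj {L u d u' d' : ℕ} (hd : d < L) (hd' : d' < L) (h : L * u + d = L * u' + d') :
    u = u' ∧ d = d' := by
  have h1 := congrArg (· / L) h
  simp only [Nat.mul_add_div (by omega : L > 0), Nat.div_eq_of_lt hd, Nat.div_eq_of_lt hd'] at h1
  obtain rfl : u = u' := by simpa using h1
  exact ⟨rfl, by omega⟩

theorem mul_add_lt_mul_add {L u d u' : ℕ} (d' : ℕ) (hd : d < L) (h : u < u') :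
    L * u + d < L * u' + d' := by
  have := Nat.mul_le_mul_left L h
  rw [Nat.mul_succ] at this
  omega

/-- Tables are filled in lexicographic order of the indices, so `idx` tells which entries are
already present. The recursions below refer to a smaller first index, or to a smaller third one with
the first two equal. -/
theorem idx_lt_of_fst {L a b c d a' b' c' d' : ℕ} (hb : b' < L) (hc : c' < L) (hd : d' < L)
    (h : a' < a) : idx L a' b' c' d' < idx L a b c d :=
  mul_add_lt_mul_add _ hd (mul_add_lt_mul_add _ hc (mul_add_lt_mul_add _ hb h))

theorem idx_lt_of_trd {L a b c d c' d' : ℕ} (hd : d' < L) (h : c' < c) :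
    idx L a b c' d' < idx L a b c d :=
  mul_add_lt_mul_add _ hd (by omega)

theorem idx_inj {L a b c d a' b' c' d' : ℕ} (hb : b < L) (hc : c < L) (hd : d < L) (hb' : b' < L)
    (hc' : c' < L) (hd' : d' < L) (h : idx L a b c d = idx L a' b' c' d') :
    a = a' ∧ b = b' ∧ c = c' ∧ d = d' := by
  obtain ⟨h1, h2⟩ := mul_add_inj hd hd' h
  obtain ⟨h3, h4⟩ := mul_add_inj hc hc' h1
  obtain ⟨h5, h6⟩ := mul_add_inj hb hb' h3
  exact ⟨h5, h6, h4, h2⟩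

theorem flat_mod {L a b c d j : ℕ} (hj : j < L) : flat L a b c d j % L = j := by
  rw [flat, Nat.mul_add_mod, Nat.mod_eq_of_lt hj]

theorem forLoop_induction {α : Type*} {f : ℕ → α → α} {n : ℕ} {s : α} (I : ℕ → α → Prop)
    (h₀ : I 0 s) (h : ∀ i < n, ∀ s, I i s → I (i + 1) (f i s)) : I n (forLoop f n s) := by
  have : ∀ m ≤ n, I m (forLoop f m s) := by
    intro m
    induction m with
    | zero => exact fun _ => h₀
    | succ m ih => exact fun hm => h m hm _ (ih (by omega))
  exact this n le_rfl

namespace Expr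

def flat (a b c d : Expr) (j : ℕ) : Expr :=
  add (mul bound (add (mul bound (add (mul bound (add (mul bound a) b)) c)) d)) (const j)

/-- The content of a cell of the table number `j`. -/
def cell (j : ℕ) (a b c d : Expr) : Expr := load (flat a b c d j)

def pred (a : Expr) : Expr := sub a (const 1)

variable {x : List Bool} {L : ℕ} {M : ℕ → ℕ} {env : List ℕ}

theorem eval_flat {a b c d : Expr} {j : ℕ} : (flat a b c d j).eval x L M env =
    RAM.flat L (a.eval x L M env) (b.eval x L M env) (c.eval x L M env) (d.eval x L M env) j := by
  have h : ∀ e : Expr, (mul bound e).eval x L M env = L * e.eval x L M env :=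
    fun e => eval_mul le_rfl
  simp only [flat, eval, h, RAM.flat, idx]

theorem eval_cell {a b c d : Expr} {j : ℕ} : (cell j a b c d).eval x L M env =
    M (RAM.flat L (a.eval x L M env) (b.eval x L M env) (c.eval x L M env) (d.eval x L M env) j) := by
  rw [cell, eval, eval_flat]

theorem eval_pred {a : Expr} (h : a.eval x L M env ≤ L) :
    (pred a).eval x L M env = a.eval x L M env - 1 :=
  eval_sub (by omega)

end Expr

namespace Cmd

/-- Fill the table number `j` with the values of `e`, whose variables `3, 2, 1, 0` are the
indices. -/
def fill (j : ℕ) (e : Expr) : Cmd :=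
  loop (loop (loop (loop (store (.flat (.var 3) (.var 2) (.var 1) (.var 0) j) e))))

/-- Dynamic programming: an entry may be computed from earlier entries, already known to satisfy
`G`, and from memory outside the table, which is as at the start. Since `j < L`, no cell with
another remainder is touched. -/
theorem eval_fill {x : List Bool} {L j : ℕ} {e : Expr} {env : List ℕ} {s : Store} (hj : j < L)
    (G : ℕ → ℕ → ℕ → ℕ → ℕ → Prop)
    (h : ∀ a < L, ∀ b < L, ∀ c < L, ∀ d < L, ∀ M : ℕ → ℕ, (∀ p, p % L ≠ j → M p = s.mem p) →
      (∀ a' < L, ∀ b' < L, ∀ c' < L, ∀ d' < L, idx L a' b' c' d' < idx L a b c d →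
        G a' b' c' d' (M (flat L a' b' c' d' j))) →
      G a b c d (e.eval x L M (d :: c :: b :: a :: env))) :
    (∀ a < L, ∀ b < L, ∀ c < L, ∀ d < L,
      G a b c d (((fill j e).eval x L env s).mem (flat L a b c d j))) ∧
    (∀ p, p % L ≠ j → ((fill j e).eval x L env s).mem p = s.mem p) ∧
    ((fill j e).eval x L env s).word = s.word ∧ ((fill j e).eval x L env s).outs = s.outs := by
  let J : ℕ → Store → Prop := fun u s' =>
    (∀ a < L, ∀ b < L, ∀ c < L, ∀ d < L, idx L a b c d < u →
      G a b c d (s'.mem (flat L a b c d j))) ∧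
    (∀ p, p % L ≠ j → s'.mem p = s.mem p) ∧ s'.word = s.word ∧ s'.outs = s.outs
  have hstep : ∀ a < L, ∀ b < L, ∀ c < L, ∀ d < L, ∀ s', J (idx L a b c d) s' →
      J (idx L a b c d + 1) ((store (.flat (.var 3) (.var 2) (.var 1) (.var 0) j) e).eval x L
        (d :: c :: b :: a :: env) s') := by
    intro a ha b hb c hc d hd s' ⟨h1, h2, h3, h4⟩
    have hflat : (Expr.flat (.var 3) (.var 2) (.var 1) (.var 0) j).eval x L s'.mem
        (d :: c :: b :: a :: env) = flat L a b c d j := Expr.eval_flat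
    refine ⟨fun a' ha' b' hb' c' hc' d' hd' hlt => ?_, fun p hp => ?_, h3, h4⟩
    · simp only [eval, hflat]
      by_cases heq : idx L a' b' c' d' = idx L a b c d
      · obtain ⟨rfl, rfl, rfl, rfl⟩ := idx_inj hb' hc' hd' hb hc hd heq
        rw [Function.update_self]
        exact h _ ha _ hb _ hc _ hd _ h2 h1
      · rw [Function.update_of_ne]
        · exact h1 a' ha' b' hb' c' hc' d' hd' (by omega)
        · intro hf
          exact heq (mul_add_inj hj hj hf).1
    · simp only [eval, hflat]
      rw [Function.update_of_ne, h2 p hp]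
      rintro rfl
      exact hp (flat_mod hj)
  have h1 : ∀ a < L, ∀ b < L, ∀ c < L, ∀ s', J (L * (L * (L * a + b) + c)) s' →
      J (L * (L * (L * a + b) + (c + 1))) ((loop (store (.flat (.var 3) (.var 2) (.var 1) (.var 0) j)
        e)).eval x L (c :: b :: a :: env) s') := by
    intro a ha b hb c hc s' hs'
    exact forLoop_induction (fun d => J (L * (L * (L * a + b) + c) + d)) hs'
      fun d hd s' hs' => hstep a ha b hb c hc d hd s' hs'
  have h2 : ∀ a < L, ∀ b < L, ∀ s', J (L * (L * (L * a + b))) s' →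
      J (L * (L * (L * a + (b + 1)))) ((loop (loop (store (.flat (.var 3) (.var 2) (.var 1) (.var 0)
        j) e))).eval x L (b :: a :: env) s') := by
    intro a ha b hb s' hs'
    exact forLoop_induction (fun c => J (L * (L * (L * a + b) + c))) hs'
      fun c hc s' hs' => h1 a ha b hb c hc s' hs'
  have h3 : ∀ a < L, ∀ s', J (L * (L * (L * a))) s' →
      J (L * (L * (L * (a + 1)))) ((loop (loop (loop (store (.flat (.var 3) (.var 2) (.var 1) (.var 0)
        j) e)))).eval x L (a :: env) s') := by
    intro a ha s' hs'
    exact forLoop_induction (fun b => J (L * (L * (L * a + b)))) hs'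
      fun b hb s' hs' => h2 a ha b hb s' hs'
  have h4 : J (L * (L * (L * L))) ((fill j e).eval x L env s) :=
    forLoop_induction (fun a => J (L * (L * (L * a)))) ⟨by simp, fun _ _ => rfl, rfl, rfl⟩
      fun a ha s' hs' => h3 a ha s' hs'
  refine ⟨fun a ha b hb c hc d hd => h4.1 a ha b hb c hc d hd ?_, h4.2⟩
  have := mul_add_lt_mul_add 0 hd (mul_add_lt_mul_add 0 hc (mul_add_lt_mul_add 0 hb ha))
  simpa [idx] using this

/-- Filling a table changes nothing else. -/
theorem eval_fill_frame {x : List Bool} {L j : ℕ} {e : Expr} {env : List ℕ} {s : Store}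
    (hj : j < L) : (∀ p, p % L ≠ j → ((fill j e).eval x L env s).mem p = s.mem p) ∧
    ((fill j e).eval x L env s).word = s.word ∧ ((fill j e).eval x L env s).outs = s.outs :=
  (eval_fill hj (fun _ _ _ _ _ => True) (by intros; trivial)).2

end Cmd

/-! ### The numbers of accepted words -/

namespace Expr

/-- The number of accepted words of length `var 3` from the state `var 2` whose runs start with an
edge below `var 1`. -/
def counts (σ : ℕ) : Expr :=
  ite (var 3) (const 1) (final (var 2)) <| ite (var 1) (const 1) (const 0) <|
    add (and (edge σ (var 2) (pred (var 1)))
        (cell 3 (pred (var 3)) (target (pred (var 1))) (numEdges σ) (const 0)))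
      (cell 3 (var 3) (var 2) (pred (var 1)) (const 0))

/-- Positive if there are two runs on a word of length `var 3` to the states `var 2` and `var 1`,
which are different if and only if `var 0` is `1`. -/
def twins (σ : ℕ) : Expr :=
  ite (var 3) (const 1)
    (and (eq (var 2) initial) (and (eq (var 1) initial) (eq (var 0) (const 0)))) <|
    sum <| sum <| sum <| sum <|
      and (edge σ (var 3) (add (mul numStates (var 1)) (var 6))) <|
      and (edge σ (var 2) (add (mul numStates (var 1)) (var 5))) <|
      and (ite (var 0) (const 2) (const 1) (const 0)) <|
      and (ite (const 0) (eq (var 6) (var 5)) (eq (var 4) (var 0)) (eq (var 4) (const 1)))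
        (cell 4 (pred (var 7)) (var 3) (var 2) (var 0))

end Expr

/-- The table number 3 contains the numbers of accepted words. -/
def Counted {σ : ℕ} (A : FinNFA σ) (k L : ℕ) (M : ℕ → ℕ) : Prop :=
  ∀ i ≤ k, ∀ q < A.n, ∀ e ≤ σ * A.n, ∀ d < L,
    M (flat L i q e d 3) = (A.wordList i q e).length

/-- The table number 4 describes the pairs of runs on the same word. -/
def Twinned {σ : ℕ} (A : FinNFA σ) (L : ℕ) (M : ℕ → ℕ) : Prop :=
  ∀ t < L, ∀ p < A.n, ∀ q < A.n, ∀ d < 2,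
    0 < M (flat L t p q d 4) ↔ A.Twin t p q (decide (d = 1))

section Tables

variable {σ : ℕ} {A : FinNFA σ} {k L : ℕ}

/-- The recursion of `wordList`, with concatenation turned into addition. The fourth index is a
dummy. -/
theorem counted_fill (hL : Enough σ A k L) {env : List ℕ} {s : Store} :
    Counted A k L ((Cmd.fill 3 (.counts σ)).eval (A.encode k) L env s).mem := by
  have hn : 0 < A.n := A.start.pos
  have hLn := hL.states
  have hLe := hL.edges
  have hLk := hL.words
  have hLt := hL.tables
  have key := (Cmd.eval_fill (x := A.encode k) (L := L) (j := 3) (e := .counts σ) (env := env)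
    (s := s) (by omega)
    (fun i q e _ v => i ≤ k → q < A.n → e ≤ σ * A.n → v = (A.wordList i q e).length) ?_).1
  · intro i hi q hq e he d hd
    exact key i (by omega) q (by omega) e (by omega) d hd hi hq he
  · intro i hi q hq e he d hd M _ ih hik hqn hen
    set v := d :: e :: q :: i :: env with hv
    have hpe : (Expr.pred (.var 1)).eval (A.encode k) L M v = e - 1 := Expr.eval_pred he.le
    have hpi : (Expr.pred (.var 3)).eval (A.encode k) L M v = i - 1 := Expr.eval_pred hi.le
    have htar : (Expr.target (.pred (.var 1))).eval (A.encode k) L M v = (e - 1) % A.n := by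
      rw [Expr.eval_target hL (by omega), hpe]
    simp only [Expr.counts, Expr.eval, Expr.eval_final hL, Expr.eval_and, Expr.eval_edge hL,
      Expr.eval_cell, Expr.eval_numEdges hL, hpe, hpi, htar]
    simp only [hv, List.getD_cons_zero, List.getD_cons_succ, ifLt_eq]
    cases i with
    | zero =>
      rw [if_pos (by omega), FinNFA.wordList]
      cases A.final q <;> rfl
    | succ i =>
      rw [if_neg (by omega)]
      cases e with
      | zero => rw [if_pos (by omega), FinNFA.wordList]; rfl
      | succ e =>
        rw [if_neg (by omega), FinNFA.wordList, List.length_append]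
        simp only [Nat.add_sub_cancel]
        have h1 := ih i (by omega) (e % A.n) (by have := Nat.mod_lt e hn; omega) (σ * A.n)
          (by omega) 0 (by omega) (idx_lt_of_fst (by have := Nat.mod_lt e hn; omega)
            (by omega) (by omega) (by omega)) (by omega) (Nat.mod_lt e hn) le_rfl
        have h2 := ih (i + 1) (by omega) q (by omega) e (by omega) 0 (by omega)
          (idx_lt_of_trd (by omega) (by omega)) hik hqn (by omega)
        rw [h1, h2]
        cases A.edge q e <;> simp

theorem twin_zero {p q : ℕ} {d : Bool} :
    A.Twin 0 p q d ↔ p = A.start ∧ q = A.start ∧ d = false := by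
  constructor
  · intro h
    cases h
    exact ⟨rfl, rfl, rfl⟩
  · rintro ⟨rfl, rfl, rfl⟩
    exact .start

theorem twin_succ {t p' q' : ℕ} {d' : Bool} : A.Twin (t + 1) p' q' d' ↔
    ∃ p q a d, A.Twin t p q d ∧ A.edge p (a * A.n + p') = true ∧ A.edge q (a * A.n + q') = true ∧
      p' < A.n ∧ q' < A.n ∧ d' = (d || decide (p' ≠ q')) := by
  constructor
  · intro h
    cases h with
    | step h h1 h2 h3 h4 => exact ⟨_, _, _, _, h, h1, h2, h3, h4, rfl⟩
  · rintro ⟨p, q, a, d, h, h1, h2, h3, h4, rfl⟩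
    exact h.step h1 h2 h3 h4

theorem pos_and_iff {a b : ℕ} : 0 < ifLt 0 a b 0 ↔ 0 < a ∧ 0 < b := by
  rw [ifLt_eq]; split_ifs <;> simp [*]

theorem pos_ifEq_iff {a b : ℕ} : 0 < ifEq a b 1 0 ↔ a = b := by
  rw [ifEq_eq]; split_ifs <;> simp [*]

theorem pos_ifLt_iff {a b : ℕ} : 0 < ifLt a b 1 0 ↔ a < b := by
  rw [ifLt_eq]; split_ifs <;> simp [*]

theorem pos_toNat_iff {b : Bool} : 0 < b.toNat ↔ b = true := by cases b <;> simp

/-- A sum of natural numbers is positive if and only if some summand is, so sums act as existential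
quantifiers: over the previous states `p`, `q`, the letter `a` and the previous bit `d`. Only the
positivity of an entry has a meaning. -/
theorem twinned_fill (hL : Enough σ A k L) {env : List ℕ} {s : Store} :
    Twinned A L ((Cmd.fill 4 (.twins σ)).eval (A.encode k) L env s).mem := by
  have hLn := hL.states
  have hLe := hL.edges
  have hLt := hL.tables
  have key := (Cmd.eval_fill (x := A.encode k) (L := L) (j := 4) (e := .twins σ) (env := env)
    (s := s) (by omega)
    (fun t p q d v => p < A.n → q < A.n → d < 2 → (0 < v ↔ A.Twin t p q (decide (d = 1)))) ?_).1
  · intro t ht p hp q hq d hd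
    exact key t (by omega) p (by omega) q (by omega) d (by omega) hp hq hd
  · intro t ht p' hp' q' hq' d' hd' M _ ih hpn hqn hdn
    have hm : ∀ (env : List ℕ) i, (Expr.mul .numStates (.var i)).eval (A.encode k) L M env =
        A.n * env.getD i L := by
      intro env i
      rw [Expr.eval_mul (by rw [Expr.eval_numStates hL]; omega), Expr.eval_numStates hL]
      rfl
    have hpt : ∀ d a q p, (Expr.pred (.var 7)).eval (A.encode k) L M
        (d :: a :: q :: p :: d' :: q' :: p' :: t :: env) = t - 1 := fun d a q p =>
      Expr.eval_pred ht.le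
    simp only [Expr.twins, Expr.eval, Expr.eval_and, Expr.eval_eq, Expr.eval_edge hL,
      Expr.eval_cell, Expr.eval_initial hL, hm, hpt]
    simp only [List.getD_cons_zero, List.getD_cons_succ]
    rw [ifLt_eq]
    cases t with
    | zero =>
      rw [if_pos (by omega), twin_zero, pos_and_iff, pos_and_iff, pos_ifEq_iff, pos_ifEq_iff,
        pos_ifEq_iff]
      simp only [decide_eq_false_iff_not]
      have : d' = 0 ↔ ¬ d' = 1 := by omega
      rw [this]
    | succ t =>
      rw [if_neg (by omega), twin_succ]
      simp only [Finset.sum_pos_iff, Finset.mem_range, pos_and_iff, pos_toNat_iff, pos_ifLt_iff,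
        Nat.add_sub_cancel]
      constructor
      · rintro ⟨p, hp, q, hq, a, ha, d, hd, h1, h2, h3, h4, h5⟩
        refine ⟨p, q, a, decide (d = 1), ?_, by rwa [Nat.mul_comm], by rwa [Nat.mul_comm], hpn, hqn,
          ?_⟩
        · have hp' := (A.edge_lt h1).1
          have hq' := (A.edge_lt h2).1
          exact (ih t (by omega) p hp q hq d hd (idx_lt_of_fst (by omega) (by omega) hd (by omega))
            hp' hq' h3).1 h5
        · by_cases hpq : p' = q'
          · simp only [hpq, ifLt_eq, ifEq_eq] at h4
            have : d' = d := by
              by_contra hne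
              simp [hne] at h4
            simp [hpq, this]
          · simp only [hpq, ifLt_eq, ifEq_eq] at h4
            have : d' = 1 := by
              by_contra hne
              simp [hne] at h4
            simp [hpq, this]
      · rintro ⟨p, q, a, d, h, h1, h2, -, -, h3⟩
        have hlt := h.lt
        -- The sum has only `L` terms, so the letter must be seen to be below `L`.
        have ha : a < σ * A.n := by
          have := (A.edge_lt h1).2
          have := Nat.le_mul_of_pos_right a A.start.pos
          omega
        have hd : d.toNat < 2 := Bool.toNat_lt d
        refine ⟨p, by omega, q, by omega, a, by omega, d.toNat, by omega, by rwa [Nat.mul_comm],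
          by rwa [Nat.mul_comm], hd, ?_, ?_⟩
        · by_cases hpq : p' = q'
          · simp only [hpq, ifLt_eq, ifEq_eq]
            have : d' = d.toNat := by
              cases d <;> simp [hpq] at h3 ⊢ <;> omega
            simp [this]
          · simp only [hpq, ifLt_eq, ifEq_eq]
            have : d' = 1 := by simpa [hpq] using h3
            simp [this]
        · refine (ih t (by omega) p (by omega) q (by omega) d.toNat (by omega)
            (idx_lt_of_fst (by omega) (by omega) (by omega) (by omega)) hlt.1 hlt.2 hd).2 ?_
          cases d <;> exact h

end Tables

/-! ### The number of witnesses -/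

namespace Expr

/-- Positive if the automaton is ambiguous. -/
def ambiguous : Expr :=
  sum <| sum <| sum <|
    and (final (var 1)) (and (final (var 0)) (cell 4 (var 2) (var 1) (var 0) (const 1)))

/-- The number of witnesses. -/
def total (σ : ℕ) : Expr :=
  ite (violations σ) (const 1)
    (ite ambiguous (const 1) (cell 3 (wordLength σ) initial (numEdges σ) (const 0)) (const 0))
    (const 0)

end Expr

/-- The memory contains the tables for the input `x`. -/
def Prepared (σ : ℕ) (x : List Bool) (L : ℕ) (M : ℕ → ℕ) : Prop :=
  ∀ (A : FinNFA σ) (k : ℕ), x = A.encode k → Counted A k L M ∧ Twinned A L M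

/-- The bound of the loops for the input `x`. -/
def boundOf (σ : ℕ) (x : List Bool) : ℕ := (σ + 10) + (σ + 2) * x.length

theorem le_boundOf (σ : ℕ) (x : List Bool) :
    σ ≤ boundOf σ x ∧ x.length ≤ boundOf σ x ∧ 10 ≤ boundOf σ x := by
  unfold boundOf
  have : (σ + 2) * x.length = σ * x.length + 2 * x.length := by ring
  exact ⟨by omega, by omega, by omega⟩

def prepare (σ : ℕ) : Cmd := .seq (.fill 3 (.counts σ)) (.fill 4 (.twins σ))

theorem prepared_prepare {σ : ℕ} {x : List Bool} {s : Store} {env : List ℕ} :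
    Prepared σ x (boundOf σ x) ((prepare σ).eval x (boundOf σ x) env s).mem ∧
      ((prepare σ).eval x (boundOf σ x) env s).word = s.word ∧
      ((prepare σ).eval x (boundOf σ x) env s).outs = s.outs := by
  have hL := (le_boundOf σ x).2.2
  simp only [prepare, Cmd.eval]
  obtain ⟨f1, w1, o1⟩ := Cmd.eval_fill_frame (x := x) (L := boundOf σ x) (j := 3) (e := .counts σ)
    (env := env) (s := s) (by omega)
  obtain ⟨f2, w2, o2⟩ := Cmd.eval_fill_frame (x := x) (L := boundOf σ x) (j := 4) (e := .twins σ)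
    (env := env) (s := (Cmd.fill 3 (.counts σ)).eval x (boundOf σ x) env s) (by omega)
  refine ⟨?_, w2.trans w1, o2.trans o1⟩
  rintro A k rfl
  refine ⟨fun i hi q hq e he d hd => ?_, twinned_fill (enough A k)⟩
  rw [f2 _ (by rw [flat_mod (by omega)]; omega)]
  exact counted_fill (enough A k) i hi q hq e he d hd

/-- The table covers the levels below `L`, which is enough by `unambiguous_iff_twin`. -/
theorem eval_ambiguous {σ : ℕ} {A : FinNFA σ} {k L : ℕ} {M : ℕ → ℕ} {env : List ℕ}
    (hL : Enough σ A k L) (hM : Twinned A L M) :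
    Expr.ambiguous.eval (A.encode k) L M env = 0 ↔ A.Unambiguous := by
  have hLn := hL.states
  rw [FinNFA.unambiguous_iff_twin hL.twins, ← not_iff_not, ← ne_eq, ← Nat.pos_iff_ne_zero]
  simp only [Expr.ambiguous, Expr.eval, Expr.eval_and, Expr.eval_cell, Expr.eval_final hL]
  simp only [List.getD_cons_zero, List.getD_cons_succ, Finset.sum_pos_iff, Finset.mem_range,
    pos_and_iff, pos_toNat_iff]
  have hfin : ∀ {q}, A.final q = true → q < A.n := by
    intro q hq
    unfold FinNFA.final at hq
    split at hq
    · assumption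
    · simp at hq
  push Not
  constructor
  · rintro ⟨t, ht, p, hp, q, hq, h1, h2, h3⟩
    exact ⟨t, ht, p, q, h1, h2, (hM t ht p (hfin h1) q (hfin h2) 1 (by omega)).1 h3⟩
  · rintro ⟨t, ht, p, q, h1, h2, h3⟩
    have hp := hfin h1
    have hq := hfin h2
    exact ⟨t, ht, p, by omega, q, by omega, h1, h2, (hM t ht p hp q hq 1 (by omega)).2 h3⟩

/-- The value of `Expr.total` is the number of witnesses. -/
theorem eval_total {σ : ℕ} {x : List Bool} {M : ℕ → ℕ} (hM : Prepared σ x (boundOf σ x) M)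
    (env : List ℕ) :
    (∃ (A : FinNFA σ) (k : ℕ), x = A.encode k ∧ A.Unambiguous ∧
      (Expr.total σ).eval x (boundOf σ x) M env = (A.wordList k A.start (σ * A.n)).length) ∨
    (Expr.total σ).eval x (boundOf σ x) M env = 0 ∧ witnesses (MemUFA σ) x = ∅ := by
  obtain ⟨h1, h2, h3⟩ := le_boundOf σ x
  by_cases hx : ∃ (A : FinNFA σ) (k : ℕ), x = A.encode k
  · obtain ⟨A, k, rfl⟩ := hx
    have hL := enough A k
    rw [← boundOf] at hL
    obtain ⟨hc, ht⟩ := hM A k rfl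
    have hamb := eval_ambiguous (env := env) hL ht
    simp only [Expr.total, Expr.eval, Expr.eval_cell, Expr.eval_violations_encode hL,
      Expr.eval_wordLength_encode hL, Expr.eval_initial hL, Expr.eval_numEdges hL, ifLt_eq]
    by_cases hA : A.Unambiguous
    · refine .inl ⟨A, k, rfl, hA, ?_⟩
      rw [hamb.2 hA]
      exact hc k le_rfl _ A.start.2 _ le_rfl 0 (by omega)
    · refine .inr ⟨?_, FinNFA.witnesses_encode_of_not hA⟩
      have : ¬ Expr.ambiguous.eval (A.encode k) (boundOf σ (A.encode k)) M env < 1 := by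
        rw [Nat.lt_one_iff, hamb]; exact hA
      rw [if_pos (by omega), if_neg this]
  · refine .inr ⟨?_, FinNFA.witnesses_of_not_encode fun A k h => hx ⟨A, k, h⟩⟩
    simp only [Expr.total, Expr.eval, ifLt_eq]
    rw [if_neg]
    rw [Nat.lt_one_iff, Expr.eval_violations h1 h2]
    intro hp
    obtain ⟨A, -, -, h⟩ := FinNFA.exists_encode hp
    exact hx ⟨A, _, h⟩

end RAM

/-! ## Counting -/

namespace RAM

/-- The tables number 3 and 4 occupy the remainders `3` and `4`, so cells with remainder `5` or more
are free for other use. -/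
theorem Prepared.congr {σ : ℕ} {x : List Bool} {L : ℕ} {M M' : ℕ → ℕ} (h : Prepared σ x L M)
    (hL : 10 ≤ L) (h' : ∀ p, p % L < 5 → M' p = M p) : Prepared σ x L M' := by
  intro A k hx
  obtain ⟨h1, h2⟩ := h A k hx
  refine ⟨fun i hi q hq e he d hd => ?_, fun t ht p hp q hq d hd => ?_⟩
  · rw [h' _ (by rw [flat_mod (by omega)]; omega)]
    exact h1 i hi q hq e he d hd
  · rw [h' _ (by rw [flat_mod (by omega)]; omega)]
    exact h2 t ht p hp q hq d hd

theorem ncard_witnesses {σ : ℕ} {A : FinNFA σ} {k : ℕ} (hA : A.Unambiguous) :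
    (witnesses (MemUFA σ) (A.encode k)).ncard = (A.wordList k A.start (σ * A.n)).length := by
  obtain ⟨ys, hys, h⟩ := A.exists_witness_list k
  obtain ⟨hnd, hmem⟩ := h hA
  have : witnesses (MemUFA σ) (A.encode k) = (ys.toFinset : Set (List (Fin σ))) := by
    ext y; simp [hmem]
  rw [this, Set.ncard_coe_finset, List.toFinset_card_of_nodup hnd, ← hys, List.length_map]

theorem eval_total_eq_ncard {σ : ℕ} {x : List Bool} {M : ℕ → ℕ}
    (hM : Prepared σ x (boundOf σ x) M) (env : List ℕ) :
    (Expr.total σ).eval x (boundOf σ x) M env = (witnesses (MemUFA σ) x).ncard := by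
  rcases eval_total hM env with ⟨A, k, rfl, hA, h⟩ | ⟨h, h'⟩
  · rw [h, ncard_witnesses hA]
  · rw [h, h', Set.ncard_empty]

theorem finite_witnesses {σ : ℕ} (x : List Bool) : (witnesses (MemUFA σ) x).Finite := by
  refine (List.finite_length_le (Fin σ) x.length).subset ?_
  rintro y ⟨A, k, rfl, -, hk, -⟩
  have := A.length_encode k
  simp only [Set.mem_ofPred_eq]
  omega

/-- There are at most `σ ^ k ≤ 2 ^ (σ * k)` words of length `k`. So `L` binary digits are enough. -/
theorem ncard_witnesses_lt {σ : ℕ} (x : List Bool) :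
    (witnesses (MemUFA σ) x).ncard < 2 ^ boundOf σ x := by
  by_cases hx : ∃ (A : FinNFA σ) (k : ℕ), x = A.encode k ∧ A.Unambiguous
  · obtain ⟨A, k, rfl, hA⟩ := hx
    have hL := enough A k
    rw [← boundOf] at hL
    have hcard : (witnesses (MemUFA σ) (A.encode k)).ncard ≤ σ ^ k := by
      have : witnesses (MemUFA σ) (A.encode k) ⊆
          Set.range (List.Vector.toList : List.Vector (Fin σ) k → List (Fin σ)) := by
        rw [FinNFA.witnesses_encode hA]
        rintro y ⟨hy, -⟩
        exact ⟨⟨y, hy⟩, rfl⟩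
      refine (Set.ncard_le_ncard this (Set.toFinite _)).trans ?_
      rw [← Set.image_univ]
      refine (Set.ncard_image_le (Set.toFinite _)).trans ?_
      rw [Set.ncard_univ, Nat.card_eq_fintype_card, card_vector, Fintype.card_fin]
    calc _ ≤ σ ^ k := hcard
      _ ≤ (2 ^ σ) ^ k := Nat.pow_le_pow_left Nat.lt_two_pow_self.le k
      _ = 2 ^ (σ * k) := (pow_mul 2 σ k).symm
      _ < _ := Nat.pow_lt_pow_right (by omega) hL.bits
  · have : witnesses (MemUFA σ) x = ∅ := by
      ext y
      simp only [Set.mem_empty_iff_false, iff_false]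
      rintro ⟨A, k, h, hA, -⟩
      exact hx ⟨A, k, h, hA⟩
    rw [this, Set.ncard_empty]
    positivity

/-- The program that runs a command with the bound `boundOf σ x`. -/
def program (σ : ℕ) (S : Cmd) : Stm := setBound (σ + 2) (σ + 10) ;; S.code [] 1

noncomputable def boundPoly (σ : ℕ) : Polynomial ℕ := .C (σ + 10) + .C (σ + 2) * .X

theorem eval_boundPoly (σ : ℕ) (x : List Bool) : (boundPoly σ).eval x.length = boundOf σ x := by
  simp [boundPoly, boundOf]

noncomputable def programCost (σ : ℕ) (S : Cmd) : Polynomial ℕ :=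
  5 * .X + 8 + S.cost.comp (boundPoly σ)

def Store.init : Store := ⟨fun _ => 0, [], []⟩

theorem reach_program (σ : ℕ) (S : Cmd) (x : List Bool) :
    Reach x (program σ S) .init ((programCost σ S).eval x.length) fun s =>
      s.store = S.eval x (boundOf σ x) [] .init ∧ s.reg 0 = boundOf σ x := by
  refine ((reach_setBound x (σ + 2) (σ + 10) .init).seq fun s ⟨h0, hst, _⟩ =>
    (S.reach_code x [] 1 s (by omega) (by simp) h0).mono le_rfl fun s' h => ?_).mono
      (by simp [programCost, eval_boundPoly, boundOf]) fun _ h => h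
  refine ⟨?_, (h.low 0 (by omega)).trans h0⟩
  rw [h.store, hst]
  rfl

theorem log_eq_nil_of_store {s : St} (h : s.store.outs = []) : s.log = [] :=
  List.map_eq_nil_iff.1 h

/-! ### Conversion of the count to binary -/

namespace Expr

/-- The power of two with exponent `var 3`. -/
def powers : Expr :=
  let e := cell 5 (pred (var 3)) (const 0) (const 0) (const 0)
  ite (var 3) (const 1) (const 1) (add e e)

/-- The number formed by the bits that were already considered. -/
def prefixVal : Expr := cell 6 (const 0) (const 0) (const 0) (const 0)

/-- The power of two for the bit number `var 0`, counted from the most significant one. -/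
def bitWeight : Expr :=
  cell 5 (sub bound (add (var 0) (const 1))) (const 0) (const 0) (const 0)

/-- The bit number `var 0`. -/
def bit (σ : ℕ) : Expr := ite (total σ) (add prefixVal bitWeight) (const 0) (const 1)

end Expr

open RAM.Expr in
/-- Output the number of witnesses in binary. -/
def countCmd (σ : ℕ) : Cmd :=
  .seq (prepare σ) <| .seq (.fill 5 powers) <|
  .seq (.store (.flat (const 0) (const 0) (const 0) (const 0) 6) (const 0)) <|
  .seq (.loop <|
    .seq (.guarded (const 0) (add (add prefixVal (bit σ)) (eq (add (var 0) (const 1)) bound))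
      (.print (bit σ)))
    (.store (.flat (const 0) (const 0) (const 0) (const 0) 6)
      (add prefixVal (ite (total σ) (add prefixVal bitWeight) (const 0) bitWeight)))) .emit

theorem powers_fill {x : List Bool} {L : ℕ} (hL : 10 ≤ L) {env : List ℕ} {s : Store} :
    ∀ t < L, ((Cmd.fill 5 .powers).eval x L env s).mem (flat L t 0 0 0 5) = 2 ^ t := by
  have key := (Cmd.eval_fill (x := x) (L := L) (j := 5) (e := .powers) (env := env) (s := s)
    (by omega) (fun t _ _ _ v => v = 2 ^ t) ?_).1
  · exact fun t ht => key t ht 0 (by omega) 0 (by omega) 0 (by omega)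
  · intro t ht b hb c hc d hd M _ ih
    have hp : (Expr.pred (.var 3)).eval x L M (d :: c :: b :: t :: env) = t - 1 :=
      Expr.eval_pred ht.le
    simp only [Expr.powers, Expr.eval, Expr.eval_cell, hp]
    simp only [List.getD_cons_zero, List.getD_cons_succ, ifLt_eq]
    cases t with
    | zero => simp
    | succ t =>
      have := ih t (by omega) 0 (by omega) 0 (by omega) 0 (by omega)
        (idx_lt_of_fst (by omega) (by omega) (by omega) (by omega))
      rw [if_neg (by omega), Nat.add_sub_cancel, this, pow_succ]
      ring

/-- Once the bits above position `m` are known, the bit at `m` is found by comparing `N` with the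
known prefix plus `2 ^ m`. No division of `N` is needed. -/
theorem div_two_pow (N m : ℕ) : N / 2 ^ m = 2 * (N / 2 ^ (m + 1)) +
    if N < N / 2 ^ (m + 1) * 2 ^ (m + 1) + 2 ^ m then 0 else 1 := by
  have h1 : N / 2 ^ (m + 1) = N / 2 ^ m / 2 := by rw [pow_succ, Nat.div_div_eq_div_mul]
  rw [h1]
  set v := N / 2 ^ m with hv
  have h2 : v / 2 * 2 ^ (m + 1) + 2 ^ m = (2 * (v / 2) + 1) * 2 ^ m := by ring
  have h3 : N < (2 * (v / 2) + 1) * 2 ^ m ↔ v < 2 * (v / 2) + 1 :=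
    (Nat.div_lt_iff_lt_mul (by positivity)).symm
  rw [h2]
  simp only [h3]
  split_ifs <;> omega

/-- Invariant before round `j`: the accumulator holds `N` with its last `L - j` bits cleared, and
the digits of `N / 2 ^ (L - j)` have been printed. Leading zeros are suppressed, but the last bit is
printed in any case; this gives `[0]` for `N = 0`. -/
theorem eval_countCmd (σ : ℕ) (x : List Bool) :
    ((countCmd σ).eval x (boundOf σ x) [] .init).word = [] ∧
    ((countCmd σ).eval x (boundOf σ x) [] .init).outs =
      [binaryRepr (witnesses (MemUFA σ) x).ncard] := by
  have hNlt := ncard_witnesses_lt (σ := σ) x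
  have htotal : ∀ {M}, Prepared σ x (boundOf σ x) M → ∀ env,
    (Expr.total σ).eval x (boundOf σ x) M env = (witnesses (MemUFA σ) x).ncard :=
      fun hM env => eval_total_eq_ncard hM env
  have hL := (le_boundOf σ x).2.2
  obtain ⟨p1, w1, o1⟩ := prepared_prepare (σ := σ) (x := x) (s := .init) (env := [])
  simp only [countCmd, Cmd.eval, Expr.eval_flat]
  generalize (witnesses (MemUFA σ) x).ncard = N at *
  set s1 := (prepare σ).eval x (boundOf σ x) [] .init
  obtain ⟨f2, w2, o2⟩ := Cmd.eval_fill_frame (x := x) (j := 5) (e := .powers)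
    (env := []) (s := s1) (by omega : 5 < boundOf σ x)
  have hpow := powers_fill (x := x) (env := []) (s := s1) hL
  set s2 := (Cmd.fill 5 .powers).eval x (boundOf σ x) [] s1
  have p2 : Prepared σ x (boundOf σ x) s2.mem := p1.congr hL fun p hp => f2 p (by omega)
  generalize boundOf σ x = L at *
  simp only [Expr.eval]
  have hacc : ∀ t, flat L t 0 0 0 5 ≠ flat L 0 0 0 0 6 := by
    intro t h
    have := congrArg (· % L) h
    simp only [flat_mod (show 5 < L by omega), flat_mod (show 6 < L by omega)] at this
    omega
  set acc := flat L 0 0 0 0 6 with hacc_def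
  have hacc' : acc % L = 6 := flat_mod (by omega)
  have key := forLoop_induction (n := L)
    (s := (⟨Function.update s2.mem acc 0, s2.word, s2.outs⟩ : Store))
    (f := fun i s => Cmd.eval x L (.seq (.guarded (.const 0) (.add (.add .prefixVal (.bit σ))
      (.eq (.add (.var 0) (.const 1)) .bound)) (.print (.bit σ)))
      (.store (.flat (.const 0) (.const 0) (.const 0) (.const 0) 6)
        (.add .prefixVal (.ite (.total σ) (.add .prefixVal .bitWeight) (.const 0) .bitWeight))))
      [i] s)
    (fun j s => Prepared σ x L s.mem ∧ (∀ t < L, s.mem (flat L t 0 0 0 5) = 2 ^ t) ∧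
      s.mem acc = N / 2 ^ (L - j) * 2 ^ (L - j) ∧ s.outs = [] ∧
      s.word = (Nat.digits 2 (N / 2 ^ (L - j))).reverse ++ if j = L ∧ N = 0 then [0] else []) ?_ ?_
  · obtain ⟨-, -, -, h4, h5⟩ := key
    simp only [Cmd.eval, Expr.eval, Expr.eval_flat] at h4 h5
    refine ⟨trivial, ?_⟩
    rw [h4, h5, binaryRepr]
    by_cases hN : N = 0 <;> simp [hN]
  -- At the start nothing has been printed, in accordance with `N / 2 ^ L = 0`.
  · refine ⟨p2.congr hL fun p hp => ?_, fun t ht => ?_, ?_, ?_, ?_⟩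
    · refine Function.update_of_ne ?_ _ _
      rintro rfl
      omega
    · rw [← hpow t ht]
      exact Function.update_of_ne (hacc t) _ _
    · simp [Nat.div_eq_of_lt hNlt]
    · exact o2.trans o1
    · simp [Nat.div_eq_of_lt hNlt, w2, w1, Store.init]
      omega
  · rintro j hj s ⟨h1, h2, h3, h4, h5⟩
    obtain ⟨m, hm⟩ : ∃ m, L = m + 1 + j := ⟨L - 1 - j, by omega⟩
    have hmj : L - j = m + 1 := by omega
    have hmj' : L - (j + 1) = m := by omega
    have hbw : Expr.bitWeight.eval x L s.mem [j] = 2 ^ m := by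
      have : (Expr.sub .bound (.add (.var 0) (.const 1))).eval x L s.mem [j] = L - (j + 1) :=
        Expr.eval_sub (by simp [Expr.eval])
      rw [Expr.bitWeight, Expr.eval_cell, this, hmj']
      exact h2 m (by omega)
    have hpv : Expr.prefixVal.eval x L s.mem [j] = N / 2 ^ (m + 1) * 2 ^ (m + 1) := by
      rw [Expr.prefixVal, Expr.eval_cell]
      change s.mem acc = _
      simpa only [hmj] using h3
    have hdiv := div_two_pow N m
    have hbit : (Expr.bit σ).eval x L s.mem [j] =
        if N < N / 2 ^ (m + 1) * 2 ^ (m + 1) + 2 ^ m then 0 else 1 := by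
      simp only [Expr.bit, Expr.eval, htotal h1, hbw, hpv, ifLt_eq]
    rw [hmj] at h5
    rw [hmj']
    have hmem : ∀ w o, (Cmd.eval x L
        (.store (.flat (.const 0) (.const 0) (.const 0) (.const 0) 6)
        (.add .prefixVal (.ite (.total σ) (.add .prefixVal .bitWeight) (.const 0) .bitWeight)))
        [j] ⟨s.mem, w, o⟩) = ⟨Function.update s.mem acc (N / 2 ^ m * 2 ^ m), w, o⟩ := by
      intro w o
      simp only [Cmd.eval, Expr.eval_flat, Expr.eval, hpv, hbw, htotal h1, ifLt_eq]
      congr 2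
      rw [hdiv]
      split_ifs <;> ring
    set b := if N < N / 2 ^ (m + 1) * 2 ^ (m + 1) + 2 ^ m then 0 else 1 with hb
    have hword : Cmd.eval x L (.guarded (.const 0) (.add (.add .prefixVal (.bit σ))
      (.eq (.add (.var 0) (.const 1)) .bound)) (.print (.bit σ))) [j] s =
        ⟨s.mem, (Nat.digits 2 (N / 2 ^ m)).reverse ++ if j + 1 = L ∧ N = 0 then [0] else [],
          s.outs⟩ := by
      simp only [Cmd.eval, Expr.eval, Expr.eval_eq, hpv, hbit, List.getD_cons_zero]
      rw [h5, if_neg (by omega), List.append_nil, ifLt_eq, ifEq_eq]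
      have hble : b ≤ 1 := by rw [hb]; split_ifs <;> omega
      -- If `N / 2 ^ m = 0`, the current bit is a leading zero, printed only in the last round.
      rcases Nat.eq_zero_or_pos (N / 2 ^ m) with hz | hz
      · have hz1 : N / 2 ^ (m + 1) = 0 := by omega
        have hb0 : b = 0 := by omega
        have hN : j + 1 = L → N = 0 := by
          intro h
          have : m = 0 := by omega
          simpa [this] using hz
        by_cases hjL : j + 1 = L
        · simp [hb0, hjL, hN hjL]
        · simp [hz1, hz, hb0, hjL]
          have hw : s.word = [] := by rw [h5, hz1]; simp; omega
          exact congrArg (fun w => (⟨s.mem, w, s.outs⟩ : Store)) hw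
      · have hdig : Nat.digits 2 (N / 2 ^ m) = b :: Nat.digits 2 (N / 2 ^ (m + 1)) := by
          rw [Nat.digits_def' (by omega) hz]
          congr 2 <;> omega
        have hpos : 0 < N / 2 ^ (m + 1) * 2 ^ (m + 1) + b := by
          rcases Nat.eq_zero_or_pos b with hb0 | hb0
          · have : 0 < N / 2 ^ (m + 1) := by omega
            positivity
          · omega
        have hN : N ≠ 0 := by
          rintro rfl
          simp at hz
        rw [if_pos (by omega), hdig]
        simp [hN]
    rw [Cmd.eval, hword, hmem]
    refine ⟨h1.congr hL fun p hp => ?_, fun t ht => ?_, by simp, h4, rfl⟩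
    · refine Function.update_of_ne ?_ _ _
      rintro rfl
      omega
    · rw [← h2 t ht]
      exact Function.update_of_ne (hacc t) _ _

theorem countPolyTime_memUFA (σ : ℕ) : CountPolyTime (MemUFA σ) := by
  refine ⟨(program σ (countCmd σ)).code 0, programCost σ (countCmd σ), fun x =>
    ⟨finite_witnesses x, ?_⟩⟩
  obtain ⟨s, hs, hB, hst, -⟩ := reach_program σ (countCmd σ) x
  have hrun := hs.run_eq hB
  obtain ⟨hw, ho⟩ := eval_countCmd σ x
  rw [← hst] at hw ho
  rw [show Config.init = St.init.at 0 from rfl, hrun]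
  exact ⟨⟨by simp [St.at], hw⟩, ho⟩

end RAM

/-! ## Uniform generation -/

namespace FinNFA

variable {σ : ℕ} (A : FinNFA σ)

theorem length_wordList_mono {i q e e' : ℕ} (h : e ≤ e') :
    (A.wordList (i + 1) q e).length ≤ (A.wordList (i + 1) q e').length := by
  induction e' with
  | zero => rw [Nat.le_zero.1 h]
  | succ e' ih =>
    rcases Nat.lt_or_ge e' e with h' | h'
    · rw [show e = e' + 1 by omega]
    · refine (ih h').trans ?_
      rw [wordList, List.length_append]
      omega

/-- In the reversed list, the words whose runs start with the same edge are consecutive, and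
the edges are in increasing order. -/
theorem exists_edge_of_getElem? {i q e t : ℕ} {w : List ℕ}
    (h : (A.wordList (i + 1) q e).reverse[t]? = some w) :
    ∃ e' < e, (A.wordList (i + 1) q e').length ≤ t ∧ t < (A.wordList (i + 1) q (e' + 1)).length ∧
      ∃ w', w = e' / A.n :: w' ∧ (A.wordList i (e' % A.n) (σ * A.n)).reverse[
        t - (A.wordList (i + 1) q e').length]? = some w' := by
  induction e with
  | zero => simp [wordList] at h
  | succ e ih =>
    rw [wordList, List.reverse_append, List.getElem?_append] at h
    split_ifs at h with h1 h2
    · obtain ⟨e', he', h'⟩ := ih h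
      exact ⟨e', by omega, h'⟩
    · rw [List.length_reverse, not_lt] at h1
      rw [← List.map_reverse, List.getElem?_map, Option.map_eq_some_iff] at h
      obtain ⟨w', hw', rfl⟩ := h
      rw [List.length_reverse] at hw'
      obtain ⟨hlt, -⟩ := List.getElem?_eq_some_iff.1 hw'
      refine ⟨e, by omega, h1, ?_, w', rfl, hw'⟩
      rw [List.length_reverse] at hlt
      rw [wordList, List.length_append, if_pos h2, List.length_map]
      omega
    · simp at h

end FinNFA

namespace RAM

namespace Expr

/-- The single cell of the table number `j`. -/
def single (j : ℕ) : Expr := flat (const 0) (const 0) (const 0) (const 0) j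

/-- The number of letters that are still to be generated. -/
def rest (σ : ℕ) (j : Expr) : Expr := sub (wordLength σ) j

/-- The number of the first word with a run that starts with the edge `e`, at the position `j`. -/
def offset (σ : ℕ) (j e : Expr) : Expr :=
  add (load (single 6)) (cell 3 (rest σ j) (load (single 5)) e (const 0))

/-- The first edge of a run on the word number `var 1`, at the position `var 0`. -/
def chosenEdge (σ : ℕ) : Expr :=
  sum (ite (var 2) (offset σ (var 1) (var 0)) (const 0)
    (ite (var 0) (numEdges σ)
      (ite (var 2) (offset σ (var 1) (add (var 0) (const 1))) (var 0) (const 0)) (const 0)))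

end Expr

open RAM.Expr in
/-- Print the letter at the position `var 0` of the word number `var 1`, unless the position is
beyond its end. The memory cells contain the current state, the number of the first word that
starts with the letters printed so far, and an edge. -/
def genStep (σ : ℕ) : Cmd :=
  .guarded (var 0) (wordLength σ) <|
    .seq (.store (single 7) (chosenEdge σ)) <|
    .seq (.print (letter (load (single 7)))) <|
    .seq (.store (single 6) (offset σ (var 0) (load (single 7))))
    (.store (single 5) (target (load (single 7))))

open RAM.Expr in
/-- Output the word number `var 0`. -/
def genCmd (σ : ℕ) : Cmd :=
  .guarded (const 0) (total σ) <|
    .seq (.store (single 5) initial) <| .seq (.store (single 6) (const 0)) <|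
    .seq (.loop (genStep σ)) .emit

theorem eval_single {x : List Bool} {L : ℕ} {M : ℕ → ℕ} {env : List ℕ} (j : ℕ) :
    (Expr.single j).eval x L M env = flat L 0 0 0 0 j :=
  Expr.eval_flat

/-- The invariant of the generation of the word `w`, which has number `r`. -/
structure Generating {σ : ℕ} (A : FinNFA σ) (k L r : ℕ) (w : List ℕ) (j : ℕ) (s : Store) :
    Prop where
  counted : Counted A k L s.mem
  state : s.mem (flat L 0 0 0 0 5) < A.n
  le : s.mem (flat L 0 0 0 0 6) ≤ r
  outs : s.outs = []
  word : ∃ w', s.word ++ w' = w ∧ (A.wordList (k - j) (s.mem (flat L 0 0 0 0 5))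
    (σ * A.n)).reverse[r - s.mem (flat L 0 0 0 0 6)]? = some w'

section

variable {σ : ℕ} {A : FinNFA σ} {k L r : ℕ} {w : List ℕ}

theorem Counted.congr {M M' : ℕ → ℕ} (h : Counted A k L M) (hL : 10 ≤ L)
    (h' : ∀ p, p % L < 5 → M' p = M p) : Counted A k L M' := by
  intro i hi q hq e he d hd
  rw [h' _ (by rw [flat_mod (by omega)]; omega)]
  exact h i hi q hq e he d hd

theorem Counted.eval_offset (hL : Enough σ A k L) {M : ℕ → ℕ} (hM : Counted A k L M)
    (hq : M (flat L 0 0 0 0 5) < A.n) {j e : Expr} {env : List ℕ}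
    (he : e.eval (A.encode k) L M env ≤ σ * A.n) :
    (Expr.offset σ j e).eval (A.encode k) L M env = M (flat L 0 0 0 0 6) +
      (A.wordList (k - j.eval (A.encode k) L M env) (M (flat L 0 0 0 0 5))
        (e.eval (A.encode k) L M env)).length := by
  have hk := hL.words
  have hLt := hL.tables
  have hr : (Expr.rest σ j).eval (A.encode k) L M env = k - j.eval (A.encode k) L M env := by
    rw [Expr.rest, Expr.eval_sub (by rw [Expr.eval_wordLength_encode hL]; omega),
      Expr.eval_wordLength_encode hL]
  simp only [Expr.offset, Expr.eval, Expr.eval_cell, eval_single, hr]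
  rw [hM _ (by omega) _ hq _ he 0 (by omega)]

/-- The lengths of the lists grow with the edge, so they cut the range of ranks into consecutive
blocks. Only the edge whose block contains the rank contributes to the sum, and it contributes
itself. -/
theorem Counted.eval_chosenEdge (hL : Enough σ A k L) {M : ℕ → ℕ} (hM : Counted A k L M)
    (hq : M (flat L 0 0 0 0 5) < A.n) {i j e : ℕ} (hj : k - j = i + 1) (he : e < σ * A.n)
    (hr : M (flat L 0 0 0 0 6) ≤ r)
    (h1 : (A.wordList (i + 1) (M (flat L 0 0 0 0 5)) e).length ≤ r - M (flat L 0 0 0 0 6))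
    (h2 : r - M (flat L 0 0 0 0 6) < (A.wordList (i + 1) (M (flat L 0 0 0 0 5)) (e + 1)).length) :
    (Expr.chosenEdge σ).eval (A.encode k) L M [j, r] = e := by
  have hLe := hL.edges
  simp only [Expr.chosenEdge, Expr.eval, Expr.eval_numEdges hL]
  simp only [List.getD_cons_zero, List.getD_cons_succ, ifLt_eq]
  have hval : ∀ {e'}, e' < σ * A.n →
      (Expr.offset σ (.var 1) (.var 0)).eval (A.encode k) L M [e', j, r] = M (flat L 0 0 0 0 6) +
        (A.wordList (i + 1) (M (flat L 0 0 0 0 5)) e').length ∧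
      (Expr.offset σ (.var 1) (.add (.var 0) (.const 1))).eval (A.encode k) L M [e', j, r] =
        M (flat L 0 0 0 0 6) + (A.wordList (i + 1) (M (flat L 0 0 0 0 5)) (e' + 1)).length := by
    intro e' he'
    rw [← hj]
    exact ⟨hM.eval_offset hL hq (j := .var 1) (e := .var 0) (env := [e', j, r]) he'.le,
      hM.eval_offset hL hq (j := .var 1) (e := .add (.var 0) (.const 1)) (env := [e', j, r]) he'⟩
  rw [Finset.sum_eq_single e]
  · rw [(hval he).1, (hval he).2, if_neg (by omega), if_pos he, if_pos (by omega)]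
  · intro e' _ hne
    by_cases he' : e' < σ * A.n
    · rw [(hval he').1, (hval he').2, if_pos he']
      rcases Nat.lt_or_gt_of_ne hne with h | h
      · have := A.length_wordList_mono (i := i) (q := M (flat L 0 0 0 0 5)) (show e' + 1 ≤ e by omega)
        have := A.length_wordList_mono (i := i) (q := M (flat L 0 0 0 0 5)) (show e' ≤ e by omega)
        rw [if_neg (by omega), if_neg (by omega)]
      · have := A.length_wordList_mono (i := i) (q := M (flat L 0 0 0 0 5)) (show e + 1 ≤ e' by omega)
        rw [if_pos (by omega)]
    · rw [if_neg he', ite_self]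
  · intro h
    exact absurd (Finset.mem_range.2 (by omega)) h

theorem single_ne (hL : 10 ≤ L) {i j : ℕ} (hi : i < 10) (hj : j < 10) (h : i ≠ j) :
    flat L 0 0 0 0 i ≠ flat L 0 0 0 0 j := by
  intro h'
  have := congrArg (· % L) h'
  simp only [flat_mod (show i < L by omega), flat_mod (show j < L by omega)] at this
  exact h this

/-- Cell 6 grows by the number of words that start with smaller edges, so its difference to `r`
becomes the rank of the remaining word among those from the new state. The list is reversed because
`wordList` begins with the largest edge, while the table counts the edges below a given one. -/
theorem Generating.step (hL : Enough σ A k L) {j : ℕ} {s : Store}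
    (h : Generating A k L r w j s) :
    Generating A k L r w (j + 1) ((genStep σ).eval (A.encode k) L [j, r] s) := by
  have hLe := hL.edges
  have hn : 0 < A.n := A.start.pos
  simp only [genStep, Cmd.eval, Expr.eval_wordLength_encode hL, eval_single]
  simp only [Expr.eval, List.getD_cons_zero, ifLt_eq]
  obtain ⟨w', hw', hget⟩ := h.word
  by_cases hjk : j < k
  · obtain ⟨i, hi⟩ : ∃ i, k - j = i + 1 := ⟨k - j - 1, by omega⟩
    rw [hi] at hget
    obtain ⟨e, he, h1, h2, w'', rfl, h3⟩ := A.exists_edge_of_getElem? hget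
    rw [if_pos hjk, h.counted.eval_chosenEdge hL h.state hi he h.le h1 h2]
    set q := s.mem (flat L 0 0 0 0 5) with hq
    set y := s.mem (flat L 0 0 0 0 6) with hy
    have h75 := single_ne hL.tables (i := 7) (j := 5) (by omega) (by omega) (by omega)
    have h76 := single_ne hL.tables (i := 7) (j := 6) (by omega) (by omega) (by omega)
    have h65 := single_ne hL.tables (i := 6) (j := 5) (by omega) (by omega) (by omega)
    set M₁ := Function.update s.mem (flat L 0 0 0 0 7) e with hM₁
    have hZ : (Expr.load (.single 7)).eval (A.encode k) L M₁ [j, r] = e := by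
      rw [Expr.eval, eval_single, hM₁, Function.update_self]
    have hmod : ∀ {M : ℕ → ℕ} {t v : ℕ}, t = 5 ∨ t = 6 ∨ t = 7 → ∀ p, p % L < 5 →
        Function.update M (flat L 0 0 0 0 t) v p = M p := by
      intro M t v ht p hp
      refine Function.update_of_ne ?_ _ _
      rintro rfl
      have := hL.tables
      rw [flat_mod (by omega)] at hp
      omega
    have hM₁c : Counted A k L M₁ := h.counted.congr hL.tables (hmod (by omega))
    have hM₁5 : M₁ (flat L 0 0 0 0 5) = q := Function.update_of_ne h75.symm _ _
    have hM₁6 : M₁ (flat L 0 0 0 0 6) = y := Function.update_of_ne h76.symm _ _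
    have hoff : (Expr.offset σ (.var 0) (.load (.single 7))).eval (A.encode k) L M₁ [j, r] =
        y + (A.wordList (i + 1) q e).length := by
      rw [hM₁c.eval_offset hL (by rw [hM₁5]; exact h.state) (by rw [hZ]; exact he.le), hZ, hM₁5,
        hM₁6, ← hi]
      rfl
    rw [hoff]
    set M₂ := Function.update M₁ (flat L 0 0 0 0 6) (y + (A.wordList (i + 1) q e).length) with hM₂
    have hZ₂ : (Expr.load (.single 7)).eval (A.encode k) L M₂ [j, r] = e := by
      rw [Expr.eval, eval_single, hM₂, Function.update_of_ne h76, hM₁, Function.update_self]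
    rw [Expr.eval_letter hL (by rw [hZ]; omega), Expr.eval_target hL (by rw [hZ₂]; omega), hZ, hZ₂]
    have hM₂6 : M₂ (flat L 0 0 0 0 6) = y + (A.wordList (i + 1) q e).length :=
      Function.update_self _ _ _
    refine ⟨(hM₁c.congr hL.tables (hmod (by omega))).congr hL.tables (hmod (by omega)), ?_, ?_,
      h.outs, w'', ?_, ?_⟩
    · simpa using Nat.mod_lt e hn
    · simp only [Function.update_of_ne h65, hM₂6]
      have := h.le
      omega
    · simpa using hw'
    · simp only [Function.update_self, Function.update_of_ne h65, hM₂6]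
      rw [show k - (j + 1) = i by omega, ← Nat.sub_sub]
      exact h3
  -- The loop has `L` rounds, more than there are letters; the surplus rounds do nothing.
  · rw [if_neg hjk]
    refine ⟨h.counted, h.state, h.le, h.outs, w', hw', ?_⟩
    rwa [show k - (j + 1) = k - j by omega]

/-- The generation of the word number `r`, in the reversed list of all accepted words. -/
theorem eval_genCmd (hL : Enough σ A k L) {s : Store} (hM : Counted A k L s.mem)
    (hw : s.word = []) (ho : s.outs = [])
    (ht : 0 < (Expr.total σ).eval (A.encode k) L s.mem [r])
    (hr : (A.wordList k A.start (σ * A.n)).reverse[r]? = some w) :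
    ((genCmd σ).eval (A.encode k) L [r] s).word = [] ∧
      ((genCmd σ).eval (A.encode k) L [r] s).outs = [w] := by
  simp only [genCmd, Cmd.eval, eval_single, Expr.eval_initial hL]
  simp only [Expr.eval, ifLt_eq, if_pos ht]
  have h56 := single_ne hL.tables (i := 5) (j := 6) (by omega) (by omega) (by omega)
  have key := forLoop_induction (n := L) (Generating A k L r w)
    (f := fun i => (genStep σ).eval (A.encode k) L [i, r])
    (s := ⟨Function.update (Function.update s.mem (flat L 0 0 0 0 5) A.start) (flat L 0 0 0 0 6) 0,
      s.word, s.outs⟩) ?_ fun j _ s hs => hs.step hL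
  · refine ⟨trivial, ?_⟩
    obtain ⟨w', h1, h2⟩ := key.word
    have hk := hL.words
    rw [Nat.sub_eq_zero_of_le hk.le, FinNFA.wordList] at h2
    have : w' = [] := by
      split_ifs at h2
      · rw [List.reverse_singleton, List.getElem?_singleton] at h2
        split_ifs at h2
        exact (Option.some.inj h2).symm
      · simp at h2
    rw [this, List.append_nil] at h1
    rw [key.outs, h1, List.nil_append]
  · refine ⟨hM.congr hL.tables fun p hp => ?_, ?_, ?_, ho, w, ?_, ?_⟩
    · have := hL.tables
      refine (Function.update_of_ne ?_ _ _).trans (Function.update_of_ne ?_ _ _) <;>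
      · rintro rfl
        rw [flat_mod (by omega)] at hp
        omega
    · simp [h56]
    · simp
    · simp [hw]
    · simpa [h56] using hr

end

/-! ### The randomized program and its output distribution -/

theorem map_uniformOfFinset_range_apply {α : Type*} {N : ℕ} (hN : (Finset.range N).Nonempty)
    (f : ℕ → α) {r : ℕ} (hr : r < N) (h : ∀ r' < N, f r' = f r → r' = r) :
    ((PMF.uniformOfFinset (Finset.range N) hN).map f) (f r) = (N : ENNReal)⁻¹ := by
  rw [PMF.map_apply, tsum_eq_single r]
  · rw [if_pos rfl, PMF.uniformOfFinset_apply_of_mem _ (Finset.mem_range.2 hr), Finset.card_range]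
  · intro r' hne
    by_cases hr' : r' < N
    · exact if_neg fun h' => hne (h r' hr' h'.symm)
    · rw [PMF.uniformOfFinset_apply_of_notMem _ (by simpa using hr'), ite_self]

def genProgram (σ : ℕ) : RandProgram :=
  drawOnce (program σ (prepare σ) ;; (Expr.total σ).code [] 1) 1 1 ((genCmd σ).code [1] 2)

noncomputable def genCost (σ : ℕ) : Polynomial ℕ :=
  programCost σ (prepare σ) + (Expr.total σ).cost.comp (boundPoly σ) + 1 +
    (genCmd σ).cost.comp (boundPoly σ)

/-- The number drawn by the program determines what happens. -/
theorem randRun_genProgram (σ : ℕ) (x : List Bool) :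
    ∃ (M : ℕ → ℕ) (g : ℕ → St), Prepared σ x (boundOf σ x) M ∧
      (∀ r, (g r).store = (genCmd σ).eval x (boundOf σ x) [r] ⟨M, [], []⟩) ∧
      randRun (genProgram σ) x .init ((genCost σ).eval x.length) =
        (PMF.uniformOfFinset (Finset.range (max 1 (witnesses (MemUFA σ) x).ncard))
          ⟨0, by simp⟩).map fun r => (g r).at (genProgram σ).length := by
  obtain ⟨p, pw, po⟩ := prepared_prepare (σ := σ) (x := x) (s := .init) (env := [])
  obtain ⟨s', hs', hB', hreg, hreg0, hst⟩ := (reach_program σ (prepare σ) x).seq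
    (B' := ((Expr.total σ).cost.comp (boundPoly σ)).eval x.length) (T := (Expr.total σ).code [] 1)
    (Q' := fun s => s.reg 1 = (witnesses (MemUFA σ) x).ncard ∧ s.reg 0 = boundOf σ x ∧
      s.store = (prepare σ).eval x (boundOf σ x) [] .init) fun s ⟨h1, h0⟩ => by
    refine ((Expr.total σ).reach_code x [] 1 s (by omega) (by simp) h0).mono
      (by simp [eval_boundPoly]) fun s' h => ⟨?_, (h.low 0 (by omega)).trans h0, ?_⟩
    · rw [h.reg]
      refine eval_total_eq_ncard ?_ _
      rw [← h1] at p
      exact p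
    · rw [← h1]
      simp only [St.store, h.mem, h.word, h.log]
  have hgen : ∀ r, Reach x ((genCmd σ).code [1] 2) (s'.set 1 r)
      (((genCmd σ).cost.comp (boundPoly σ)).eval x.length)
      fun s => s.store = (genCmd σ).eval x (boundOf σ x) [r] s'.store := fun r => by
    refine ((genCmd σ).reach_code x [1] 2 (s'.set 1 r) (by omega) (by simp)
      (L := boundOf σ x) (by simpa using hreg0)).mono (by simp [eval_boundPoly]) fun s h => ?_
    rw [h.store]
    simp [St.store]
  choose g hg hBg hgst using hgen
  refine ⟨s'.mem, g, ?_, fun r => ?_, ?_⟩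
  · have : s'.mem = ((prepare σ).eval x (boundOf σ x) [] .init).mem := by rw [← hst]; rfl
    rwa [this]
  · rw [hgst]
    congr 1
    have h1 : s'.store.word = [] := by rw [hst, pw]; rfl
    have h2 : s'.store.outs = [] := by rw [hst, po]; rfl
    rw [← h1, ← h2]
    rfl
  · have := randRun_drawOnce (d := 1) (a := 1) hs' (g := g) (fun r _ => hg r)
      (B := (genCost σ).eval x.length) fun r _ => by
        have := hBg r
        simp only [St.set_clock] at this
        simp only [genCost, Polynomial.eval_add, Polynomial.eval_one]
        omega
    have hlen : (genProgram σ).length = (program σ (prepare σ) ;; (Expr.total σ).code [] 1).size +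
        1 + ((genCmd σ).code [1] 2).size := by
      simp [genProgram, drawOnce]
      omega
    simp only [hlen]
    refine Eq.trans this ?_
    simp only [hreg]

theorem genPolyTime_memUFA (σ : ℕ) : GenPolyTime (MemUFA σ) := by
  refine ⟨genProgram σ, genCost σ, fun x => ?_⟩
  obtain ⟨M, g, hM, hg, hD⟩ := randRun_genProgram σ x
  intro D
  have hout : D.map Config.outputs = (PMF.uniformOfFinset
      (Finset.range (max 1 (witnesses (MemUFA σ) x).ncard)) ⟨0, by simp⟩).map
        fun r => (g r).store.outs := by
    rw [show D = _ from hD, PMF.map_comp]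
    rfl
  have hhalt : (∀ r < max 1 (witnesses (MemUFA σ) x).ncard, (g r).store.word = []) →
      ∀ f ∈ D.support, Halted (genProgram σ) f := by
    intro h f hf
    rw [show D = _ from hD, PMF.support_map] at hf
    obtain ⟨r, hr, rfl⟩ := hf
    exact ⟨le_rfl, h r (Finset.mem_range.1 ((PMF.mem_support_uniformOfFinset_iff _ _).1 hr))⟩
  refine ⟨finite_witnesses x, ?_⟩
  have htot := fun env => eval_total_eq_ncard hM env
  rcases Nat.eq_zero_or_pos (witnesses (MemUFA σ) x).ncard with h0 | hpos
  -- The draw is then `0`, and the test of the total in `genCmd` prevents any output.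
  · have hempty := (Set.ncard_eq_zero (finite_witnesses x)).1 h0
    have hgr : ∀ r, (g r).store = ⟨M, [], []⟩ := by
      intro r
      rw [hg, genCmd, Cmd.eval]
      simp only [htot, h0, ifLt_eq]
      exact if_neg (by simp [Expr.eval])
    refine ⟨hhalt fun r _ => by rw [hgr], fun y hy => by simp [hempty] at hy, fun _ => ?_⟩
    rw [hout]
    simp [hgr]
  · have hmax : max 1 (witnesses (MemUFA σ) x).ncard = (witnesses (MemUFA σ) x).ncard := by omega
    have hx : ∃ (A : FinNFA σ) (k : ℕ), x = A.encode k ∧ A.Unambiguous := by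
      obtain ⟨y, A, k, hx, hA, -⟩ := (Set.ncard_pos (finite_witnesses x)).1 hpos
      exact ⟨A, k, hx, hA⟩
    obtain ⟨A, k, rfl, hA⟩ := hx
    have hL := enough A k
    rw [← boundOf] at hL
    obtain ⟨ys, hys, h⟩ := A.exists_witness_list k
    obtain ⟨hnd, hmem⟩ := h hA
    have hN : (witnesses (MemUFA σ) (A.encode k)).ncard = ys.length := by
      rw [ncard_witnesses hA, ← hys, List.length_map]
    have hgr : ∀ r (hr : r < ys.length), (g r).store.word = [] ∧
        (g r).store.outs = [written (ys.reverse[r]'(by simpa using hr))] := by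
      intro r hr
      rw [hg]
      refine eval_genCmd hL (hM A k rfl).1 rfl rfl (by rw [htot]; exact hpos) ?_
      rw [← hys, ← List.map_reverse, List.getElem?_map, List.getElem?_eq_getElem (by simpa using hr)]
      rfl
    refine ⟨hhalt fun r hr => (hgr r (by omega)).1, fun y hy => ?_, fun h => ?_⟩
    · obtain ⟨r, hr, rfl⟩ := List.getElem_of_mem (List.mem_reverse.2 ((hmem y).2 hy))
      have hr' : r < ys.length := by simpa using hr
      -- The list has no duplicates and `written` is injective, so `y` comes from a single value of
      -- the draw.
      have := map_uniformOfFinset_range_apply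
        (N := max 1 (witnesses (MemUFA σ) (A.encode k)).ncard) ⟨0, by simp⟩
        (fun r => (g r).store.outs) (r := r) (by omega) fun r' hlt heq => by
          have hlt' : r' < ys.length := by omega
          simp only [(hgr r hr').2, (hgr r' hlt').2, List.cons.injEq, and_true] at heq
          have heq' := List.map_injective_iff.2 Fin.val_injective heq
          exact (List.nodup_reverse.2 hnd).getElem_inj_iff.1 heq'
      rw [hout]
      simp only [(hgr r hr').2] at this
      rw [this, hmax]
    · rw [h, Set.ncard_empty] at hpos
      exact absurd hpos (by omega)

end RAM

/-! ## Enumeration -/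

namespace RAM

namespace Expr

/-- The first node for the words of length `var 3` from the state `var 2` whose runs start with an
edge below `var 1`. -/
def chain (σ : ℕ) : Expr :=
  ite (var 1) (const 1) (const 0) <|
    ite (const 0) (and (edge σ (var 2) (pred (var 1)))
        (cell 3 (pred (var 3)) (target (pred (var 1))) (numEdges σ) (const 0)))
      (flat (var 3) (var 2) (pred (var 1)) (const 0) 5)
      (cell 7 (var 3) (var 2) (pred (var 1)) (const 0))

/-- The first node for the continuations after the edge `var 1`. -/
def child (σ : ℕ) : Expr := cell 7 (pred (var 3)) (target (var 1)) (numEdges σ) (const 0)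

end Expr

/-- Construct the linked structure of all words, whose nodes are the corresponding cells of the
tables number 5, 6 and 7. -/
def link (σ : ℕ) : Cmd :=
  .seq (.fill 7 (.chain σ)) <| .seq (.fill 5 (.letter (.var 1))) (.fill 6 (.child σ))

section

variable {σ : ℕ} {A : FinNFA σ} {k L : ℕ}

/-- The first node for the words of length `i + 1` from `q` whose runs start with an edge below a
given one. -/
def firstNode (A : FinNFA σ) (L i q : ℕ) : ℕ → ℕ
  | 0 => 0
  | e + 1 => if A.edge q e = true ∧ A.wordList i (e % A.n) (σ * A.n) ≠ [] then
      flat L (i + 1) q e 0 5 else firstNode A L i q e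

/-- The tables number 5, 6 and 7 contain the linked structure of all words. -/
structure Linked (A : FinNFA σ) (k L : ℕ) (M : ℕ → ℕ) : Prop where
  letter : ∀ i < k, ∀ q < A.n, ∀ e < σ * A.n, M (flat L (i + 1) q e 0 5) = e / A.n
  child : ∀ i < k, ∀ q < A.n, ∀ e < σ * A.n,
    M (flat L (i + 1) q e 0 6) = M (flat L i (e % A.n) (σ * A.n) 0 7)
  next : ∀ i < k, ∀ q < A.n, ∀ e ≤ σ * A.n, M (flat L (i + 1) q e 0 7) = firstNode A L i q e

/-- The node of the edge `e` is its cell in table 5; the next two addresses are the corresponding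
cells of the tables 6 and 7. The cell in table 7 holds the first node among the edges below `e`,
which is just the pointer to the alternatives. Edges without continuations get no place in the
chain, as `Repr` requires. -/
theorem Linked.repr_succ {M : ℕ → ℕ} (hL : Enough σ A k L) (hM : Linked A k L M) {i q : ℕ}
    (hi : i < k) (hq : q < A.n)
    (h : ∀ q' < A.n, A.wordList i q' (σ * A.n) ≠ [] →
      Repr M (flat L L 0 0 0 0) i (M (flat L i q' (σ * A.n) 0 7)) (A.wordList i q' (σ * A.n))) :
    ∀ {e}, e ≤ σ * A.n →
      Repr M (flat L L 0 0 0 0) (i + 1) (firstNode A L i q e) (A.wordList (i + 1) q e) := by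
  have hLn := hL.states
  have hLe := hL.edges
  have hLk := hL.words
  have hLt := hL.tables
  intro e
  induction e with
  | zero =>
    intro _
    rw [firstNode, FinNFA.wordList]
    exact .nil i
  | succ e ih =>
    intro he
    have hm : e % A.n < A.n := Nat.mod_lt e A.start.pos
    rw [FinNFA.wordList, firstNode]
    generalize hws : A.wordList i (e % A.n) (σ * A.n) = ws
    split_ifs with h1 h2 h2
    · have hp : flat L (i + 1) q e 0 5 + 2 < flat L L 0 0 0 0 :=
        mul_add_lt_mul_add 0 (show 7 < L by omega)
          (idx_lt_of_fst (by omega) (by omega) (by omega) (by omega))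
      have hch := h _ hm (by rw [hws]; exact h1.2)
      rw [hws, ← hM.child i hi q hq e he] at hch
      have hc := Repr.cons (M := M) (p := flat L (i + 1) q e 0 5) (by simp [flat]) hp hch h1.2
        ((hM.next i hi q hq e (by omega)).symm ▸ ih (by omega))
      rwa [hM.letter i hi q hq e he] at hc
    · exact absurd h1.1 h2
    · have : ws = [] := by
        by_contra h
        exact h1 ⟨h2, h⟩
      rw [this]
      exact ih (by omega)
    · exact ih (by omega)

theorem Linked.repr {M : ℕ → ℕ} (hL : Enough σ A k L) (hM : Linked A k L M) {i : ℕ} (hi : i ≤ k) :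
    ∀ q < A.n, A.wordList i q (σ * A.n) ≠ [] →
      Repr M (flat L L 0 0 0 0) i (M (flat L i q (σ * A.n) 0 7)) (A.wordList i q (σ * A.n)) := by
  induction i with
  | zero =>
    intro q _ hne
    rw [FinNFA.wordList] at hne ⊢
    split_ifs at hne ⊢
    -- A pointer for words of length `0` is never followed, so the content of table 7 at level `0`
    -- does not matter.
    · exact .zero _
    · exact absurd rfl hne
  | succ i ih =>
    intro q hq _
    rw [hM.next i hi q hq _ le_rfl]
    exact hM.repr_succ hL hi hq (ih (by omega)) le_rfl

/-- Whether an edge has a continuation is read from the counts in table 3, which the filling of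
table 7 leaves intact. -/
theorem chain_fill (hL : Enough σ A k L) {env : List ℕ} {s : Store} (hs : Counted A k L s.mem) :
    ∀ i < k, ∀ q < A.n, ∀ e ≤ σ * A.n, ((Cmd.fill 7 (.chain σ)).eval (A.encode k) L env s).mem
      (flat L (i + 1) q e 0 7) = firstNode A L i q e := by
  have hn : 0 < A.n := A.start.pos
  have hLn := hL.states
  have hLe := hL.edges
  have hLk := hL.words
  have hLt := hL.tables
  have key := (Cmd.eval_fill (x := A.encode k) (L := L) (j := 7) (e := .chain σ) (env := env)
    (s := s) (by omega)
    (fun i q e d v => ∀ i', i = i' + 1 → i' < k → q < A.n → e ≤ σ * A.n → d = 0 →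
      v = firstNode A L i' q e) ?_).1
  · intro i hi q hq e he
    exact key (i + 1) (by omega) q (by omega) e (by omega) 0 (by omega) i rfl hi hq he rfl
  · rintro _ hi q hq e he d hd M hMs ih i rfl hik hqn hen rfl
    have hM : Counted A k L M := hs.congr hLt fun p hp => hMs p (by omega)
    set v := 0 :: e :: q :: (i + 1) :: env with hv
    have hpe : (Expr.pred (.var 1)).eval (A.encode k) L M v = e - 1 := Expr.eval_pred he.le
    have hpi : (Expr.pred (.var 3)).eval (A.encode k) L M v = i := Expr.eval_pred hi.le
    have htar : (Expr.target (.pred (.var 1))).eval (A.encode k) L M v = (e - 1) % A.n := by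
      rw [Expr.eval_target hL (by omega), hpe]
    simp only [Expr.chain, Expr.eval, Expr.eval_and, Expr.eval_edge hL,
      Expr.eval_cell, Expr.eval_flat, Expr.eval_numEdges hL, hpe, hpi, htar]
    rw [ifLt_eq, ifLt_eq]
    simp only [hv, List.getD_cons_zero, List.getD_cons_succ, pos_and_iff, pos_toNat_iff]
    cases e with
    | zero => rw [if_pos (by omega), firstNode]
    | succ e =>
      rw [if_neg (by omega), firstNode]
      simp only [Nat.add_sub_cancel]
      rw [hM i hik.le _ (Nat.mod_lt e hn) _ le_rfl 0 (by omega),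
        ih (i + 1) (by omega) q (by omega) e (by omega) 0 (by omega)
          (idx_lt_of_trd (by omega) (by omega)) i rfl hik hqn (by omega) rfl]
      simp only [List.length_pos_iff]

end

/-! ### The precomputation phase, and the two phases together -/

/-- The precomputation of the enumeration. -/
def enumCmd (σ : ℕ) : Cmd := .seq (prepare σ) (link σ)

theorem eval_enumCmd (σ : ℕ) (x : List Bool) :
    Prepared σ x (boundOf σ x) ((enumCmd σ).eval x (boundOf σ x) [] .init).mem ∧
    (∀ (A : FinNFA σ) k, x = A.encode k →
      Linked A k (boundOf σ x) ((enumCmd σ).eval x (boundOf σ x) [] .init).mem) ∧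
    ((enumCmd σ).eval x (boundOf σ x) [] .init).word = [] ∧
    ((enumCmd σ).eval x (boundOf σ x) [] .init).outs = [] := by
  have hLt := (le_boundOf σ x).2.2
  obtain ⟨p, pw, po⟩ := prepared_prepare (σ := σ) (x := x) (s := .init) (env := [])
  simp only [enumCmd, link, Cmd.eval]
  set s₁ := (prepare σ).eval x (boundOf σ x) [] .init
  obtain ⟨f2, w2, o2⟩ := Cmd.eval_fill_frame (x := x) (L := boundOf σ x) (j := 7) (e := .chain σ)
    (env := []) (s := s₁) (by omega)
  set s₂ := (Cmd.fill 7 (.chain σ)).eval x (boundOf σ x) [] s₁ with hs₂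
  have h3 := Cmd.eval_fill (x := x) (L := boundOf σ x) (j := 5) (e := .letter (.var 1))
    (env := []) (s := s₂) (by omega) (fun _ _ e _ v => ∀ (A : FinNFA σ) k, x = A.encode k →
      v = e / A.n) fun i hi q hq e he d hd M _ _ A k hx => by
        subst hx
        have hL := enough A k
        rw [← boundOf] at hL
        exact Expr.eval_letter hL he.le
  obtain ⟨h3, f3, w3, o3⟩ := h3
  set s₃ := (Cmd.fill 5 (.letter (.var 1))).eval x (boundOf σ x) [] s₂ with hs₃
  -- Table 7 is complete by now, so the pointers to continuations are copied from it.
  have h4 := Cmd.eval_fill (x := x) (L := boundOf σ x) (j := 6) (e := .child σ)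
    (env := []) (s := s₃) (by omega) (fun i _ e _ v => ∀ (A : FinNFA σ) k, x = A.encode k →
      v = s₃.mem (flat (boundOf σ x) (i - 1) (e % A.n) (σ * A.n) 0 7))
      fun i hi q hq e he d hd M hM _ A k hx => by
        subst hx
        have hL := enough A k
        rw [← boundOf] at hL
        have htar : (Expr.target (.var 1)).eval (A.encode k) (boundOf σ (A.encode k)) M
          [d, e, q, i] = e % A.n := Expr.eval_target hL he.le
        rw [Expr.child, Expr.eval_cell, Expr.eval_pred (a := .var 3) hi.le, htar,
          Expr.eval_numEdges hL, hM _ (by rw [flat_mod] <;> omega)]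
        rfl
  obtain ⟨h4, f4, w4, o4⟩ := h4
  set s₄ := (Cmd.fill 6 (.child σ)).eval x (boundOf σ x) [] s₃ with hs₄
  have p2 : Prepared σ x (boundOf σ x) s₄.mem := p.congr hLt fun p hp => by
    rw [f4 p (by omega), f3 p (by omega), f2 p (by omega)]
  refine ⟨p2, fun A k hx => ?_, by rw [w4, w3, w2, pw]; rfl, by rw [o4, o3, o2, po]; rfl⟩
  have hL : Enough σ A k (boundOf σ x) := by rw [hx]; exact enough A k
  have hLn := hL.states
  have hLe := hL.edges
  have hLk := hL.words
  refine ⟨fun i hi q hq e he => ?_, fun i hi q hq e he => ?_, fun i hi q hq e he => ?_⟩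
  · rw [f4 _ (by rw [flat_mod] <;> omega)]
    exact h3 _ (by omega) _ (by omega) _ (by omega) _ (by omega) A k hx
  · exact (h4 (i + 1) (by omega) q (by omega) e (by omega) 0 (by omega) A k hx).trans
      (f4 _ (by rw [flat_mod] <;> omega)).symm
  · rw [f4 _ (by rw [flat_mod] <;> omega), f3 _ (by rw [flat_mod] <;> omega), hs₂]
    subst hx
    exact chain_fill hL (p A k rfl).1 i hi q hq e he

/-- The program that puts the values of expressions into consecutive registers. -/
def evalAll : List Expr → ℕ → Stm
  | [], _ => .skip
  | e :: es, d => e.code [] d ;; evalAll es (d + 1)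

noncomputable def evalAllCost : List Expr → Polynomial ℕ
  | [] => 0
  | e :: es => e.cost + evalAllCost es

theorem reach_evalAll (x : List Bool) {L : ℕ} (es : List Expr) : ∀ {d : ℕ} {s : St}, 0 < d →
    s.reg 0 = L → Reach x (evalAll es d) s ((evalAllCost es).eval L) fun s' =>
      (∀ j, (h : j < es.length) → s'.reg (d + j) = es[j].eval x L s.mem []) ∧
      (∀ r < d, s'.reg r = s.reg r) ∧ s'.mem = s.mem ∧ s'.word = s.word ∧ s'.log = s.log := by
  induction es with
  | nil =>
    intro d s _ _
    exact ⟨s, .skip s, by simp, by simp⟩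
  | cons e es ih =>
    intro d s hd h0
    rw [evalAllCost, Polynomial.eval_add]
    refine (e.reach_code x [] d s hd (by simp) h0).seq fun s₁ h₁ =>
      (ih (d := d + 1) (s := s₁) (by omega) ((h₁.low 0 hd).trans h0)).mono
        le_rfl fun s' ⟨h, hlow, hm, hw, hl⟩ => ?_
    refine ⟨fun j hj => ?_, fun r hr => ?_, hm.trans h₁.mem, hw.trans h₁.word, hl.trans h₁.log⟩
    · cases j with
      | zero => exact (hlow d (by omega)).trans h₁.reg
      | succ j =>
        have := h j (by simpa using hj)
        rw [h₁.mem] at this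
        rw [show d + (j + 1) = d + 1 + j by omega, this]
        rfl
    · exact (hlow r (by omega)).trans (h₁.low r hr)

namespace Expr

/-- An address beyond all tables. -/
def tablesEnd : Expr := flat bound (const 0) (const 0) (const 0) 0

/-- The parameters of the enumeration phase. -/
def params (σ : ℕ) : List Expr :=
  [tablesEnd, add tablesEnd (wordLength σ), cell 7 (wordLength σ) initial (numEdges σ) (const 0),
    total σ]

end Expr

def precompute (σ : ℕ) : Stm := program σ (enumCmd σ) ;; evalAll (Expr.params σ) 1

noncomputable def precomputeCost (σ : ℕ) : Polynomial ℕ :=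
  programCost σ (enumCmd σ) + (evalAllCost (Expr.params σ)).comp (boundPoly σ)

/-- After the precomputation, the memory contains a representation of the list of the witnesses. -/
theorem reach_precompute (σ : ℕ) (x : List Bool) :
    Reach x (precompute σ) .init ((precomputeCost σ).eval x.length) fun s =>
      s.word = [] ∧ s.log = [] ∧ ∃ (S k : ℕ) (ys : List (List (Fin σ))),
        s.reg 1 = S ∧ s.reg 2 = S + k ∧ ys.Nodup ∧ (∀ y, y ∈ ys ↔ y ∈ witnesses (MemUFA σ) x) ∧
        (s.reg 4 = 0 ∧ ys.map written = [] ∨ 0 < s.reg 4 ∧ ys.map written ≠ [] ∧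
          Repr s.mem S k (s.reg 3) (ys.map written)) := by
  obtain ⟨hp, hlink, hw, ho⟩ := eval_enumCmd σ x
  rw [precomputeCost, Polynomial.eval_add, Polynomial.eval_comp, eval_boundPoly]
  refine (reach_program σ (enumCmd σ) x).seq fun s ⟨hst, h0⟩ =>
    (reach_evalAll x (Expr.params σ) (d := 1) (by omega) h0).mono le_rfl fun s' ⟨hr, _, hm, hw', hl'⟩ => ?_
  rw [← hst] at hp hlink hw ho
  change Prepared σ x _ s.mem at hp
  change ∀ A k, _ → Linked A k _ s.mem at hlink
  refine ⟨hw'.trans hw, hl'.trans (log_eq_nil_of_store ho), flat (boundOf σ x) (boundOf σ x) 0 0 0 0, ?_⟩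
  have h1 : s'.reg 1 = flat (boundOf σ x) (boundOf σ x) 0 0 0 0 :=
    (hr 0 (by simp [Expr.params])).trans Expr.eval_flat
  have h2 := hr 1 (by simp [Expr.params])
  have h3 := hr 2 (by simp [Expr.params])
  have h4 := hr 3 (by simp [Expr.params])
  simp only [Expr.params, List.getElem_cons_succ, List.getElem_cons_zero, Expr.eval,
    Expr.eval_cell] at h2 h3 h4
  rw [show Expr.tablesEnd.eval x (boundOf σ x) s.mem [] = flat (boundOf σ x) (boundOf σ x) 0 0 0 0
    from Expr.eval_flat] at h2
  rcases eval_total hp [] with ⟨A, k, rfl, hA, ht⟩ | ⟨ht, hempty⟩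
  · have hL := enough A k
    rw [← boundOf] at hL
    obtain ⟨ys, hys, h⟩ := A.exists_witness_list k
    obtain ⟨hnd, hmem⟩ := h hA
    rw [Expr.eval_wordLength_encode hL] at h2 h3
    rw [Expr.eval_initial hL, Expr.eval_numEdges hL] at h3
    refine ⟨k, ys, h1, h2, hnd, hmem, ?_⟩
    rw [hys, show s'.reg 4 = _ from h4, ht, show s'.reg 3 = _ from h3, hm]
    -- An unambiguous automaton may accept no word of length `k`; the zero in register `4` then
    -- stops the enumeration phase before it follows any pointer.
    by_cases hne : A.wordList k A.start (σ * A.n) = []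
    · exact .inl ⟨by rw [hne]; rfl, hne⟩
    · refine .inr ⟨List.length_pos_iff.2 hne, hne, ?_⟩
      exact (hlink A k rfl).repr hL le_rfl _ A.start.2 hne
  · exact ⟨_, [], h1, h2, List.nodup_nil, by simp [hempty], .inl ⟨h4.trans ht, rfl⟩⟩

theorem enumConstantDelay_memUFA (σ : ℕ) : EnumConstantDelay (MemUFA σ) := by
  -- The constant satisfies `15 * k + 20 ≤ 35 * max 1 k`, and it exceeds the `10` steps allowed when
  -- there is no witness.
  refine ⟨(precompute σ).code 0, enumerate.code 0, precomputeCost σ, 35, fun x => ?_⟩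
  intro s
  obtain ⟨s₁, hs₁, hB, hw, hl, S, k, ys, h1, h2, hnd, hmem, hR⟩ := reach_precompute σ x
  have hs : s = s₁.at (precompute σ).size := hs₁.run_eq hB
  clear_value s
  subst hs
  refine ⟨⟨by simp [St.at], hw⟩, hl, ?_⟩
  obtain ⟨s', hs', hw', hl', hlen, hnil, hD⟩ := exec_enumerate (x := x)
    (s := ⟨s₁.reg, s₁.mem, [], [], 0⟩) h1 h2 hR rfl rfl rfl
  refine ⟨s'.clock, ?_⟩
  intro f
  have hf : f = s'.at enumerate.size := hs'.run_eq (by simp)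
  clear_value f
  subst hf
  refine ⟨⟨by simp [St.at], hw'⟩, ⟨ys, hnd, hmem, hl'⟩, ?_⟩
  by_cases hne : ys.map written = []
  · have hlog : s'.log = [] := by rwa [hne, List.map_eq_nil_iff] at hl'
    have := hnil hne
    refine ⟨?_, ?_, ?_, fun _ => ?_⟩ <;> simp [St.at, hlog]
    omega
  · refine (hD hne).delaysBoundedBy (f := s'.at enumerate.size) le_rfl (fun h => hne ?_)
      fun e he => ?_
    · rw [← hl', show s'.log = [] from h, List.map_nil]
    · rw [hlen e.1 (hl' ▸ List.mem_map_of_mem he)]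
      omega

end RAM

theorem mainTheorem8 (σ : ℕ) :
    EnumConstantDelay (MemUFA σ) ∧ CountPolyTime (MemUFA σ) ∧ GenPolyTime (MemUFA σ) :=
  ⟨RAM.enumConstantDelay_memUFA σ, RAM.countPolyTime_memUFA σ, RAM.genPolyTime_memUFA σ⟩
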